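/- Consider the infinite strip $\{(x,y)\in\mathbb{R}^2 : 0\le x\le 1\}$ of unit width, whose shores are the lines $x=0$ and $x=1$. A swimmer starts at a random point whose $x$-coordinate is uniformly distributed on $[0,1]$ (the distribution of the $y$-coordinate is arbitrary); her initial heading $\theta$ (the angle from the $x$-axis) is independent of the starting point and uniformly distributed on $[-\pi,\pi]$. For $r\ge 0$ and $0\le\alpha\le\pi$, the 2-segment path with parameters $(r,\alpha)$ goes a distance $r$ in the direction $\theta$ and then straight on forever in the direction $\theta+\alpha+\pi$; thus $\alpha$ is the angle enclosed by the two segments ($\alpha=\pi$: no turn, $\alpha=0$: reversal). Let $E(r,\alpha)\in[0,\infty]$ be the expected length of the path up to the first time it reaches a shore. (a) If $r>1$ and $0<\frac{\pi}{2}-\alpha<\arccos(1/r)$, then $E(r,\alpha)$ is finite and $$\begin{aligned} \pi\,E(r,\alpha) ={}& r \left[(1 + \cos \alpha) \left(\tfrac{\pi}{2} + \sqrt{r^2 - 1} - r \right) - (2 + \cos \alpha) \arccos \left(\tfrac{1}{r} \right) + \tfrac{\pi}{2} \right] \\ &+ \ln \left(\sqrt{r^2 - 1} + r \right) + \tfrac{1}{2}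 r^2 \ln(1 - \cos \alpha) \sin^2 \alpha + r \sin \alpha \ln \left(\frac{\sqrt{r^2 - 1} \sin \alpha - \cos \alpha}{r \sin \alpha} \right) \\ &+ \tfrac{1}{4} (r^2 \sin^2 \alpha + 1) \ln \left(\sqrt{r^2 - 1} \cos \alpha + \sin \alpha + r \right) \\ &+ \tfrac{1}{4} (r^2 \sin^2 \alpha - 1) \ln \left(\sqrt{r^2 - 1} \cos \alpha - \sin \alpha + r \right) \\ &- \tfrac{1}{4} (r^2 \sin^2 \alpha + 1) \ln \left[-\sqrt{r^2 - 1} \cos^2 \alpha - \left(\sin \alpha + \sqrt{r^2 - 1} - r \right) \cos \alpha - \sin \alpha + r \right] \\ &- \tfrac{1}{4} (r^2 \sin^2 \alpha - 1) \ln \left[-\sqrt{r^2 - 1} \cos^2 \alpha + \left(\sin \alpha - \sqrt{r^2 - 1} + r \right) \cos \alpha + \sin \alpha + r \right]. \end{aligned}$$ (b) Among all $r\ge 0$ and $0\le\alpha\le\pi$, the expected escape length $E(r,\alpha)$ has a unique minimizer $(r_0,\alpha_0)$. It satisfies $r_0>1$ and $0<\frac{\pi}{2}-\alpha_0<\arccos(1/r_0)$,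 and $$r_0 = 1.0432668686\ldots,\qquad \alpha_0 = 1.3734935859\ldots,\qquad E(r_0,\alpha_0)=0.8869669056\ldots,$$ where the decimals shown are the first ten, truncated. -/

import Mathlib

open Real Set MeasureTheory
open scoped ENNReal

noncomputable section

namespace LostAtSea

/-- The two shores of the strip of all `(x, y)` with `0 ≤ x ≤ 1`. -/
def shore : Set (ℝ × ℝ) := {p | p.1 = 0 ∨ p.1 = 1}

/-- The unit vector at angle `θ` from the `x`-axis. -/
def direction (θ : ℝ) : ℝ × ℝ := (cos θ, sin θ)

/-- The unit-speed 2-segment path from `z`: go a distance `r` in the direction `θ`, then go straight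
on in the direction `θ + α + π`. Thus the two segments enclose the angle `α` at the corner
(`α = π`: no turn, `α = 0`: reversal). -/
def twoSegmentPath (r α θ : ℝ) (z : ℝ × ℝ) (t : ℝ) : ℝ × ℝ :=
  if t ≤ r then z + t • direction θ
  else z + r • direction θ + (t - r) • direction (θ + α + π)

/-- The length of the path up to its first visit to a shore (`∞` if there is none). -/
def escapeLength (r α θ : ℝ) (z : ℝ × ℝ) : ℝ≥0∞ :=
  ⨅ (t : ℝ) (_ : 0 ≤ t ∧ twoSegmentPath r α θ z t ∈ shore), ENNReal.ofReal t

/-- The uniform probability distribution on the interval `[a, b]`. -/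
def uniform (a b : ℝ) : Measure ℝ := ProbabilityTheory.cond volume (Icc a b)

/-- `μ` is a possible distribution of the initial position: the `x`-coordinate is uniform on
`[0, 1]`, the `y`-coordinate is arbitrary. -/
def IsStartLaw (μ : Measure (ℝ × ℝ)) : Prop :=
  IsProbabilityMeasure μ ∧ μ.map Prod.fst = uniform 0 1

/-- The expected escape length when the initial position has the distribution `μ` and the initial
heading is independent of it and uniform on `[-π, π]`. -/
def expectedEscapeLength (μ : Measure (ℝ × ℝ)) (r α : ℝ) : ℝ≥0∞ :=
  ∫⁻ p : (ℝ × ℝ) × ℝ, escapeLength r α p.2 p.1 ∂(μ.prod (uniform (-π) π))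

/-- The closed form of `π` times the expected escape length. -/
def closedForm (r α : ℝ) : ℝ :=
  r * ((1 + cos α) * (π / 2 + √(r ^ 2 - 1) - r) - (2 + cos α) * arccos (1 / r) + π / 2)
  + log (√(r ^ 2 - 1) + r)
  + 1 / 2 * r ^ 2 * log (1 - cos α) * sin α ^ 2
  + r * sin α * log ((√(r ^ 2 - 1) * sin α - cos α) / (r * sin α))
  + 1 / 4 * (r ^ 2 * sin α ^ 2 + 1) * log (√(r ^ 2 - 1) * cos α + sin α + r)
  + 1 / 4 * (r ^ 2 * sin α ^ 2 - 1) * log (√(r ^ 2 - 1) * cos α - sin α + r)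
  - 1 / 4 * (r ^ 2 * sin α ^ 2 + 1)
    * log (-√(r ^ 2 - 1) * cos α ^ 2 - (sin α + √(r ^ 2 - 1) - r) * cos α - sin α + r)
  - 1 / 4 * (r ^ 2 * sin α ^ 2 - 1)
    * log (-√(r ^ 2 - 1) * cos α ^ 2 + (sin α - √(r ^ 2 - 1) + r) * cos α + sin α + r)

end LostAtSea

end

/-!
Throughout `δ = π / 2 - α` and `β = arccos (1 / r)`.

Only the abscissa of the swimmer matters. For a heading `θ` with `cos θ > 0` the horizontal velocity
is `cos θ` on the first segment and `sin (θ - δ)` on the second one, and the other headings are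
mirror images of these. Averaging over the abscissa is elementary (`lintegral_exitTime`) and leaves
one integral over `θ` (`expectedEscapeLength_eq_lintegral_headingMean`). It diverges like
`∫ 1 / |θ - δ|` if the second segment can be parallel to the shores while the first one has not
reached them, that is, if `r * cos δ < 1` (`expectedEscapeLength_eq_top`). In the remaining case
`r ≥ 1`, `|δ| ≤ β` the headings `θ` and `-θ` together contribute `1 / cos θ` for `θ < β` and

`2 r - r² cos θ + (1 - r cos θ)² / (2 sin (θ - δ)) + (1 - r² cos² θ) / (2 sin (θ + δ))`

for `θ > β`. Since `(1 - r cos θ)² ≤ 1 - r² cos² θ`, replacing `δ > 0` by `-δ` makes this larger, so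
only `0 ≤ δ ≤ β` matters. There the integral is elementary: `total = mainPart + turnPart`, where
`turnPart` comes from the term with `sin (θ - δ)`. It agrees with the closed form because all
arguments of the logarithms in the latter factor (`total_eq_closedForm`).

The heart of the matter is that `total` is strongly convex for `1 < r ≤ 85 / 77`, `0 ≤ δ ≤ β`.
For `turnPart` convexity holds pointwise under the integral: `x² / y` is jointly convex,
`x = 1 - r cos θ` is linear in `(r, δ)` and `y = sin (θ - δ)` is concave; the integrand vanishes
beyond `r cos θ = 1`, and the convexity survives this because `arccos (1 / r)` is concave
(`turnPart_convex`). The Hessian of `mainPart` is bounded below by `0.05` (`mainDeriv_posDef`): in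
the half-angle variables `t = tan (β / 2)` and `L = tan (δ / 2) / t`, and with the only remaining
logarithm estimated by tangents, this becomes a set of polynomial inequalities on the rectangle
`0 < t ≤ 2 / 9`, `0 < L ≤ 1`.

Strong convexity gives `total z ≥ total p + ∇ total p · (z - p) + 0.025 |z - p|²`. At a point `p`
with rational `tan (β / 2)` and `tan (δ / 2)` the value and the gradient are explicit in terms of
`π`, one arctangent and four logarithms, and the gradient turns out to be of size `1e-13` at most
(`total_bounds`). So all points with `total z ≤ total p` lie in a box of half width `6e-12` around
`p`; by compactness `total` has a minimizer there, and by strong convexity it is unique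
(`exists_minimizer_total`). For `r > 85 / 77` the inequality `1 / a ≥ 2 m - m² a` turns the integrand
into a trigonometric polynomial and shows that the expected length is larger
(`lt_expectedEscapeLength_of_large`). The point `r = 1`, `δ = 0` is checked directly.
-/

noncomputable section

namespace LostAtSea

/-! ### The mean escape length for a fixed heading, and integration over the headings -/

/-- For a path with horizontal velocity `c > 0` up to time `r` and `v ≠ 0` afterwards, the time it
takes to reach a shore from the abscissa `x ∈ (0, 1)`. -/
def exitTime (r c v x : ℝ) : ℝ :=
  if 1 ≤ x + r * c then (1 - x) / c
  else if 0 < v then r + (1 - x - r * c) / v else r + (x + r * c) / (-v)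

lemma escapeLength_eq_of_isLeast {r α θ s : ℝ} {z : ℝ × ℝ} (h0 : 0 ≤ s)
    (hs : twoSegmentPath r α θ z s ∈ shore)
    (hmin : ∀ t, 0 ≤ t → twoSegmentPath r α θ z t ∈ shore → s ≤ t) :
    escapeLength r α θ z = ENNReal.ofReal s := by
  refine le_antisymm (iInf₂_le s ⟨h0, hs⟩) (le_iInf₂ fun t ht => ?_)
  exact ENNReal.ofReal_le_ofReal (hmin t ht.1 ht.2)

lemma twoSegmentPath_fst (r α θ : ℝ) (z : ℝ × ℝ) (t : ℝ) :
    (twoSegmentPath r α θ z t).1 =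
      if t ≤ r then z.1 + t * cos θ else z.1 + r * cos θ + (t - r) * (-cos (θ + α)) := by
  unfold twoSegmentPath direction
  split_ifs <;> simp [cos_add_pi]

lemma escapeLength_of_cos_pos {r α θ : ℝ} {z : ℝ × ℝ} (hr : 0 ≤ r) (hc : 0 < cos θ)
    (hv : cos (θ + α) ≠ 0) (h0 : 0 < z.1) (h1 : z.1 < 1) :
    escapeLength r α θ z = ENNReal.ofReal (exitTime r (cos θ) (-cos (θ + α)) z.1) := by
  set c := cos θ
  set v := -cos (θ + α) with hvdef
  have hv0 : v ≠ 0 := neg_ne_zero.mpr hv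
  have hmem : ∀ t, twoSegmentPath r α θ z t ∈ shore ↔
      ((if t ≤ r then z.1 + t * c else z.1 + r * c + (t - r) * v) = 0 ∨
        (if t ≤ r then z.1 + t * c else z.1 + r * c + (t - r) * v) = 1) := by
    intro t
    rw [← twoSegmentPath_fst]; rfl
  unfold exitTime
  split_ifs with hA hB
  · have hle : (1 - z.1) / c ≤ r := by rw [div_le_iff₀ hc]; linarith
    apply escapeLength_eq_of_isLeast (div_nonneg (by linarith) hc.le)
    · rw [hmem, if_pos hle]
      right; field_simp; ring
    · intro t ht hts
      by_cases htr : t ≤ r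
      · rw [hmem, if_pos htr] at hts
        rw [div_le_iff₀ hc]
        rcases hts with h | h
        · nlinarith [mul_nonneg ht hc.le]
        · linarith
      · linarith
  · push Not at hA
    have hpos : 0 < (1 - z.1 - r * c) / v := div_pos (by linarith) hB
    apply escapeLength_eq_of_isLeast (by linarith)
    · rw [hmem, if_neg (by linarith)]
      right; field_simp; ring
    · intro t ht hts
      by_cases htr : t ≤ r
      · rw [hmem, if_pos htr] at hts
        have : t * c ≤ r * c := mul_le_mul_of_nonneg_right htr hc.le
        have := mul_nonneg ht hc.le
        rcases hts with h | h <;> linarith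
      · rw [hmem, if_neg htr] at hts
        push Not at htr
        have h3 : 0 < (t - r) * v := mul_pos (by linarith) hB
        have h4 := mul_nonneg hr hc.le
        have : (1 - z.1 - r * c) / v ≤ t - r := by
          rw [div_le_iff₀ hB]
          rcases hts with h | h <;> linarith
        linarith
  · push Not at hA hB
    have hvn : 0 < -v := by
      rcases lt_or_eq_of_le hB with h | h
      · linarith
      · exact absurd h hv0
    have hrc := mul_nonneg hr hc.le
    have hpos : 0 < (z.1 + r * c) / (-v) := div_pos (by linarith) hvn
    apply escapeLength_eq_of_isLeast (by linarith)
    · rw [hmem, if_neg (by linarith)]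
      left; field_simp; ring
    · intro t ht hts
      by_cases htr : t ≤ r
      · rw [hmem, if_pos htr] at hts
        have : t * c ≤ r * c := mul_le_mul_of_nonneg_right htr hc.le
        have := mul_nonneg ht hc.le
        rcases hts with h | h <;> linarith
      · rw [hmem, if_neg htr] at hts
        push Not at htr
        have h3 : 0 < (t - r) * (-v) := mul_pos (by linarith) hvn
        have : (z.1 + r * c) / (-v) ≤ t - r := by
          rw [div_le_iff₀ hvn]
          rcases hts with h | h <;> linarith
        linarith

/-- Reflecting the strip in its midline turns a path with heading `θ` into one with horizontal
velocities of heading `θ + π`. -/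
lemma escapeLength_reflect (r α θ : ℝ) (z : ℝ × ℝ) :
    escapeLength r α θ z = escapeLength r α (θ + π) (1 - z.1, z.2) := by
  unfold escapeLength
  have : ∀ t, twoSegmentPath r α θ z t ∈ shore ↔
      twoSegmentPath r α (θ + π) (1 - z.1, z.2) t ∈ shore := by
    intro t
    have h1 := twoSegmentPath_fst r α θ z t
    have h2 := twoSegmentPath_fst r α (θ + π) (1 - z.1, z.2) t
    have h3 : cos (θ + π + α) = -cos (θ + α) := by
      rw [← cos_add_pi]; ring_nf
    rw [cos_add_pi, h3] at h2
    have h4 : (twoSegmentPath r α (θ + π) (1 - z.1, z.2) t).1 =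
        1 - (twoSegmentPath r α θ z t).1 := by
      rw [h1, h2]; split_ifs <;> ring
    change (_ ∨ _) ↔ (_ ∨ _)
    rw [h4]
    constructor <;> rintro (h | h)
    · right; linarith
    · left; linarith
    · right; linarith
    · left; linarith
  simp only [this]

/-- The escape length as an explicit measurable function of the abscissa and the heading, valid
unless one of the two segments is parallel to the shores. Headings with `cos θ < 0` are reduced to
the opposite ones by reflecting the strip. -/
def escapeFun (r α : ℝ) (p : ℝ × ℝ) : ℝ≥0∞ :=
  if 0 < cos p.2 then ENNReal.ofReal (exitTime r (cos p.2) (-cos (p.2 + α)) p.1)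
  else ENNReal.ofReal (exitTime r (-cos p.2) (cos (p.2 + α)) (1 - p.1))

lemma measurable_exitTime {β : Type*} [MeasurableSpace β] (r : ℝ) {c v x : β → ℝ}
    (hc : Measurable c) (hv : Measurable v) (hx : Measurable x) :
    Measurable fun b => exitTime r (c b) (v b) (x b) := by
  unfold exitTime
  refine Measurable.ite (measurableSet_le (by fun_prop) (by fun_prop)) (by fun_prop) ?_
  exact Measurable.ite (measurableSet_lt (by fun_prop) (by fun_prop)) (by fun_prop) (by fun_prop)

lemma measurable_escapeFun (r α : ℝ) : Measurable (escapeFun r α) := by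
  unfold escapeFun
  refine Measurable.ite (measurableSet_lt (by fun_prop) (by fun_prop)) ?_ ?_
  · exact (measurable_exitTime r (by fun_prop) (by fun_prop) (by fun_prop)).ennreal_ofReal
  · exact (measurable_exitTime r (by fun_prop) (by fun_prop) (by fun_prop)).ennreal_ofReal

lemma escapeLength_eq_escapeFun {r α θ : ℝ} {z : ℝ × ℝ} (hr : 0 ≤ r) (hc : cos θ ≠ 0)
    (hv : cos (θ + α) ≠ 0) (h0 : 0 < z.1) (h1 : z.1 < 1) :
    escapeLength r α θ z = escapeFun r α (z.1, θ) := by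
  unfold escapeFun
  dsimp only
  split_ifs with h
  · exact escapeLength_of_cos_pos hr h hv h0 h1
  · have hc' : 0 < cos (θ + π) := by
      rw [cos_add_pi]
      rcases lt_or_gt_of_ne hc with h' | h'
      · linarith
      · exact absurd h' h
    have h3 : cos (θ + π + α) = -cos (θ + α) := by
      rw [← cos_add_pi]; ring_nf
    rw [escapeLength_reflect, escapeLength_of_cos_pos hr hc' (by rw [h3]; exact neg_ne_zero.mpr hv)
      (by simpa using h1) (by simpa using h0), h3, cos_add_pi, neg_neg]

lemma volume_setOf_cos_add_eq_zero (a : ℝ) : volume {θ : ℝ | cos (θ + a) = 0} = 0 := by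
  have : {θ : ℝ | cos (θ + a) = 0} ⊆ range fun k : ℤ => (2 * (k : ℝ) + 1) * π / 2 - a := by
    intro θ hθ
    obtain ⟨k, hk⟩ := cos_eq_zero_iff.mp hθ
    exact ⟨k, by dsimp only; linarith⟩
  exact ((countable_range _).mono this).measure_zero volume

lemma uniform_eq_smul {a b : ℝ} (hab : a < b) :
    uniform a b = ENNReal.ofReal (1 / (b - a)) • volume.restrict (Ioo a b) := by
  have h : uniform a b = (volume (Icc a b))⁻¹ • volume.restrict (Icc a b) := rfl
  rw [h, Real.volume_Icc, ← ENNReal.ofReal_inv_of_pos (by linarith),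
    Measure.restrict_congr_set (Ioo_ae_eq_Icc (a := a) (b := b) (μ := volume)).symm, one_div]

instance : IsProbabilityMeasure (uniform 0 1) := by
  constructor
  rw [uniform_eq_smul one_pos]; simp

instance : IsProbabilityMeasure (uniform (-π) π) := by
  have hp := pi_pos
  constructor
  rw [uniform_eq_smul (by linarith)]
  simp only [Measure.smul_apply, Measure.restrict_apply MeasurableSet.univ, univ_inter,
    Real.volume_Ioo, smul_eq_mul]
  rw [← ENNReal.ofReal_mul (by rw [sub_neg_eq_add]; positivity), one_div,
    inv_mul_cancel₀ (by linarith)]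
  simp

/-- The expected escape length depends on the law of the starting point only through the uniform
law of its abscissa. -/
lemma expectedEscapeLength_eq_lintegral_escapeFun {μ : Measure (ℝ × ℝ)} (hμ : IsStartLaw μ)
    {r : ℝ} (hr : 0 ≤ r) (α : ℝ) :
    expectedEscapeLength μ r α =
      ENNReal.ofReal (1 / (2 * π)) *
        ∫⁻ θ in Ioo (-π) π, ∫⁻ x in Ioo (0 : ℝ) 1, escapeFun r α (x, θ) := by
  have hp := pi_pos
  have := hμ.1
  have hmap : (μ.prod (uniform (-π) π)).map (Prod.map Prod.fst id) =
      (uniform 0 1).prod (uniform (-π) π) := by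
    have := Measure.map_prod_map μ (uniform (-π) π) (f := Prod.fst) (g := id) measurable_fst
      measurable_id
    rw [← this, hμ.2, Measure.map_id]
  have hae : ∀ᵐ p ∂((uniform 0 1).prod (uniform (-π) π)),
      (0 < p.1 ∧ p.1 < 1) ∧ cos p.2 ≠ 0 ∧ cos (p.2 + α) ≠ 0 := by
    have hx : ∀ᵐ x ∂(uniform 0 1), 0 < x ∧ x < 1 := by
      rw [uniform_eq_smul one_pos]
      refine Measure.ae_smul_measure ?_ _
      filter_upwards [ae_restrict_mem measurableSet_Ioo] with x hx using hx
    have ht : ∀ᵐ θ ∂(uniform (-π) π), cos θ ≠ 0 ∧ cos (θ + α) ≠ 0 := by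
      rw [uniform_eq_smul (by linarith)]
      refine Measure.ae_smul_measure (ae_restrict_of_ae ?_) _
      have h1 : ∀ᵐ θ : ℝ, cos (θ + 0) ≠ 0 := by
        rw [ae_iff]; simpa using volume_setOf_cos_add_eq_zero 0
      have h2 : ∀ᵐ θ : ℝ, cos (θ + α) ≠ 0 := by
        rw [ae_iff]; simpa using volume_setOf_cos_add_eq_zero α
      filter_upwards [h1, h2] with θ h1 h2
      exact ⟨by simpa using h1, h2⟩
    have hx' := Measure.quasiMeasurePreserving_fst (μ := uniform 0 1)
      (ν := uniform (-π) π) |>.ae hx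
    have ht' := Measure.quasiMeasurePreserving_snd (μ := uniform 0 1)
      (ν := uniform (-π) π) |>.ae ht
    filter_upwards [hx', ht'] with p h1 h2 using ⟨h1, h2⟩
  have hms : Measurable (Prod.map Prod.fst id : (ℝ × ℝ) × ℝ → ℝ × ℝ) :=
    measurable_fst.prodMap measurable_id
  rw [← hmap] at hae
  have hae' := ae_of_ae_map hms.aemeasurable hae
  have h1 : expectedEscapeLength μ r α =
      ∫⁻ p, escapeFun r α (Prod.map Prod.fst id p) ∂(μ.prod (uniform (-π) π)) := by
    unfold expectedEscapeLength
    refine lintegral_congr_ae ?_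
    filter_upwards [hae'] with p hp
    exact escapeLength_eq_escapeFun hr hp.2.1 hp.2.2 hp.1.1 hp.1.2
  rw [h1, ← lintegral_map (measurable_escapeFun r α) hms, hmap,
    lintegral_prod_symm _ (measurable_escapeFun r α).aemeasurable, uniform_eq_smul (by linarith),
    uniform_eq_smul one_pos, lintegral_smul_measure]
  simp only [lintegral_smul_measure, smul_eq_mul, sub_zero, div_one, ENNReal.ofReal_one, one_mul,
    sub_neg_eq_add, two_mul]

/-- The mean over `x ∈ [0, 1]` of `exitTime r c v x`, for `c > 0` and `v ≠ 0`. -/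
def meanExit (r c v : ℝ) : ℝ :=
  if 1 ≤ r * c then 1 / (2 * c)
  else r - r ^ 2 * c / 2 +
    if 0 < v then (1 - r * c) ^ 2 / (2 * v) else (1 - (r * c) ^ 2) / (2 * (-v))

lemma measurable_meanExit {β : Type*} [MeasurableSpace β] (r : ℝ) {c v : β → ℝ}
    (hc : Measurable c) (hv : Measurable v) :
    Measurable fun b => meanExit r (c b) (v b) := by
  unfold meanExit
  refine Measurable.ite (measurableSet_le (by fun_prop) (by fun_prop)) (by fun_prop) ?_
  refine Measurable.add (by fun_prop) ?_
  exact Measurable.ite (measurableSet_lt (by fun_prop) (by fun_prop)) (by fun_prop) (by fun_prop)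

/-- The fundamental theorem of calculus for a nonnegative derivative, which is automatically
integrable even if it is unbounded at the end points. -/
lemma lintegral_Ioo_ofReal_of_hasDerivAt {a b : ℝ} (hab : a ≤ b) {f F : ℝ → ℝ}
    (hF : ContinuousOn F (Icc a b)) (hd : ∀ x ∈ Ioo a b, HasDerivAt F (f x) x)
    (h0 : ∀ x ∈ Ioo a b, 0 ≤ f x) :
    ∫⁻ x in Ioo a b, ENNReal.ofReal (f x) = ENNReal.ofReal (F b - F a) := by
  have hi : IntegrableOn f (Ioc a b) := intervalIntegral.integrableOn_deriv_of_nonneg hF hd h0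
  have hi' : IntegrableOn f (Ioo a b) := hi.mono_set Ioo_subset_Ioc_self
  rw [← ofReal_integral_eq_lintegral_ofReal hi', ← integral_Ioc_eq_integral_Ioo,
    ← intervalIntegral.integral_of_le hab,
    intervalIntegral.integral_eq_sub_of_hasDerivAt_of_le hab hF hd]
  · exact (intervalIntegrable_iff_integrableOn_Ioc_of_le hab).mpr hi
  · filter_upwards [ae_restrict_mem measurableSet_Ioo] with x hx using h0 x hx

lemma setLIntegral_Ioo_split {a b c : ℝ} (hab : a ≤ b) (hbc : b ≤ c) (f : ℝ → ℝ≥0∞) :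
    ∫⁻ x in Ioo a c, f x = (∫⁻ x in Ioo a b, f x) + ∫⁻ x in Ioo b c, f x := by
  rw [Measure.restrict_congr_set (Ioo_ae_eq_Ioc (a := a) (b := c) (μ := volume)),
    Measure.restrict_congr_set (Ioo_ae_eq_Ioc (a := a) (b := b) (μ := volume)),
    Measure.restrict_congr_set (Ioo_ae_eq_Ioc (a := b) (b := c) (μ := volume)),
    ← Ioc_union_Ioc_eq_Ioc hab hbc, lintegral_union measurableSet_Ioc]
  rw [Set.disjoint_left]
  rintro x ⟨_, h1⟩ ⟨h2, _⟩
  exact absurd h1 (not_le.mpr h2)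

lemma lintegral_exitTime {r c v : ℝ} (hr : 0 ≤ r) (hc : 0 < c) (hv : v ≠ 0) :
    ∫⁻ x in Ioo (0 : ℝ) 1, ENNReal.ofReal (exitTime r c v x) =
      ENNReal.ofReal (meanExit r c v) := by
  have hlin : ∀ a b m q : ℝ, a ≤ b → (∀ x ∈ Ioo a b, 0 ≤ m * x + q) →
      ∫⁻ x in Ioo a b, ENNReal.ofReal (m * x + q) =
        ENNReal.ofReal (m * b ^ 2 / 2 + q * b - (m * a ^ 2 / 2 + q * a)) := by
    intro a b m q hab h0
    refine lintegral_Ioo_ofReal_of_hasDerivAt (F := fun x => m * x ^ 2 / 2 + q * x) hab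
      (by fun_prop) (fun x _ => ?_) h0
    have := (((hasDerivAt_pow 2 x).const_mul m).div_const 2).add ((hasDerivAt_id x).const_mul q)
    refine this.congr_deriv ?_
    simp; ring
  have hrc := mul_nonneg hr hc.le
  unfold meanExit
  split_ifs with h1 h2
  · have : ∀ x ∈ Ioo (0 : ℝ) 1, ENNReal.ofReal (exitTime r c v x) =
        ENNReal.ofReal ((-1 / c) * x + 1 / c) := by
      intro x hx
      unfold exitTime
      rw [if_pos (by linarith [hx.1])]
      congr 1; ring
    rw [setLIntegral_congr_fun measurableSet_Ioo this, hlin 0 1 _ _ zero_le_one]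
    · congr 1; field_simp; ring
    · intro x hx
      have : -1 / c * x + 1 / c = (1 - x) / c := by ring
      rw [this]; exact div_nonneg (by linarith [hx.2]) hc.le
  · push Not at h1
    have hA : ∀ x ∈ Ioo (0 : ℝ) (1 - r * c), ENNReal.ofReal (exitTime r c v x) =
        ENNReal.ofReal ((-1 / v) * x + (r + (1 - r * c) / v)) := by
      intro x hx
      unfold exitTime
      rw [if_neg (by linarith [hx.2]), if_pos h2]
      congr 1; ring
    have hB : ∀ x ∈ Ioo (1 - r * c) (1 : ℝ), ENNReal.ofReal (exitTime r c v x) =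
        ENNReal.ofReal ((-1 / c) * x + 1 / c) := by
      intro x hx
      unfold exitTime
      rw [if_pos (by linarith [hx.1])]
      congr 1; ring
    rw [setLIntegral_Ioo_split (b := 1 - r * c) (by linarith) (by linarith),
      setLIntegral_congr_fun measurableSet_Ioo hA, setLIntegral_congr_fun measurableSet_Ioo hB,
      hlin _ _ _ _ (by linarith), hlin _ _ _ _ (by linarith), ← ENNReal.ofReal_add]
    · congr 1; field_simp; ring
    · have : -1 / v * (1 - r * c) ^ 2 / 2 + (r + (1 - r * c) / v) * (1 - r * c) -
        (-1 / v * 0 ^ 2 / 2 + (r + (1 - r * c) / v) * 0) =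
        (1 - r * c) ^ 2 / (2 * v) + r * (1 - r * c) := by field_simp; ring
      rw [this]
      have : 0 ≤ 1 - r * c := by linarith
      positivity
    · have : -1 / c * 1 ^ 2 / 2 + 1 / c * 1 - (-1 / c * (1 - r * c) ^ 2 / 2 + 1 / c * (1 - r * c))
        = r ^ 2 * c / 2 := by field_simp; ring
      rw [this]; positivity
    · intro x hx
      have : -1 / c * x + 1 / c = (1 - x) / c := by ring
      rw [this]; exact div_nonneg (by linarith [hx.2]) hc.le
    · intro x hx
      have : -1 / v * x + (r + (1 - r * c) / v) = r + (1 - r * c - x) / v := by ring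
      rw [this]; exact add_nonneg hr (div_nonneg (by linarith [hx.2]) h2.le)
  · push Not at h1 h2
    have hvn : 0 < -v := by
      rcases lt_or_eq_of_le h2 with h | h
      · linarith
      · exact absurd h hv
    have hA : ∀ x ∈ Ioo (0 : ℝ) (1 - r * c), ENNReal.ofReal (exitTime r c v x) =
        ENNReal.ofReal ((1 / (-v)) * x + (r + r * c / (-v))) := by
      intro x hx
      unfold exitTime
      rw [if_neg (by linarith [hx.2]), if_neg (by linarith)]
      congr 1; ring
    have hB : ∀ x ∈ Ioo (1 - r * c) (1 : ℝ), ENNReal.ofReal (exitTime r c v x) =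
        ENNReal.ofReal ((-1 / c) * x + 1 / c) := by
      intro x hx
      unfold exitTime
      rw [if_pos (by linarith [hx.1])]
      congr 1; ring
    rw [setLIntegral_Ioo_split (b := 1 - r * c) (by linarith) (by linarith),
      setLIntegral_congr_fun measurableSet_Ioo hA, setLIntegral_congr_fun measurableSet_Ioo hB,
      hlin _ _ _ _ (by linarith), hlin _ _ _ _ (by linarith), ← ENNReal.ofReal_add]
    · congr 1; field_simp; ring
    · have h3 : 0 ≤ 1 - r * c := by linarith
      have : 1 / -v * (1 - r * c) ^ 2 / 2 + (r + r * c / -v) * (1 - r * c) -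
        (1 / -v * 0 ^ 2 / 2 + (r + r * c / -v) * 0) =
        1 / -v * (1 - r * c) ^ 2 / 2 + (r + r * c / -v) * (1 - r * c) := by ring
      rw [this]
      positivity
    · have : -1 / c * 1 ^ 2 / 2 + 1 / c * 1 - (-1 / c * (1 - r * c) ^ 2 / 2 + 1 / c * (1 - r * c))
        = r ^ 2 * c / 2 := by field_simp; ring
      rw [this]; positivity
    · intro x hx
      have : -1 / c * x + 1 / c = (1 - x) / c := by ring
      rw [this]; exact div_nonneg (by linarith [hx.2]) hc.le
    · intro x hx
      have := hx.1
      positivity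

/-- The mean escape length for the heading `θ` when the corner angle is `π / 2 - δ`. -/
def headingMean (r δ θ : ℝ) : ℝ := meanExit r (cos θ) (sin (θ - δ))

lemma measurable_headingMean (r δ : ℝ) : Measurable (headingMean r δ) :=
  measurable_meanExit r (by fun_prop) (by fun_prop)

lemma lintegral_comp_one_sub (g : ℝ → ℝ≥0∞) :
    ∫⁻ x in Ioo (0 : ℝ) 1, g (1 - x) = ∫⁻ x in Ioo (0 : ℝ) 1, g x := by
  have := (Measure.measurePreserving_sub_left (volume : Measure ℝ) 1).setLIntegral_comp_preimage_emb
    (Homeomorph.subLeft (1 : ℝ)).measurableEmbedding g (Ioo 0 1)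
  have h2 : (fun x : ℝ => 1 - x) ⁻¹' Ioo 0 1 = Ioo 0 1 := by
    ext x; simp only [mem_preimage, mem_Ioo]
    constructor <;> rintro ⟨h1, h2⟩ <;> constructor <;> linarith
  rw [h2] at this
  exact this

lemma lintegral_comp_neg (g : ℝ → ℝ≥0∞) (b : ℝ) :
    ∫⁻ x in Ioo (-b) 0, g x = ∫⁻ x in Ioo 0 b, g (-x) := by
  have := (Measure.measurePreserving_neg (volume : Measure ℝ)).setLIntegral_comp_preimage_emb
    (Homeomorph.neg ℝ).measurableEmbedding g (Ioo (-b) 0)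
  have h2 : (Neg.neg : ℝ → ℝ) ⁻¹' Ioo (-b) 0 = Ioo 0 b := by
    ext x; simp only [mem_preimage, mem_Ioo]
    constructor <;> rintro ⟨h1, h2⟩ <;> constructor <;> linarith
  rw [h2] at this
  exact this.symm

lemma lintegral_comp_add (g : ℝ → ℝ≥0∞) (a b c : ℝ) :
    ∫⁻ x in Ioo (a + c) (b + c), g x = ∫⁻ x in Ioo a b, g (x + c) := by
  have := (measurePreserving_add_right (volume : Measure ℝ) c).setLIntegral_comp_preimage_emb
    (Homeomorph.addRight c).measurableEmbedding g (Ioo (a + c) (b + c))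
  have h2 : (fun x : ℝ => x + c) ⁻¹' Ioo (a + c) (b + c) = Ioo a b := by
    ext x; simp
  rw [h2] at this
  exact this.symm

lemma ae_cos_add_ne_zero (a : ℝ) : ∀ᵐ θ : ℝ, cos (θ + a) ≠ 0 := by
  rw [ae_iff]; simpa using volume_setOf_cos_add_eq_zero a

/-- The expected escape length as an integral over the headings that point to the right. -/
lemma expectedEscapeLength_eq_lintegral_headingMean {μ : Measure (ℝ × ℝ)} (hμ : IsStartLaw μ)
    {r : ℝ} (hr : 0 ≤ r) (δ : ℝ) :
    expectedEscapeLength μ r (π / 2 - δ) =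
      ENNReal.ofReal (1 / π) *
        ∫⁻ θ in Ioo 0 (π / 2),
          (ENNReal.ofReal (headingMean r δ θ) + ENNReal.ofReal (headingMean r δ (-θ))) := by
  have hp := pi_pos
  set Φ : ℝ → ℝ≥0∞ := fun θ => ∫⁻ x in Ioo (0 : ℝ) 1, escapeFun r (π / 2 - δ) (x, θ) with hΦ
  have hcos : ∀ θ, cos (θ + (π / 2 - δ)) = -sin (θ - δ) := by
    intro θ
    rw [show θ + (π / 2 - δ) = (θ - δ) + π / 2 by ring, cos_add_pi_div_two]
  have hmid : ∀ θ, 0 < cos θ → cos (θ + (π / 2 - δ)) ≠ 0 →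
      Φ θ = ENNReal.ofReal (headingMean r δ θ) := by
    intro θ h1 h2
    simp only [hΦ, escapeFun, if_pos h1]
    rw [lintegral_exitTime hr h1 (neg_ne_zero.mpr h2), hcos, neg_neg]
    rfl
  -- opposite headings are equivalent under `x ↦ 1 - x`
  have hper : ∀ θ, 0 < cos θ → Φ (θ + π) = Φ θ := by
    intro θ h1
    have h3 : cos (θ + π + (π / 2 - δ)) = -cos (θ + (π / 2 - δ)) := by
      rw [← cos_add_pi]; ring_nf
    simp only [hΦ, escapeFun, if_pos h1, cos_add_pi, h3]
    rw [← lintegral_comp_one_sub]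
    simp only [if_neg (not_lt.mpr (neg_nonpos.mpr h1.le)), neg_neg, sub_sub_cancel]
  have hΦper : Function.Periodic Φ (2 * π) := by
    intro θ
    simp only [hΦ, escapeFun, cos_add_two_pi,
      show θ + 2 * π + (π / 2 - δ) = θ + (π / 2 - δ) + 2 * π by ring]
  rw [expectedEscapeLength_eq_lintegral_escapeFun hμ hr]
  change _ * ∫⁻ θ in Ioo (-π) π, Φ θ = _
  set Hm := ∫⁻ θ in Ioo (-(π / 2)) (π / 2), Φ θ with hHm
  have e1 : ∫⁻ θ in Ioo (π / 2) π, Φ θ = ∫⁻ θ in Ioo (-(π / 2)) 0, Φ θ := by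
    have := lintegral_comp_add Φ (-(π / 2)) 0 π
    rw [show -(π / 2) + π = π / 2 by ring, zero_add] at this
    rw [this]
    refine setLIntegral_congr_fun measurableSet_Ioo fun θ hθ => hper θ ?_
    exact cos_pos_of_mem_Ioo ⟨hθ.1, by linarith [hθ.2]⟩
  have e2 : ∫⁻ θ in Ioo (-π) (-(π / 2)), Φ θ = ∫⁻ θ in Ioo 0 (π / 2), Φ θ := by
    have := lintegral_comp_add (fun θ => Φ (θ + π)) (-π) (-(π / 2)) π
    have h2 := lintegral_comp_add Φ 0 (π / 2) (-π)
    rw [zero_add, show π / 2 + -π = -(π / 2) by ring] at h2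
    rw [h2]
    refine setLIntegral_congr_fun measurableSet_Ioo fun θ hθ => ?_
    have hc : 0 < cos θ := cos_pos_of_mem_Ioo ⟨by linarith [hθ.1], hθ.2⟩
    rw [← hper θ hc, ← hΦper (θ + -π)]
    congr 1; ring
  have e3 : ∫⁻ θ in Ioo (-π) π, Φ θ = 2 * Hm := by
    have e5 : Hm = (∫⁻ θ in Ioo (-(π / 2)) 0, Φ θ) + ∫⁻ θ in Ioo 0 (π / 2), Φ θ :=
      setLIntegral_Ioo_split (by linarith) (by linarith) Φ
    rw [setLIntegral_Ioo_split (b := -(π / 2)) (by linarith) (by linarith),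
      setLIntegral_Ioo_split (a := -(π / 2)) (b := π / 2) (by linarith) (by linarith), e1, e2,
      ← hHm, two_mul]
    nth_rw 3 [e5]
    ring
  have e4 : Hm = ∫⁻ θ in Ioo (-(π / 2)) (π / 2), ENNReal.ofReal (headingMean r δ θ) := by
    refine setLIntegral_congr_fun_ae measurableSet_Ioo ?_
    filter_upwards [ae_cos_add_ne_zero (π / 2 - δ)] with θ h hθ
    exact hmid θ (cos_pos_of_mem_Ioo hθ) h
  rw [e3, e4, setLIntegral_Ioo_split (b := 0) (by linarith) (by linarith), lintegral_comp_neg,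
    add_comm (∫⁻ x in Ioo 0 (π / 2), ENNReal.ofReal (headingMean r δ (-x))),
    ← lintegral_add_left (measurable_headingMean r δ).ennreal_ofReal, ← mul_assoc]
  congr 1
  rw [show (2 : ℝ≥0∞) = ENNReal.ofReal 2 by simp, ← ENNReal.ofReal_mul (by positivity)]
  congr 1; field_simp

/-! ### The expected escape length as `mainPart + turnPart`, and where it is infinite -/

lemma cos_arccos_inv {r : ℝ} (hr : 1 ≤ r) : cos (arccos (1 / r)) = 1 / r := by
  have : 0 < r := by linarith
  apply cos_arccos
  · have : 0 < 1 / r := by positivity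
    linarith
  · rw [div_le_one this]; exact hr

lemma arccos_inv_lt {r : ℝ} (hr : 1 ≤ r) : arccos (1 / r) < π / 2 := by
  rw [arccos_lt_pi_div_two]
  have : 0 < r := by linarith
  positivity

/-- The sum of the mean escape lengths for the headings `θ` and `-θ` when neither of them leads
directly to a shore. -/
def pairMean (r δ θ : ℝ) : ℝ :=
  2 * r - r ^ 2 * cos θ + (1 - r * cos θ) ^ 2 / (2 * sin (θ - δ)) +
    (1 - (r * cos θ) ^ 2) / (2 * sin (θ + δ))

lemma mul_cos_lt_one {r θ : ℝ} (hr : 1 ≤ r) (h1 : arccos (1 / r) < θ) (h2 : θ ≤ π / 2) :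
    r * cos θ < 1 := by
  have hr0 : 0 < r := by linarith
  have h := cos_lt_cos_of_nonneg_of_le_pi (arccos_nonneg (1 / r)) (by linarith [pi_pos]) h1
  rw [cos_arccos_inv hr, lt_div_iff₀ hr0] at h
  linarith

lemma one_le_mul_cos {r θ : ℝ} (hr : 1 ≤ r) (h0 : 0 ≤ θ) (h1 : θ ≤ arccos (1 / r)) :
    1 ≤ r * cos θ := by
  have hr0 : 0 < r := by linarith
  have h := cos_le_cos_of_nonneg_of_le_pi h0 (arccos_le_pi _) h1
  rw [cos_arccos_inv hr, div_le_iff₀ hr0] at h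
  linarith

/-- Headings with `r * cos θ ≥ 1` lead directly to a shore. -/
lemma lintegral_headings {r δ : ℝ} (hr : 1 ≤ r) (hδ : |δ| ≤ arccos (1 / r)) :
    ∫⁻ θ in Ioo 0 (π / 2),
      (ENNReal.ofReal (headingMean r δ θ) + ENNReal.ofReal (headingMean r δ (-θ))) =
    (∫⁻ θ in Ioo 0 (arccos (1 / r)), ENNReal.ofReal (1 / cos θ)) +
      ∫⁻ θ in Ioo (arccos (1 / r)) (π / 2), ENNReal.ofReal (pairMean r δ θ) := by
  have hp := pi_pos
  have hβ := arccos_inv_lt hr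
  obtain ⟨hδ1, hδ2⟩ := abs_le.mp hδ
  rw [setLIntegral_Ioo_split (arccos_nonneg (1 / r)) hβ.le]
  congr 1
  · refine setLIntegral_congr_fun measurableSet_Ioo fun θ hθ => ?_
    have hc : 0 < cos θ := cos_pos_of_mem_Ioo ⟨by linarith [hθ.1], by linarith [hθ.2]⟩
    have h1 : 1 ≤ r * cos θ := one_le_mul_cos hr hθ.1.le hθ.2.le
    simp only [headingMean, meanExit, cos_neg, if_pos h1]
    rw [← ENNReal.ofReal_add (by positivity) (by positivity)]
    congr 1; field_simp; norm_num
  · refine setLIntegral_congr_fun measurableSet_Ioo fun θ hθ => ?_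
    have hθ0 : 0 < θ := (arccos_nonneg (1 / r)).trans_lt hθ.1
    have hc : 0 < cos θ := cos_pos_of_mem_Ioo ⟨by linarith, hθ.2⟩
    have hrc := mul_cos_lt_one hr hθ.1 hθ.2.le
    have hrc0 : 0 < r * cos θ := by positivity
    have h1 : 0 < sin (θ - δ) := sin_pos_of_pos_of_lt_pi (by linarith [hθ.1]) (by linarith [hθ.2])
    have h2 : 0 < sin (θ + δ) := sin_pos_of_pos_of_lt_pi (by linarith [hθ.1]) (by linarith [hθ.2])
    have h3 : sin (-θ - δ) = -sin (θ + δ) := by rw [← sin_neg]; ring_nf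
    have h4 : 0 ≤ 1 - (r * cos θ) ^ 2 := by nlinarith
    have h5 : 0 ≤ r - r ^ 2 * cos θ / 2 := by nlinarith
    simp only [headingMean, meanExit, cos_neg, if_neg (not_le.mpr hrc), if_pos h1, h3,
      if_neg (not_lt.mpr (neg_nonpos.mpr h2.le)), neg_neg]
    rw [← ENNReal.ofReal_add (by positivity) (by positivity)]
    congr 1
    unfold pairMean; ring

/-- The part of `π` times the expected escape length that does not come from paths whose second
segment keeps the horizontal direction of the first one; it equals
`∫ θ in 0..β, 1 / cos θ + ∫ θ in β..π / 2, (2 * r - r ^ 2 * cos θ + (1 - (r * cos θ) ^ 2) /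
(2 * sin (θ + δ)))` with `β = arccos (1 / r)`. This is right also for `r = 1`, `δ = 0`, where the
value `log 0 = 0` comes with the factor `1 - (r * cos δ) ^ 2 = 0`. -/
def mainPart (r δ : ℝ) : ℝ :=
  log (1 + sin (arccos (1 / r))) - log (cos (arccos (1 / r))) + 2 * r * (π / 2 - arccos (1 / r))
    - r ^ 2 * (1 - sin (arccos (1 / r)))
    + 1 / 2 * ((1 - (r * cos δ) ^ 2) * (log (cos δ) - log (1 - sin δ)
        - log (sin (arccos (1 / r) + δ)) + log (1 + cos (arccos (1 / r) + δ)))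
      + r ^ 2 * (cos (arccos (1 / r) - δ) - sin δ))

/-- The closed form of `∫ θ in β..π / 2, (1 - r * cos θ) ^ 2 / (2 * sin (θ - δ))` with
`β = arccos (1 / r)`. For `δ = β` the value `log 0 = 0` comes with the factor
`(1 - r * cos δ) ^ 2 = 0`. -/
def turnPart (r δ : ℝ) : ℝ :=
  1 / 2 * ((1 - r * cos δ) ^ 2 * (log (cos δ) - log (sin (arccos (1 / r) - δ)))
    - (1 + (r * cos δ) ^ 2) * (log (1 + sin δ) - log (1 + cos (arccos (1 / r) - δ)))
    + 2 * r * sin δ * (π / 2 - arccos (1 / r)) - r ^ 2 * (sin δ + cos (arccos (1 / r) + δ)))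

lemma sin_sub_mul_sin_add (θ δ : ℝ) : sin (θ - δ) * sin (θ + δ) = cos δ ^ 2 - cos θ ^ 2 := by
  rw [sin_sub, sin_add]
  nlinarith [sin_sq_add_cos_sq θ, sin_sq_add_cos_sq δ]

/-- The antiderivative behind `turnPart`. -/
def turnAnti (r δ θ : ℝ) : ℝ :=
  (1 - r * cos δ) ^ 2 * log (sin (θ - δ)) - (1 + (r * cos δ) ^ 2) * log (1 + cos (θ - δ))
    + 2 * r * sin δ * θ + r ^ 2 * cos (θ + δ)

/-- The antiderivative behind the `δ`-dependent part of `mainPart`. -/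
def mainAnti (r δ θ : ℝ) : ℝ :=
  (1 - (r * cos δ) ^ 2) * (log (sin (θ + δ)) - log (1 + cos (θ + δ))) - r ^ 2 * cos (θ - δ)

lemma one_add_cos_pos_of_sin_pos {x : ℝ} (h : 0 < sin x) : 0 < 1 + cos x := by
  have := sin_sq_add_cos_sq x
  have := neg_one_le_cos x
  by_contra hcon
  have : cos x = -1 := by linarith
  nlinarith

lemma hasDerivAt_turnAnti {r δ θ : ℝ} (h : 0 < sin (θ - δ)) :
    HasDerivAt (turnAnti r δ) ((1 - r * cos θ) ^ 2 / sin (θ - δ)) θ := by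
  have h1 := one_add_cos_pos_of_sin_pos h
  have e : HasDerivAt (fun θ => θ - δ) 1 θ := (hasDerivAt_id θ).sub_const δ
  have e' : HasDerivAt (fun θ => θ + δ) 1 θ := (hasDerivAt_id θ).add_const δ
  have := (((e.sin.log h.ne').const_mul ((1 - r * cos δ) ^ 2)).sub
    (((e.cos.const_add 1).log h1.ne').const_mul (1 + (r * cos δ) ^ 2))).add
    ((hasDerivAt_id θ).const_mul (2 * r * sin δ)) |>.add (e'.cos.const_mul (r ^ 2))
  refine this.congr_deriv ?_
  have h2 := sin_sub_mul_sin_add θ δ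
  have h3 : cos θ = cos (θ - δ) * cos δ - sin (θ - δ) * sin δ := by
    rw [← cos_add]; ring_nf
  have h4 : sin (θ - δ) / (1 + cos (θ - δ)) = (1 - cos (θ - δ)) / sin (θ - δ) := by
    rw [div_eq_div_iff h1.ne' h.ne']; nlinarith [sin_sq_add_cos_sq (θ - δ)]
  have h5 : -sin (θ - δ) * 1 / (1 + cos (θ - δ)) = -((1 - cos (θ - δ)) / sin (θ - δ)) := by
    rw [← h4]; ring
  rw [h5]
  have h6 : (1 - r * cos θ) ^ 2 = 1 - 2 * r * (cos (θ - δ) * cos δ - sin (θ - δ) * sin δ)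
      + r ^ 2 * (cos δ ^ 2 - sin (θ - δ) * sin (θ + δ)) := by
    rw [h2, ← h3]; ring
  rw [h6]
  field_simp
  ring

lemma hasDerivAt_mainAnti {r δ θ : ℝ} (h : 0 < sin (θ + δ)) :
    HasDerivAt (mainAnti r δ) ((1 - (r * cos θ) ^ 2) / sin (θ + δ)) θ := by
  have h1 := one_add_cos_pos_of_sin_pos h
  have e : HasDerivAt (fun θ => θ - δ) 1 θ := (hasDerivAt_id θ).sub_const δ
  have e' : HasDerivAt (fun θ => θ + δ) 1 θ := (hasDerivAt_id θ).add_const δ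
  have := ((e'.sin.log h.ne').sub ((e'.cos.const_add 1).log h1.ne')).const_mul
    (1 - (r * cos δ) ^ 2) |>.sub (e.cos.const_mul (r ^ 2))
  refine this.congr_deriv ?_
  have h2 := sin_sub_mul_sin_add θ δ
  have h5 : cos (θ + δ) * 1 / sin (θ + δ) - -sin (θ + δ) * 1 / (1 + cos (θ + δ)) =
      1 / sin (θ + δ) := by
    rw [mul_one, mul_one, neg_div, sub_neg_eq_add, div_add_div _ _ h.ne' h1.ne',
      div_eq_div_iff (by positivity) h.ne']
    nlinarith [sin_sq_add_cos_sq (θ + δ)]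
  rw [h5]
  have h6 : (r * cos θ) ^ 2 = r ^ 2 * (cos δ ^ 2 - sin (θ - δ) * sin (θ + δ)) := by
    rw [h2]; ring
  rw [h6]
  field_simp
  ring

lemma continuousOn_turnAnti {r δ : ℝ} (hr : 1 ≤ r) (h0 : 0 ≤ δ) (hδ : δ ≤ arccos (1 / r)) :
    ContinuousOn (turnAnti r δ) (Icc (arccos (1 / r)) (π / 2)) := by
  have hp := pi_pos
  have h1 : ∀ θ ∈ Icc (arccos (1 / r)) (π / 2), 1 + cos (θ - δ) ≠ 0 := by
    intro θ hθ
    have := cos_nonneg_of_mem_Icc (x := θ - δ) ⟨by linarith [hθ.1], by linarith [hθ.2]⟩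
    positivity
  have hlog : ContinuousOn (fun θ => (1 - r * cos δ) ^ 2 * log (sin (θ - δ)))
      (Icc (arccos (1 / r)) (π / 2)) := by
    rcases hδ.eq_or_lt with h | h
    · have : r * cos δ = 1 := by
        rw [h, cos_arccos_inv hr]; field_simp
      simp only [this, sub_self]
      simpa using continuousOn_const
    · refine continuousOn_const.mul (ContinuousOn.log (by fun_prop) fun θ hθ => ?_)
      exact (sin_pos_of_pos_of_lt_pi (by linarith [hθ.1]) (by linarith [hθ.2])).ne'
  unfold turnAnti
  refine ((hlog.sub (continuousOn_const.mul (ContinuousOn.log (by fun_prop) h1))).add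
    (by fun_prop)).add (by fun_prop)

lemma continuousOn_mainAnti {r δ : ℝ} (hr : 1 ≤ r) (h0 : 0 ≤ δ) (hδ : δ ≤ arccos (1 / r)) :
    ContinuousOn (mainAnti r δ) (Icc (arccos (1 / r)) (π / 2)) := by
  have hp := pi_pos
  have hβ := arccos_inv_lt hr
  unfold mainAnti
  refine ContinuousOn.sub ?_ (by fun_prop)
  rcases (add_nonneg (arccos_nonneg (1 / r)) h0).eq_or_lt with h | h
  · have h1 : arccos (1 / r) = 0 := by linarith [arccos_nonneg (1 / r)]
    have h2 : δ = 0 := by linarith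
    have : r * cos δ = 1 := by
      rw [show δ = arccos (1 / r) by linarith, cos_arccos_inv hr]; field_simp
    simp only [this]
    simpa using continuousOn_const
  · have hs : ∀ θ ∈ Icc (arccos (1 / r)) (π / 2), 0 < sin (θ + δ) := fun θ hθ =>
      sin_pos_of_pos_of_lt_pi (by linarith [hθ.1]) (by linarith [hθ.2])
    refine continuousOn_const.mul (ContinuousOn.sub (ContinuousOn.log (by fun_prop) fun θ hθ => ?_)
      (ContinuousOn.log (by fun_prop) fun θ hθ => ?_))
    · exact (hs θ hθ).ne'
    · exact (one_add_cos_pos_of_sin_pos (hs θ hθ)).ne'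

lemma lintegral_sec {b : ℝ} (h0 : 0 ≤ b) (hb : b < π / 2) :
    ∫⁻ θ in Ioo 0 b, ENNReal.ofReal (1 / cos θ) =
      ENNReal.ofReal (log (1 + sin b) - log (cos b)) := by
  have hp := pi_pos
  have hc : ∀ θ ∈ Icc 0 b, 0 < cos θ := fun θ hθ =>
    cos_pos_of_mem_Ioo ⟨by linarith [hθ.1], by linarith [hθ.2]⟩
  have hs : ∀ θ ∈ Icc 0 b, 0 < 1 + sin θ := fun θ hθ => by
    have := sin_nonneg_of_nonneg_of_le_pi hθ.1 (by linarith [hθ.2])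
    positivity
  rw [lintegral_Ioo_ofReal_of_hasDerivAt (F := fun θ => log (1 + sin θ) - log (cos θ)) h0]
  · simp
  · exact ContinuousOn.sub (ContinuousOn.log (by fun_prop) fun θ hθ => (hs θ hθ).ne')
      (ContinuousOn.log (by fun_prop) fun θ hθ => (hc θ hθ).ne')
  · intro θ hθ
    have hθ' := Ioo_subset_Icc_self hθ
    have := (((hasDerivAt_sin θ).const_add 1).log (hs θ hθ').ne').sub
      ((hasDerivAt_cos θ).log (hc θ hθ').ne')
    refine this.congr_deriv ?_
    have h1 := (hs θ hθ').ne'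
    have h2 := (hc θ hθ').ne'
    field_simp
    nlinarith [sin_sq_add_cos_sq θ]
  · intro θ hθ
    exact (one_div_pos.mpr (hc θ (Ioo_subset_Icc_self hθ))).le

/-- `π` times the expected escape length on the region `r ≥ 1`, `0 ≤ δ ≤ arccos (1 / r)`. -/
def total (r δ : ℝ) : ℝ := mainPart r δ + turnPart r δ

lemma pairMean_nonneg {r δ θ : ℝ} (hr : 1 ≤ r) (hδ : |δ| ≤ arccos (1 / r))
    (hθ : θ ∈ Ioo (arccos (1 / r)) (π / 2)) : 0 ≤ pairMean r δ θ := by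
  obtain ⟨hδ1, hδ2⟩ := abs_le.mp hδ
  have hp := pi_pos
  have hβ := arccos_inv_lt hr
  have hθ0 : 0 < θ := (arccos_nonneg (1 / r)).trans_lt hθ.1
  have hc : 0 < cos θ := cos_pos_of_mem_Ioo ⟨by linarith, hθ.2⟩
  have hrc := mul_cos_lt_one hr hθ.1 hθ.2.le
  have hrc0 : 0 < r * cos θ := by positivity
  have h1 : 0 < sin (θ - δ) := sin_pos_of_pos_of_lt_pi (by linarith [hθ.1]) (by linarith [hθ.2])
  have h2 : 0 < sin (θ + δ) := sin_pos_of_pos_of_lt_pi (by linarith [hθ.1]) (by linarith [hθ.2])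
  have h4 : 0 ≤ 1 - (r * cos θ) ^ 2 := by nlinarith
  have h5 : 0 ≤ 2 * r - r ^ 2 * cos θ := by nlinarith
  unfold pairMean
  positivity

lemma expectedEscapeLength_eq_total {μ : Measure (ℝ × ℝ)} (hμ : IsStartLaw μ) {r δ : ℝ}
    (hr : 1 ≤ r) (h0 : 0 ≤ δ) (hδ : δ ≤ arccos (1 / r)) :
    expectedEscapeLength μ r (π / 2 - δ) = ENNReal.ofReal (total r δ / π) ∧ 0 < total r δ := by
  have hp := pi_pos
  have hβ := arccos_inv_lt hr
  have hβ0 := arccos_nonneg (1 / r)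
  have habs : |δ| ≤ arccos (1 / r) := by rwa [abs_of_nonneg h0]
  have hcβ := cos_arccos_inv hr
  rw [expectedEscapeLength_eq_lintegral_headingMean hμ (by linarith), lintegral_headings hr habs,
    lintegral_sec hβ0 hβ]
  set F : ℝ → ℝ := fun θ => 2 * r * θ - r ^ 2 * sin θ + turnAnti r δ θ / 2 + mainAnti r δ θ / 2
    with hF
  have hFc : ContinuousOn F (Icc (arccos (1 / r)) (π / 2)) :=
    ((ContinuousOn.sub (by fun_prop) (by fun_prop)).add
      ((continuousOn_turnAnti hr h0 hδ).div_const 2)).add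
      ((continuousOn_mainAnti hr h0 hδ).div_const 2)
  have hFd : ∀ θ ∈ Ioo (arccos (1 / r)) (π / 2), HasDerivAt F (pairMean r δ θ) θ := by
    intro θ hθ
    have h1 : 0 < sin (θ - δ) := sin_pos_of_pos_of_lt_pi (by linarith [hθ.1]) (by linarith [hθ.2])
    have h2 : 0 < sin (θ + δ) := sin_pos_of_pos_of_lt_pi (by linarith [hθ.1]) (by linarith [hθ.2])
    have := ((((hasDerivAt_id θ).const_mul (2 * r)).sub ((hasDerivAt_sin θ).const_mul (r ^ 2))).add
      ((hasDerivAt_turnAnti (r := r) h1).div_const 2)).add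
      ((hasDerivAt_mainAnti (r := r) h2).div_const 2)
    refine this.congr_deriv ?_
    unfold pairMean
    field_simp
  have hnn := fun θ hθ => pairMean_nonneg (θ := θ) hr habs hθ
  have hFmono : 0 ≤ F (π / 2) - F (arccos (1 / r)) := by
    rw [sub_nonneg]
    refine monotoneOn_of_deriv_nonneg (convex_Icc _ _) hFc ?_ ?_ (left_mem_Icc.mpr hβ.le)
      (right_mem_Icc.mpr hβ.le) hβ.le
    · rw [interior_Icc]
      exact fun θ hθ => (hFd θ hθ).differentiableAt.differentiableWithinAt
    · rw [interior_Icc]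
      intro θ hθ
      rw [(hFd θ hθ).deriv]
      exact hnn θ hθ
  have hlog : 0 ≤ log (1 + sin (arccos (1 / r))) - log (cos (arccos (1 / r))) := by
    have hs : 0 ≤ sin (arccos (1 / r)) := sin_nonneg_of_nonneg_of_le_pi hβ0 (by linarith)
    have h1 : 0 ≤ log (1 + sin (arccos (1 / r))) := log_nonneg (by linarith)
    have h2 : log (cos (arccos (1 / r))) ≤ 0 :=
      log_nonpos (by rw [hcβ]; positivity) (cos_le_one _)
    linarith
  have htot : log (1 + sin (arccos (1 / r))) - log (cos (arccos (1 / r))) +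
      (F (π / 2) - F (arccos (1 / r))) = total r δ := by
    simp only [hF, total, mainPart, turnPart, turnAnti, mainAnti, sin_pi_div_two_sub,
      cos_pi_div_two_sub, add_comm (π / 2) δ, sin_add_pi_div_two, cos_add_pi_div_two,
      sin_pi_div_two, ← sub_eq_add_neg]
    ring
  rw [lintegral_Ioo_ofReal_of_hasDerivAt hβ.le hFc hFd hnn, ← ENNReal.ofReal_add hlog hFmono, htot,
    ← ENNReal.ofReal_mul (by positivity)]
  refine ⟨by congr 1; ring, ?_⟩
  rw [← htot]
  have hlt : F (arccos (1 / r)) < F (π / 2) := by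
    refine strictMonoOn_of_deriv_pos (convex_Icc _ _) hFc ?_ (left_mem_Icc.mpr hβ.le)
      (right_mem_Icc.mpr hβ.le) hβ
    rw [interior_Icc]
    intro θ hθ
    rw [(hFd θ hθ).deriv]
    have hθ0 : 0 < θ := hβ0.trans_lt hθ.1
    have hc : 0 < cos θ := cos_pos_of_mem_Ioo ⟨by linarith, hθ.2⟩
    have hrc := mul_cos_lt_one hr hθ.1 hθ.2.le
    have hrc0 : 0 < r * cos θ := by positivity
    have h1 : 0 < sin (θ - δ) := sin_pos_of_pos_of_lt_pi (by linarith [hθ.1]) (by linarith [hθ.2])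
    have h2 : 0 < sin (θ + δ) := sin_pos_of_pos_of_lt_pi (by linarith [hθ.1]) (by linarith [hθ.2])
    have h4 : 0 ≤ 1 - (r * cos θ) ^ 2 := by nlinarith
    have h5 : 0 < 2 * r - r ^ 2 * cos θ := by nlinarith
    unfold pairMean
    positivity
  linarith

/-- Enclosing the acute angle `π / 2 - δ` is better than enclosing the obtuse angle `π / 2 + δ`: of
the two numerators in `pairMean` the smaller one then stands over the smaller denominator. -/
lemma expectedEscapeLength_lt_of_neg {μ : Measure (ℝ × ℝ)} (hμ : IsStartLaw μ) {r δ : ℝ}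
    (hr : 1 ≤ r) (h0 : 0 < δ) (hδ : δ ≤ arccos (1 / r)) :
    expectedEscapeLength μ r (π / 2 - δ) < expectedEscapeLength μ r (π / 2 - -δ) := by
  have hp := pi_pos
  have hβ := arccos_inv_lt hr
  have habs : |δ| ≤ arccos (1 / r) := by rwa [abs_of_nonneg h0.le]
  have hfin : expectedEscapeLength μ r (π / 2 - δ) ≠ ∞ := by
    rw [(expectedEscapeLength_eq_total hμ hr h0.le hδ).1]; exact ENNReal.ofReal_ne_top
  rw [expectedEscapeLength_eq_lintegral_headingMean hμ (by linarith), lintegral_headings hr habs]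
    at hfin ⊢
  rw [expectedEscapeLength_eq_lintegral_headingMean hμ (by linarith),
    lintegral_headings hr (by rwa [abs_neg])]
  have hpi : ENNReal.ofReal (1 / π) ≠ 0 := by
    rw [ne_eq, ENNReal.ofReal_eq_zero, not_le]; positivity
  have hfin3 : (∫⁻ θ in Ioo 0 (arccos (1 / r)), ENNReal.ofReal (1 / cos θ)) +
      ∫⁻ θ in Ioo (arccos (1 / r)) (π / 2), ENNReal.ofReal (pairMean r δ θ) ≠ ∞ := by
    intro h; rw [h, ENNReal.mul_top hpi] at hfin; exact hfin rfl
  rw [ENNReal.add_ne_top] at hfin3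
  rw [ENNReal.mul_lt_mul_iff_right hpi ENNReal.ofReal_ne_top]
  refine ENNReal.add_lt_add_left hfin3.1 ?_
  have hlt : ∀ θ ∈ Ioo (arccos (1 / r)) (π / 2), pairMean r δ θ < pairMean r (-δ) θ := by
    intro θ hθ
    have hθ0 : 0 < θ := (arccos_nonneg (1 / r)).trans_lt hθ.1
    have hc : 0 < cos θ := cos_pos_of_mem_Ioo ⟨by linarith, hθ.2⟩
    have hrc := mul_cos_lt_one hr hθ.1 hθ.2.le
    have hrc0 : 0 < r * cos θ := by positivity
    have h1 : 0 < sin (θ - δ) := sin_pos_of_pos_of_lt_pi (by linarith [hθ.1]) (by linarith [hθ.2])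
    have h2 : sin (θ - δ) < sin (θ + δ) := by
      have : 0 < sin δ := sin_pos_of_pos_of_lt_pi h0 (by linarith)
      rw [sin_sub, sin_add]; nlinarith
    have h3 : 1 / sin (θ + δ) < 1 / sin (θ - δ) := one_div_lt_one_div_of_lt h1 h2
    have h4 : (1 - r * cos θ) ^ 2 < 1 - (r * cos θ) ^ 2 := by nlinarith
    have : pairMean r (-δ) θ - pairMean r δ θ = 1 / 2 *
        ((1 - (r * cos θ) ^ 2 - (1 - r * cos θ) ^ 2) * (1 / sin (θ - δ) - 1 / sin (θ + δ))) := by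
      unfold pairMean
      rw [sub_neg_eq_add, ← sub_eq_add_neg]
      have := h1.ne'
      have := (h1.trans h2).ne'
      field_simp
      ring
    have : 0 < (1 - (r * cos θ) ^ 2 - (1 - r * cos θ) ^ 2) *
      (1 / sin (θ - δ) - 1 / sin (θ + δ)) := mul_pos (by linarith) (by linarith)
    linarith
  have hmeas : ∀ δ, Measurable fun θ => ENNReal.ofReal (pairMean r δ θ) := fun δ => by
    unfold pairMean; fun_prop
  refine lintegral_strict_mono ?_ (hmeas _).aemeasurable hfin3.2 ?_
  · rw [ne_eq, Measure.restrict_eq_zero, Real.volume_Ioo, ENNReal.ofReal_eq_zero]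
    linarith
  · filter_upwards [ae_restrict_mem measurableSet_Ioo] with θ hθ
    exact (ENNReal.ofReal_lt_ofReal_iff_of_nonneg (pairMean_nonneg hr habs hθ)).mpr (hlt θ hθ)

lemma lintegral_inv_abs_sub_eq_top {a b c : ℝ} (hab : a < b) (hc : c ∈ Icc a b) {K : ℝ}
    (hK : 0 < K) : ∫⁻ θ in Ioo a b, ENNReal.ofReal (K / |θ - c|) = ∞ := by
  by_contra hne
  have h1 : IntervalIntegrable (fun θ => (θ - c)⁻¹) volume a b := by
    rw [intervalIntegrable_iff_integrableOn_Ioo_of_le hab.le]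
    refine ⟨by fun_prop, ?_⟩
    have h2 : ∀ θ : ℝ, ‖(θ - c)⁻¹‖ₑ = ENNReal.ofReal (1 / K) * ENNReal.ofReal (K / |θ - c|) := by
      intro θ
      rw [← ENNReal.ofReal_mul (by positivity), Real.enorm_eq_ofReal_abs, abs_inv]
      congr 1; field_simp
    unfold HasFiniteIntegral
    simp only [h2]
    rw [lintegral_const_mul _ (by fun_prop)]
    exact ENNReal.mul_lt_top ENNReal.ofReal_lt_top (lt_top_iff_ne_top.mpr hne)
  rcases intervalIntegrable_sub_inv_iff.mp h1 with h | h
  · exact hab.ne h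
  · exact h (by rwa [uIcc_of_le hab.le])

lemma div_abs_le_headingMean {r δ θ t : ℝ} (hr : 0 ≤ r) (hc : 0 ≤ cos θ) {m : ℝ}
    (hm : m < 1) (hrc : r * cos θ ≤ m) (ht : |sin (θ - δ)| ≤ |t|) (h0 : sin (θ - δ) ≠ 0) :
    (1 - m) ^ 2 / 2 / |t| ≤ headingMean r δ θ := by
  have hrc0 := mul_nonneg hr hc
  unfold headingMean meanExit
  rw [if_neg (by linarith)]
  have h1 : 0 ≤ r - r ^ 2 * cos θ / 2 := by nlinarith
  have hs : 0 < |sin (θ - δ)| := abs_pos.mpr h0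
  have h2 : (1 - m) ^ 2 / 2 / |t| ≤ (1 - m) ^ 2 / (2 * |sin (θ - δ)|) := by
    rw [div_div]
    exact div_le_div_of_nonneg_left (sq_nonneg _) (by positivity) (by linarith)
  have h3 : (1 - m) ^ 2 ≤ (1 - r * cos θ) ^ 2 := by nlinarith
  split_ifs with h
  · rw [abs_of_pos h] at h2 hs
    have := div_le_div_of_nonneg_right h3 (by positivity : 0 ≤ 2 * sin (θ - δ))
    linarith
  · rw [abs_of_nonpos (not_lt.mp h)] at h2 hs
    have h4 : (1 - m) ^ 2 ≤ 1 - (r * cos θ) ^ 2 := by nlinarith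
    have := div_le_div_of_nonneg_right h4 (by positivity : 0 ≤ 2 * -sin (θ - δ))
    linarith

/-- If the second leg can be nearly parallel to the shores while the swimmer is still in the
water at the corner, then the expected escape length is infinite. -/
lemma expectedEscapeLength_eq_top {μ : Measure (ℝ × ℝ)} (hμ : IsStartLaw μ) {r δ : ℝ}
    (hr : 0 ≤ r) (hδ : |δ| ≤ π / 2) (h : r * cos δ < 1) :
    expectedEscapeLength μ r (π / 2 - δ) = ∞ := by
  have hp := pi_pos
  rw [expectedEscapeLength_eq_lintegral_headingMean hμ hr]
  have key : ∃ a b m : ℝ, 0 ≤ a ∧ a < b ∧ b ≤ π / 2 ∧ |δ| ∈ Icc a b ∧ m < 1 ∧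
      (∀ θ ∈ Ioo a b, r * cos θ ≤ m) ∧ ∀ θ ∈ Ioo a b, θ ≠ |δ| := by
    rcases hδ.eq_or_lt with h1 | h1
    · have hr1 : 0 < 1 / (2 * (r + 1)) := by positivity
      refine ⟨arccos (1 / (2 * (r + 1))), π / 2, 1 / 2, arccos_nonneg _, ?_, le_rfl, ⟨?_, hδ⟩,
        by norm_num, fun θ hθ => ?_, fun θ hθ => ?_⟩
      · exact arccos_lt_pi_div_two.mpr hr1
      · rw [h1]; exact (arccos_lt_pi_div_two.mpr hr1).le
      · have := cos_le_cos_of_nonneg_of_le_pi (arccos_nonneg (1 / (2 * (r + 1))))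
          (by linarith [hθ.2]) hθ.1.le
        rw [cos_arccos (by linarith) (by rw [div_le_one (by positivity)]; linarith),
          le_div_iff₀ (by positivity)] at this
        have hc : 0 ≤ cos θ := (cos_pos_of_mem_Ioo
          ⟨by linarith [hθ.1, arccos_nonneg (1 / (2 * (r + 1)))], hθ.2⟩).le
        nlinarith
      · rw [h1]; exact hθ.2.ne
    · refine ⟨|δ|, π / 2, r * cos δ, abs_nonneg δ, h1, le_rfl, ⟨le_rfl, hδ⟩, h, fun θ hθ => ?_,
        fun θ hθ => hθ.1.ne'⟩
      have := cos_le_cos_of_nonneg_of_le_pi (abs_nonneg δ) (by linarith [hθ.2]) hθ.1.le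
      rw [cos_abs] at this
      exact mul_le_mul_of_nonneg_left this hr
  obtain ⟨a, b, m, ha, hab, hb, hmem, hm, hle, hne⟩ := key
  have h2 : ∫⁻ θ in Ioo a b, ENNReal.ofReal ((1 - m) ^ 2 / 2 / |θ - (|δ|)|) = ∞ :=
    lintegral_inv_abs_sub_eq_top hab hmem (by have : 0 < 1 - m := by linarith
                                              positivity)
  have h3 : ∫⁻ θ in Ioo a b, ENNReal.ofReal ((1 - m) ^ 2 / 2 / |θ - (|δ|)|) ≤
      ∫⁻ θ in Ioo 0 (π / 2),
        (ENNReal.ofReal (headingMean r δ θ) + ENNReal.ofReal (headingMean r δ (-θ))) := by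
    refine (setLIntegral_mono' measurableSet_Ioo fun θ hθ => ?_).trans
      (lintegral_mono_set (Ioo_subset_Ioo ha hb))
    have hc : 0 ≤ cos θ :=
      (cos_pos_of_mem_Ioo ⟨by linarith [hθ.1], by linarith [hθ.2]⟩).le
    have hδpos := abs_nonneg δ
    have hsin : ∀ y : ℝ, |y| = |θ - (|δ|)| → sin y ≠ 0 := by
      intro y hy hy0
      have hlt : |y| < π := by
        rw [hy, abs_lt]; constructor <;> linarith [hθ.1, hθ.2]
      have hy1 := (sin_eq_zero_iff_of_lt_of_lt (abs_lt.mp hlt).1 (abs_lt.mp hlt).2).mp hy0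
      rw [hy1, abs_zero] at hy
      exact hne θ hθ (by linarith [abs_eq_zero.mp hy.symm])
    rcases le_total 0 δ with hd | hd
    · rw [abs_of_nonneg hd] at hsin ⊢
      refine le_add_right (ENNReal.ofReal_le_ofReal ?_)
      exact div_abs_le_headingMean hr hc hm (hle θ hθ) (abs_sin_le_abs) (hsin _ rfl)
    · rw [abs_of_nonpos hd] at hsin ⊢
      refine le_add_left (ENNReal.ofReal_le_ofReal ?_)
      have e : |-θ - δ| = |θ - -δ| := by rw [← abs_neg]; ring_nf
      refine div_abs_le_headingMean hr (by rwa [cos_neg]) hm (by rw [cos_neg]; exact hle θ hθ)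
        (abs_sin_le_abs.trans e.le) (hsin _ e)
  rw [h2, top_le_iff] at h3
  rw [h3, ENNReal.mul_top]
  rw [ne_eq, ENNReal.ofReal_eq_zero, not_le]; positivity

/-! ### The closed form -/

lemma sin_arccos_inv_pos {r : ℝ} (hr : 1 < r) : 0 < sin (arccos (1 / r)) := by
  refine sin_pos_of_pos_of_lt_pi ?_ (by linarith [arccos_inv_lt hr.le, pi_pos])
  rw [arccos_pos, div_lt_one (by linarith)]
  exact hr

lemma sqrt_sq_sub_one {r : ℝ} (hr : 1 < r) : √(r ^ 2 - 1) = r * sin (arccos (1 / r)) := by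
  have hs := sin_arccos_inv_pos hr
  have hc := cos_arccos_inv hr.le
  rw [sqrt_eq_iff_mul_self_eq (by nlinarith) (by positivity)]
  have h1 : r * cos (arccos (1 / r)) = 1 := by rw [hc]; field_simp
  have := sin_sq_add_cos_sq (arccos (1 / r))
  have h2 : r ^ 2 * cos (arccos (1 / r)) ^ 2 = 1 := by rw [← mul_pow, h1, one_pow]
  nlinarith

lemma log_one_add_cos_add_log_one_sub_cos {x : ℝ} (h : 0 < sin x) :
    log (1 + cos x) + log (1 - cos x) = 2 * log (sin x) := by
  have h1 := one_add_cos_pos_of_sin_pos h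
  have h2 : 0 < 1 - cos x := by
    have := one_add_cos_pos_of_sin_pos (x := π - x) (by rwa [sin_pi_sub])
    rwa [cos_pi_sub, ← sub_eq_add_neg] at this
  rw [← log_mul h1.ne' h2.ne', show (1 + cos x) * (1 - cos x) = sin x ^ 2 by
    nlinarith [sin_sq_add_cos_sq x], log_pow]
  norm_num

lemma one_sub_cos_pos_of_sin_pos {x : ℝ} (h : 0 < sin x) : 0 < 1 - cos x := by
  have := one_add_cos_pos_of_sin_pos (x := π - x) (by rwa [sin_pi_sub])
  rwa [cos_pi_sub, ← sub_eq_add_neg] at this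

/-- After the substitution `√(r ^ 2 - 1) = r * sin β`, all arguments of logarithms in `closedForm`
factor into terms `1 ± cos (β - δ)`, `1 ± cos (β + δ)` and `1 ± sin δ`. -/
lemma total_eq_closedForm {r δ : ℝ} (hr : 1 < r) (h0 : 0 < δ) (hδ : δ < arccos (1 / r)) :
    total r δ = closedForm r (π / 2 - δ) := by
  have hp := pi_pos
  have hβ := arccos_inv_lt hr.le
  have hsβ := sin_arccos_inv_pos hr
  have hr0 : 0 < r := by linarith
  have hcβ : r * cos (arccos (1 / r)) = 1 := by rw [cos_arccos_inv hr.le]; field_simp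
  unfold total mainPart turnPart closedForm
  rw [cos_pi_div_two_sub, sin_pi_div_two_sub, sqrt_sq_sub_one hr]
  generalize arccos (1 / r) = β at *
  have hlogr : log (cos β) = -log r := by
    rw [← log_inv]; congr 1; field_simp; linarith
  have hS : 0 < sin (β - δ) := sin_pos_of_pos_of_lt_pi (by linarith) (by linarith)
  have hW : 0 < sin (β + δ) := sin_pos_of_pos_of_lt_pi (by linarith) (by linarith)
  have hD : 0 < cos δ := cos_pos_of_mem_Ioo ⟨by linarith, by linarith⟩
  have hD' : 0 < sin (π / 2 - δ) := by rwa [sin_pi_div_two_sub]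
  have e1 := log_one_add_cos_add_log_one_sub_cos hS
  have e2 := log_one_add_cos_add_log_one_sub_cos hW
  have e3 := log_one_add_cos_add_log_one_sub_cos hD'
  rw [sin_pi_div_two_sub, cos_pi_div_two_sub] at e3
  have p1 := one_add_cos_pos_of_sin_pos hS
  have p2 := one_sub_cos_pos_of_sin_pos hS
  have p3 := one_add_cos_pos_of_sin_pos hW
  have p4 := one_sub_cos_pos_of_sin_pos hW
  have p5 := one_add_cos_pos_of_sin_pos hD'
  have p6 := one_sub_cos_pos_of_sin_pos hD'
  rw [cos_pi_div_two_sub] at p5 p6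
  have a1 : r * sin β + r = r * (1 + sin β) := by ring
  have a2 : (r * sin β * cos δ - sin δ) / (r * cos δ) = sin (β - δ) / cos δ := by
    rw [div_eq_div_iff (by positivity) hD.ne', sin_sub]
    linear_combination (sin δ * cos δ) * hcβ
  have a3 : r * sin β * sin δ + cos δ + r = r * (1 + cos (β - δ)) := by
    rw [cos_sub]; linear_combination (-cos δ) * hcβ
  have a4 : r * sin β * sin δ - cos δ + r = r * (1 - cos (β + δ)) := by
    rw [cos_add]; linear_combination (cos δ) * hcβ
  have a5 : -(r * sin β) * sin δ ^ 2 - (cos δ + r * sin β - r) * sin δ - cos δ + r =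
      r * ((1 + sin δ) * (1 - cos (β - δ))) := by
    rw [cos_sub]; linear_combination (cos δ * (1 + sin δ)) * hcβ
  have a6 : -(r * sin β) * sin δ ^ 2 + (cos δ - r * sin β + r) * sin δ + cos δ + r =
      r * ((1 + sin δ) * (1 + cos (β + δ))) := by
    rw [cos_add]; linear_combination (-cos δ * (1 + sin δ)) * hcβ
  rw [a1, a2, a3, a4, a5, a6, log_mul hr0.ne' (by positivity), log_div hS.ne' hD.ne',
    log_mul hr0.ne' p1.ne', log_mul hr0.ne' p4.ne', log_mul hr0.ne' (by positivity),
    log_mul p5.ne' p2.ne', log_mul hr0.ne' (by positivity), log_mul p5.ne' p3.ne', hlogr]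
  have b1 : log (1 - cos (β - δ)) = 2 * log (sin (β - δ)) - log (1 + cos (β - δ)) := by linarith
  have b2 : log (1 - cos (β + δ)) = 2 * log (sin (β + δ)) - log (1 + cos (β + δ)) := by linarith
  have b3 : log (1 - sin δ) = 2 * log (cos δ) - log (1 + sin δ) := by linarith
  rw [b1, b2, b3, cos_sub β δ, cos_add β δ]
  have hcβ2 : cos β = 1 / r := by field_simp; linarith
  rw [hcβ2]
  field_simp
  ring

/-! ### First and second derivatives of the two parts -/

/-- The integral of `1 / sin (θ + δ)` over `θ ∈ [arccos (1 / r), π / 2]`. -/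
def cscInt (r δ : ℝ) : ℝ :=
  log (cos δ) - log (1 - sin δ) - log (sin (arccos (1 / r) + δ)) +
    log (1 + cos (arccos (1 / r) + δ))

/-- The partial derivative of `mainPart` with respect to `r`. -/
def mainDerivR (r δ : ℝ) : ℝ :=
  2 * (π / 2 - arccos (1 / r)) - 2 * r * (1 - sin (arccos (1 / r)))
    - r * (cos δ ^ 2 * cscInt r δ - cos (arccos (1 / r) - δ) + sin δ)

/-- The partial derivative of `mainPart` with respect to `δ`. -/
def mainDerivD (r δ : ℝ) : ℝ :=
  r ^ 2 * (sin δ * cos δ) * cscInt r δ + (2 * cos δ)⁻¹ - r ^ 2 * cos δ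
    + r ^ 2 * sin (arccos (1 / r) - δ)

/-- The second partial derivative of `mainPart` with respect to `r`. -/
def mainDerivRR (r δ : ℝ) : ℝ :=
  1 / (r ^ 3 * sin (arccos (1 / r)) * sin (arccos (1 / r) + δ)) - 2 * (1 - sin (arccos (1 / r)))
    - (cos δ ^ 2 * cscInt r δ - cos (arccos (1 / r) - δ) + sin δ)

/-- The mixed second partial derivative of `mainPart`. -/
def mainDerivRD (r δ : ℝ) : ℝ :=
  r * (2 * sin δ * cos δ * cscInt r δ - 2 * cos δ + 2 * sin (arccos (1 / r) - δ))
    + 1 / (r * sin (arccos (1 / r) + δ))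

/-- The second partial derivative of `mainPart` with respect to `δ`. -/
def mainDerivDD (r δ : ℝ) : ℝ :=
  r ^ 2 * ((cos δ ^ 2 - sin δ ^ 2) * cscInt r δ - sin δ * cos δ / sin (arccos (1 / r) + δ)
    + 2 * sin δ - cos (arccos (1 / r) - δ)) + sin δ / (2 * cos δ ^ 2)

/-- The partial derivative of `turnPart` with respect to `r`. -/
def turnDerivR (r δ : ℝ) : ℝ :=
  -(cos δ * (log (cos δ) - log (sin (arccos (1 / r) - δ))) - sin δ * (π / 2 - arccos (1 / r)))
    + r * (cos δ ^ 2 * ((log (cos δ) - log (sin (arccos (1 / r) - δ)))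
      - (log (1 + sin δ) - log (1 + cos (arccos (1 / r) - δ))))
      - cos (arccos (1 / r) + δ) - sin δ)

/-- The partial derivative of `turnPart` with respect to `δ`. -/
def turnDerivD (r δ : ℝ) : ℝ :=
  (1 - r * cos δ) * r * sin δ * (log (cos δ) - log (sin (arccos (1 / r) - δ)))
    + r ^ 2 * cos δ * sin δ * (log (1 + sin δ) - log (1 + cos (arccos (1 / r) - δ)))
    + r * cos δ * (π / 2 - arccos (1 / r)) - r ^ 2 * cos δ + r ^ 2 * sin (arccos (1 / r) + δ)
    - 1 / (2 * cos δ)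

lemma hasDerivAt_arccos_inv {R : ℝ → ℝ} {h t : ℝ} (hR : HasDerivAt R h t) (h1 : 1 < R t) :
    HasDerivAt (fun t => arccos (1 / R t)) (h / (R t ^ 2 * sin (arccos (1 / R t)))) t := by
  have h0 : 0 < R t := by linarith
  have hlt : 1 / R t < 1 := by rw [div_lt_one h0]; exact h1
  have hgt : -1 < 1 / R t := by
    have : 0 < 1 / R t := by positivity
    linarith
  have h2 := (hasDerivAt_arccos hgt.ne' hlt.ne).comp t (hR.fun_inv h0.ne' |>.congr_of_eventuallyEq
    (Filter.Eventually.of_forall fun s => one_div (R s)))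
  refine h2.congr_deriv ?_
  rw [sin_arccos]
  have : 0 < √(1 - (1 / R t) ^ 2) := by
    apply sqrt_pos.mpr
    have : 0 < 1 / R t := by positivity
    nlinarith
  field_simp

/- The derivatives are taken along an arbitrary differentiable curve `t ↦ (R t, Δ t)` with velocity
`(h, l)`, so that one statement covers both partial derivatives and the derivatives along segments.
-/

section Derivatives

variable {R Δ : ℝ → ℝ} {h l t : ℝ}

lemma hasDerivAt_cscInt (hR : HasDerivAt R h t) (hΔ : HasDerivAt Δ l t) (h1 : 1 < R t)
    (hc : 0 < cos (Δ t)) (hw : 0 < sin (arccos (1 / R t) + Δ t)) :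
    HasDerivAt (fun t => cscInt (R t) (Δ t))
      (-(h / (R t ^ 2 * sin (arccos (1 / R t))) + l) / sin (arccos (1 / R t) + Δ t)
        + l / cos (Δ t)) t := by
  have hb := hasDerivAt_arccos_inv hR h1
  have hw1 := one_add_cos_pos_of_sin_pos hw
  have hs1 : 0 < 1 - sin (Δ t) := by
    have := one_sub_cos_pos_of_sin_pos (x := π / 2 - Δ t) (by rwa [sin_pi_div_two_sub])
    rwa [cos_pi_div_two_sub] at this
  have hbw := hb.add hΔ
  have := ((hΔ.cos.log hc.ne').sub ((hΔ.sin.const_sub 1).log hs1.ne')).sub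
    (hbw.sin.log hw.ne') |>.add ((hbw.cos.const_add 1).log hw1.ne')
  refine this.congr_deriv ?_
  simp only [Pi.add_apply]
  have e1 : cos (arccos (1 / R t) + Δ t) / sin (arccos (1 / R t) + Δ t) +
      sin (arccos (1 / R t) + Δ t) / (1 + cos (arccos (1 / R t) + Δ t)) =
      1 / sin (arccos (1 / R t) + Δ t) := by
    rw [div_add_div _ _ hw.ne' hw1.ne', div_eq_div_iff (by positivity) hw.ne']
    nlinarith [sin_sq_add_cos_sq (arccos (1 / R t) + Δ t)]
  have e2 : -sin (Δ t) / cos (Δ t) + cos (Δ t) / (1 - sin (Δ t)) = 1 / cos (Δ t) := by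
    rw [div_add_div _ _ hc.ne' hs1.ne', div_eq_div_iff (by positivity) hc.ne']
    nlinarith [sin_sq_add_cos_sq (Δ t)]
  generalize h / (R t ^ 2 * sin (arccos (1 / R t))) = q
  linear_combination (-(q + l)) * e1 + l * e2

/-- The factorization that makes the boundary terms at `θ = β` cancel in the derivatives. -/
lemma one_sub_mul_cos_sq (r δ : ℝ) (hr : 1 < r) :
    1 - (r * cos δ) ^ 2 =
      -(r ^ 2 * (sin (arccos (1 / r) - δ) * sin (arccos (1 / r) + δ))) := by
  rw [sin_sub_mul_sin_add, cos_arccos_inv hr.le]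
  field_simp; ring

lemma hasDerivAt_mainPart (hR : HasDerivAt R h t) (hΔ : HasDerivAt Δ l t) (h1 : 1 < R t)
    (hc : 0 < cos (Δ t)) (hw : 0 < sin (arccos (1 / R t) + Δ t)) :
    HasDerivAt (fun t => mainPart (R t) (Δ t))
      (h * mainDerivR (R t) (Δ t) + l * mainDerivD (R t) (Δ t)) t := by
  have hb := hasDerivAt_arccos_inv hR h1
  have hsβ := sin_arccos_inv_pos h1
  have hcβ := cos_arccos_inv h1.le
  have hr0 : 0 < R t := by linarith
  have hcβ0 : 0 < cos (arccos (1 / R t)) := by rw [hcβ]; positivity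
  have hB := hasDerivAt_cscInt hR hΔ h1 hc hw
  have := ((hb.sin.const_add 1).log (by positivity)).sub (hb.cos.log hcβ0.ne') |>.add
    ((hR.const_mul 2).mul (hb.const_sub (π / 2))) |>.sub ((hR.pow 2).mul (hb.sin.const_sub 1))
    |>.add (((((hR.mul hΔ.cos).pow 2).const_sub 1).mul hB |>.add
      ((hR.pow 2).mul ((hb.sub hΔ).cos.sub hΔ.sin))).const_mul (1 / 2))
  refine HasDerivAt.congr_deriv (f := fun t => mainPart (R t) (Δ t)) this ?_
  simp only [Pi.sub_apply, Pi.mul_apply, Pi.pow_apply, mainDerivR, mainDerivD]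
  have hk := one_sub_mul_cos_sq (R t) (Δ t) h1
  have e1 : cos (arccos (1 / R t)) / (1 + sin (arccos (1 / R t))) +
      sin (arccos (1 / R t)) / cos (arccos (1 / R t)) = R t := by
    have h2 : 1 / cos (arccos (1 / R t)) = R t := by rw [hcβ]; field_simp
    refine Eq.trans ?_ h2
    rw [div_add_div _ _ (by positivity) hcβ0.ne', div_eq_div_iff (by positivity) hcβ0.ne']
    nlinarith [sin_sq_add_cos_sq (arccos (1 / R t))]
  have hrc : R t * cos (arccos (1 / R t)) = 1 := by rw [hcβ]; field_simp
  rw [hk]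
  generalize arccos (1 / R t) = β at *
  generalize h / (R t ^ 2 * sin β) = q
  generalize cscInt (R t) (Δ t) = B
  have e2 : R t ^ 2 * cos β = R t := by linear_combination R t * hrc
  have e3 : cos (Δ t) ^ 2 * R t ^ 2 = 1 + R t ^ 2 * (sin (β - Δ t) * sin (β + Δ t)) := by
    linear_combination -hk
  have e4 : sin (β + Δ t) * (sin (β + Δ t))⁻¹ = 1 := mul_inv_cancel₀ hw.ne'
  have e5 : cos (Δ t) * (cos (Δ t))⁻¹ = 1 := mul_inv_cancel₀ hc.ne'
  linear_combination q * e1 + q * e2 + 1 / 2 * R t ^ 2 * sin (β - Δ t) * (q + l) * e4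
    + 1 / 2 * l * (cos (Δ t))⁻¹ * e3 - 1 / 2 * l * R t ^ 2 * cos (Δ t) * e5

lemma hasDerivAt_mainDerivR (hR : HasDerivAt R h t) (hΔ : HasDerivAt Δ l t) (h1 : 1 < R t)
    (hc : 0 < cos (Δ t)) (hw : 0 < sin (arccos (1 / R t) + Δ t)) :
    HasDerivAt (fun t => mainDerivR (R t) (Δ t))
      (h * mainDerivRR (R t) (Δ t) + l * mainDerivRD (R t) (Δ t)) t := by
  have hb := hasDerivAt_arccos_inv hR h1
  have hsβ := sin_arccos_inv_pos h1
  have hcβ := cos_arccos_inv h1.le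
  have hr0 : 0 < R t := by linarith
  have hB := hasDerivAt_cscInt hR hΔ h1 hc hw
  have := ((hb.const_sub (π / 2)).const_mul 2).sub ((hR.const_mul 2).mul (hb.sin.const_sub 1)) |>.sub
    (hR.mul ((((hΔ.cos.pow 2).mul hB).sub (hb.sub hΔ).cos).add hΔ.sin))
  refine HasDerivAt.congr_deriv (f := fun t => mainDerivR (R t) (Δ t)) this ?_
  simp only [Pi.add_apply, Pi.sub_apply, Pi.mul_apply, Pi.pow_apply, mainDerivRR, mainDerivRD]
  have hrc : R t * cos (arccos (1 / R t)) = 1 := by rw [hcβ]; field_simp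
  have t1 : h * (1 / (R t ^ 3 * sin (arccos (1 / R t)) * sin (arccos (1 / R t) + Δ t))) =
      h / (R t ^ 2 * sin (arccos (1 / R t))) * (R t * cos (arccos (1 / R t)) ^ 2) *
        (sin (arccos (1 / R t) + Δ t))⁻¹ := by
    rw [hcβ]; field_simp
  have t2 : 1 / (R t * sin (arccos (1 / R t) + Δ t)) =
      R t * cos (arccos (1 / R t)) ^ 2 * (sin (arccos (1 / R t) + Δ t))⁻¹ := by
    rw [hcβ]; field_simp
  generalize arccos (1 / R t) = β at *
  generalize h / (R t ^ 2 * sin β) = q at *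
  generalize cscInt (R t) (Δ t) = B
  have e3 := sin_sub_mul_sin_add β (Δ t)
  have e4 : sin (β + Δ t) * (sin (β + Δ t))⁻¹ = 1 := mul_inv_cancel₀ hw.ne'
  have e5 : cos (Δ t) * (cos (Δ t))⁻¹ = 1 := mul_inv_cancel₀ hc.ne'
  linear_combination 2 * q * hrc - t1 - l * t2
    - R t * (sin (β + Δ t))⁻¹ * (q + l) * e3 + R t * sin (β - Δ t) * (q + l) * e4
    - R t * cos (Δ t) * l * e5

lemma hasDerivAt_mainDerivD (hR : HasDerivAt R h t) (hΔ : HasDerivAt Δ l t) (h1 : 1 < R t)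
    (hc : 0 < cos (Δ t)) (hw : 0 < sin (arccos (1 / R t) + Δ t)) :
    HasDerivAt (fun t => mainDerivD (R t) (Δ t))
      (h * mainDerivRD (R t) (Δ t) + l * mainDerivDD (R t) (Δ t)) t := by
  have hb := hasDerivAt_arccos_inv hR h1
  have hsβ := sin_arccos_inv_pos h1
  have hcβ := cos_arccos_inv h1.le
  have hr0 : 0 < R t := by linarith
  have hB := hasDerivAt_cscInt hR hΔ h1 hc hw
  have := ((((hR.pow 2).mul (hΔ.sin.mul hΔ.cos)).mul hB).add
    ((hΔ.cos.const_mul 2).fun_inv (by positivity))).sub ((hR.pow 2).mul hΔ.cos) |>.add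
    ((hR.pow 2).mul (hb.sub hΔ).sin)
  refine HasDerivAt.congr_deriv (f := fun t => mainDerivD (R t) (Δ t)) this ?_
  simp only [Pi.sub_apply, Pi.mul_apply, Pi.pow_apply, mainDerivDD, mainDerivRD]
  have hrc : R t * cos (arccos (1 / R t)) = 1 := by rw [hcβ]; field_simp
  have hq : h = h / (R t ^ 2 * sin (arccos (1 / R t))) * (R t ^ 2 * sin (arccos (1 / R t))) := by
    field_simp
  have t2 : 1 / (R t * sin (arccos (1 / R t) + Δ t)) =
      R t * cos (arccos (1 / R t)) ^ 2 * (sin (arccos (1 / R t) + Δ t))⁻¹ := by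
    rw [hcβ]; field_simp
  have t3 : -(2 * (-sin (Δ t) * l)) / (2 * cos (Δ t)) ^ 2 =
      l * (sin (Δ t) / (2 * cos (Δ t) ^ 2)) := by field_simp
  generalize arccos (1 / R t) = β at *
  generalize h / (R t ^ 2 * sin β) = q at *
  generalize cscInt (R t) (Δ t) = B
  have e4 : sin (β + Δ t) * (sin (β + Δ t))⁻¹ = 1 := mul_inv_cancel₀ hw.ne'
  have e5 : cos (Δ t) * (cos (Δ t))⁻¹ = 1 := mul_inv_cancel₀ hc.ne'
  have e7 : cos (β - Δ t) * sin (β + Δ t) = sin (Δ t) * cos (Δ t) + sin β * cos β := by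
    rw [cos_sub, sin_add]
    linear_combination sin β * cos β * sin_sq_add_cos_sq (Δ t)
      + sin (Δ t) * cos (Δ t) * sin_sq_add_cos_sq β
  linear_combination t3 - h * t2 - R t * cos β ^ 2 * (sin (β + Δ t))⁻¹ * hq
    - R t ^ 2 * q * (sin β * cos β) * (sin (β + Δ t))⁻¹ * hrc
    - R t ^ 2 * q * cos (β - Δ t) * e4 + R t ^ 2 * q * (sin (β + Δ t))⁻¹ * e7
    + R t ^ 2 * sin (Δ t) * l * e5

lemma hasDerivAt_turnPart (hR : HasDerivAt R h t) (hΔ : HasDerivAt Δ l t) (h1 : 1 < R t)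
    (hc : 0 < cos (Δ t)) (hσ : 0 < sin (arccos (1 / R t) - Δ t)) :
    HasDerivAt (fun t => turnPart (R t) (Δ t))
      (h * turnDerivR (R t) (Δ t) + l * turnDerivD (R t) (Δ t)) t := by
  have hb := hasDerivAt_arccos_inv hR h1
  have hsβ := sin_arccos_inv_pos h1
  have hcβ := cos_arccos_inv h1.le
  have hr0 : 0 < R t := by linarith
  have hσ1 := one_add_cos_pos_of_sin_pos hσ
  have hs1 : 0 < 1 + sin (Δ t) := by
    have := one_add_cos_pos_of_sin_pos (x := π / 2 - Δ t) (by rwa [sin_pi_div_two_sub])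
    rwa [cos_pi_div_two_sub] at this
  have hbσ := hb.sub hΔ
  have hbw := hb.add hΔ
  have hx := (hR.mul hΔ.cos)
  have := ((((hx.const_sub 1).pow 2).mul ((hΔ.cos.log hc.ne').sub (hbσ.sin.log hσ.ne'))).sub
    (((hx.pow 2).const_add 1).mul
      ((hΔ.sin.const_add 1).log hs1.ne' |>.sub ((hbσ.cos.const_add 1).log hσ1.ne')))).add
    (((hR.const_mul 2).mul hΔ.sin).mul (hb.const_sub (π / 2))) |>.sub
    ((hR.pow 2).mul (hΔ.sin.add hbw.cos)) |>.const_mul (1 / 2)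
  refine HasDerivAt.congr_deriv (f := fun t => turnPart (R t) (Δ t)) this ?_
  simp only [Pi.add_apply, Pi.sub_apply, Pi.mul_apply, Pi.pow_apply, turnDerivR, turnDerivD]
  have hrc : R t * cos (arccos (1 / R t)) = 1 := by rw [hcβ]; field_simp
  have hk := one_sub_mul_cos_sq (R t) (Δ t) h1
  have e1 : sin (arccos (1 / R t) - Δ t) / (1 + cos (arccos (1 / R t) - Δ t)) =
      (1 - cos (arccos (1 / R t) - Δ t)) * (sin (arccos (1 / R t) - Δ t))⁻¹ := by
    rw [← div_eq_mul_inv, div_eq_div_iff hσ1.ne' hσ.ne']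
    nlinarith [sin_sq_add_cos_sq (arccos (1 / R t) - Δ t)]
  have e2 : cos (Δ t) / (1 + sin (Δ t)) = (1 - sin (Δ t)) * (cos (Δ t))⁻¹ := by
    rw [← div_eq_mul_inv, div_eq_div_iff hs1.ne' hc.ne']
    nlinarith [sin_sq_add_cos_sq (Δ t)]
  generalize arccos (1 / R t) = β at *
  generalize h / (R t ^ 2 * sin β) = q at *
  have e4 : sin (β - Δ t) * (sin (β - Δ t))⁻¹ = 1 := mul_inv_cancel₀ hσ.ne'
  have e5 : cos (Δ t) * (cos (Δ t))⁻¹ = 1 := mul_inv_cancel₀ hc.ne'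
  have e6 : R t * (cos (β - Δ t) * cos (Δ t) - sin (β - Δ t) * sin (Δ t)) = 1 := by
    rw [← cos_add, sub_add_cancel, hrc]
  have e8 : 1 / (2 * cos (Δ t)) = (cos (Δ t))⁻¹ / 2 := by field_simp
  linear_combination l * e8 - 1 / 2 * (1 + (R t * cos (Δ t)) ^ 2) * (q - l) * e1
    - 1 / 2 * (1 + (R t * cos (Δ t)) ^ 2) * l * e2 + (q - l) * (sin (β - Δ t))⁻¹ * e6
    + 1 / 2 * (q - l) * (sin (β - Δ t))⁻¹ * hk
    + 1 / 2 * (q - l) * (2 * R t * sin (Δ t) - R t ^ 2 * sin (β + Δ t)) * e4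
    + l * (R t * sin (Δ t) - 1 / 2 * R t ^ 2 * cos (Δ t)) * e5

end Derivatives

/-! ### Polynomial bounds for the second derivatives -/

/-- Polynomial minorant of `∂²/∂r²` of `mainPart`, multiplied by `sin (β + δ) ^ 2`, in terms of
`t = tan (β / 2)` and `L = tan (δ / 2) / t`. -/
def boundRR (t L : ℝ) : ℝ :=
  (1 - L) * (1 - 1.2 * t - 7 * t ^ 2) + L * (2 - 2.5 * t - 37 * t ^ 2 + 65 * t ^ 3)

/-- Majorant of the mixed second derivative of `mainPart`, multiplied by `sin (β + δ)`. -/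
def boundRD (t L : ℝ) : ℝ :=
  (1 - L) * (1 - 3.85 * t + 4.7 * t ^ 2) + L * (1 - 6.4 * t + 12.8 * t ^ 2)

/-- Minorant of the second derivative of `mainPart` with respect to `δ`. -/
def boundDD (t L : ℝ) : ℝ :=
  (1 - L) * (1.59 - 4.65 * t + 3 * t ^ 2) + L * (1.1 - 5.2 * t + 7.6 * t ^ 2)
    - L * (1 - L) * (0.37 + 0.8 * t)

lemma exists_eq_div_one_add {c t : ℝ} (ht : 0 < t) (htc : t ≤ c) :
    ∃ x : ℝ, 0 ≤ x ∧ t = c / (1 + x) := by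
  refine ⟨c / t - 1, ?_, ?_⟩
  · rw [sub_nonneg, le_div_iff₀ ht]; linarith
  · have : c ≠ 0 := by linarith
    rw [add_sub_cancel]; field_simp

section Polynomials

/- The substitution `t = (2 / 9) / (1 + x)`, `L = 1 / (1 + y)` maps `x, y ≥ 0` onto the rectangle
`0 < t ≤ 2 / 9`, `0 < L ≤ 1` and turns each of the following polynomial inequalities into one with
nonnegative coefficients only. -/

variable {t L : ℝ} (ht : 0 < t) (ht' : t ≤ 2 / 9) (hL : 0 < L) (hL' : L ≤ 1)
include ht ht' hL hL'

set_option maxRecDepth 100000 in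
set_option maxHeartbeats 2000000 in
lemma boundRR_mul_le :
    boundRR t L * ((1 + t ^ 2) ^ 3 * (1 + (L * t) ^ 2) ^ 4) ≤
      (1 - t ^ 2) ^ 3 * (1 - (L * t) ^ 2 + (1 - t ^ 2) * L) * (1 + (L * t) ^ 2) ^ 3
      - (2 * (t + L * t) * (1 - t * (L * t))) ^ 2 * ((2 * (1 + t ^ 2) - 4 * t)
        * (1 + (L * t) ^ 2) ^ 2 + 0.61 * (1 - (L * t) ^ 2) ^ 2 * (1 + t ^ 2)
        - ((1 - t ^ 2) * (1 - (L * t) ^ 2) + 4 * t * (L * t)) * (1 + (L * t) ^ 2)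
        + 2 * (L * t) * (1 + t ^ 2) * (1 + (L * t) ^ 2))
      - 1 / 5 * (2 * (t + L * t) * (1 - t * (L * t))) * (1 - (L * t) ^ 2) * (1 + L * t) ^ 2 * 2
        * (1 - t * (L * t)) ^ 2 * (1 + t ^ 2) := by
  rw [← sub_nonneg]
  obtain ⟨x, hx, rfl⟩ := exists_eq_div_one_add ht ht'
  obtain ⟨y, hy, rfl⟩ := exists_eq_div_one_add hL hL'
  unfold boundRR
  field_simp
  ring_nf
  positivity

set_option maxRecDepth 100000 in
set_option maxHeartbeats 2000000 in
lemma le_boundRD_mul :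
    (1 - t ^ 2) ^ 2 * (1 + (L * t) ^ 2) ^ 3 - 2 * (
      2 * (t + L * t) * (1 - t * (L * t)) * (1 - (L * t) ^ 2) * (1 + t ^ 2) * (1 + (L * t) ^ 2)
      - 2 * (t + L * t) * (1 - t * (L * t)) * (2 * (t - L * t) * (1 + t * (L * t)))
        * (1 + (L * t) ^ 2)
      - 0.61 * 2 * (L * t) * (1 - (L * t) ^ 2) * (2 * (t + L * t) * (1 - t * (L * t)))
        * (1 + t ^ 2)
      - 1 / 5 * 4 * (L * t) * (1 + L * t) ^ 2 * (1 - t * (L * t)) ^ 2 * (1 + t ^ 2)) ≤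
    boundRD t L * ((1 - t ^ 2) * (1 + t ^ 2) * (1 + (L * t) ^ 2) ^ 3) := by
  rw [← sub_nonneg]
  obtain ⟨x, hx, rfl⟩ := exists_eq_div_one_add ht ht'
  obtain ⟨y, hy, rfl⟩ := exists_eq_div_one_add hL hL'
  unfold boundRD
  field_simp
  ring_nf
  positivity

set_option maxRecDepth 100000 in
set_option maxHeartbeats 2000000 in
lemma boundDD_mul_le :
    boundDD t L * ((1 - t ^ 2) ^ 2 * (1 + (L * t) ^ 2) ^ 2 * (1 - t * (L * t)) * (1 + L * t)
      * (1 + L)) ≤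
    (((1 - (L * t) ^ 2) ^ 2 - 4 * (L * t) ^ 2) * (2.609 * (1 - t * (L * t)) * (1 + L * t)
        - 5 * (t + L * t) * (1 - L * t)) * (1 + L) * (1 + t ^ 2)
      - L * (1 + t ^ 2) * (1 - (L * t) ^ 2) * (1 + t ^ 2) * (1 + (L * t) ^ 2) * (1 + L * t)
      + (4 * (L * t) * (1 + t ^ 2) - ((1 - t ^ 2) * (1 - (L * t) ^ 2) + 4 * t * (L * t)))
        * (1 + (L * t) ^ 2) * (1 - t * (L * t)) * (1 + L * t) * (1 + L)) * (1 + t ^ 2)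
      + L * t * (1 + (L * t) ^ 2) * (1 + 2 * (L * t) ^ 2) * (1 - t ^ 2) ^ 2 * (1 + (L * t) ^ 2) ^ 2
        * (1 - t * (L * t)) * (1 + L * t) * (1 + L) := by
  rw [← sub_nonneg]
  obtain ⟨x, hx, rfl⟩ := exists_eq_div_one_add ht ht'
  obtain ⟨y, hy, rfl⟩ := exists_eq_div_one_add hL hL'
  unfold boundDD
  field_simp
  ring_nf
  positivity

lemma bound_det_pos :
    0 < (boundRR t L - 0.05 * (2 * t * (1 + L)) ^ 2) * (boundDD t L - 0.05) - boundRD t L ^ 2 := by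
  obtain ⟨x, hx, rfl⟩ := exists_eq_div_one_add ht ht'
  obtain ⟨y, hy, rfl⟩ := exists_eq_div_one_add hL hL'
  unfold boundDD boundRR boundRD
  field_simp
  ring_nf
  positivity

lemma boundDD_pos : 0 < boundDD t L - 0.05 := by
  obtain ⟨x, hx, rfl⟩ := exists_eq_div_one_add ht ht'
  obtain ⟨y, hy, rfl⟩ := exists_eq_div_one_add hL hL'
  unfold boundDD
  field_simp
  ring_nf
  positivity

end Polynomials

/-! ### Positive definiteness of the Hessian of `mainPart` -/

set_option maxRecDepth 100000 in
set_option maxHeartbeats 2000000 in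
/-- The mixed derivative of `mainPart` is nonnegative: the polynomial form, in the variables of the
preceding section. -/
lemma nonneg_of_boundRD {t L : ℝ} (ht : 0 < t) (ht' : t ≤ 2 / 9) (hL : 0 < L) (hL' : L ≤ 1) :
    0 ≤ (1 - t ^ 2) ^ 2 * (1 + (L * t) ^ 2) ^ 3 - 2 * (
      2 * (t + L * t) * (1 - t * (L * t)) * (1 - (L * t) ^ 2) * (1 + t ^ 2) * (1 + (L * t) ^ 2)
      - 2 * (t + L * t) * (1 - t * (L * t)) * (2 * (t - L * t) * (1 + t * (L * t)))
        * (1 + (L * t) ^ 2)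
      - 2.609 * 2 * (L * t) * (1 - (L * t) ^ 2) * (2 * (t + L * t) * (1 - t * (L * t)))
        * (1 + t ^ 2)
      + 20 * (L * t) * (t + L * t) ^ 2 * (1 - L * t) ^ 2 * (1 + t ^ 2)) := by
  obtain ⟨x, hx, rfl⟩ := exists_eq_div_one_add ht ht'
  obtain ⟨y, hy, rfl⟩ := exists_eq_div_one_add hL hL'
  field_simp
  ring_nf
  positivity

lemma sin_cos_of_tan_half {x t : ℝ} (h0 : 0 ≤ x) (h1 : x < π) (ht : t = tan (x / 2)) :
    sin x = 2 * t / (1 + t ^ 2) ∧ cos x = (1 - t ^ 2) / (1 + t ^ 2) := by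
  have hc : cos x ≠ -1 := by
    intro h
    have := (cos_pos_of_mem_Ioo (x := x / 2) ⟨by linarith, by linarith⟩)
    have h2 := cos_sq (x / 2)
    rw [mul_div_cancel₀ x two_ne_zero, h] at h2
    nlinarith
  rw [ht]
  exact ⟨sin_eq_two_mul_tan_half_div_one_add_tan_half_sq x,
    cos_eq_two_mul_tan_half_div_one_sub_tan_half_sq x hc⟩

/-- The tangent to `log` at `5`, in the variable `1 / q`; the constant is below `1 + log 5`. -/
lemma sub_le_log {q : ℝ} (hq : 0 < q) : 2.609 - 5 / q ≤ log q := by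
  have h := log_le_sub_one_of_pos (x := 5 / q) (by positivity)
  rw [log_div (by norm_num) hq.ne'] at h
  linarith [log_five_gt_d9]

/-- The tangent to `log` at `5`; the constant is above `log 5 - 1`. The numbers `q` of interest
range over a neighbourhood of `5`. -/
lemma log_le_add {q : ℝ} (hq : 0 < q) : log q ≤ 0.61 + q / 5 := by
  have h := log_le_sub_one_of_pos (x := q / 5) (by positivity)
  rw [log_div hq.ne' (by norm_num)] at h
  linarith [log_five_lt_d9]

set_option maxHeartbeats 1000000 in
/-- Bounds for the second derivatives of `mainPart` in terms of the half-angle parameters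
`t = tan (β / 2)` and `L = tan (δ / 2) / t`, with `S = sin (β + δ)`. The range `r ≤ 85 / 77` is
`t ≤ 2 / 9`. -/
lemma exists_mainDeriv_bounds {r δ : ℝ} (hr : 1 < r) (hr' : r ≤ 85 / 77) (h0 : 0 < δ)
    (hδ : δ ≤ arccos (1 / r)) :
    ∃ t L S : ℝ, 0 < t ∧ t ≤ 2 / 9 ∧ 0 < L ∧ L ≤ 1 ∧ 0 < S ∧ S ≤ 2 * t * (1 + L) ∧
      boundRR t L ≤ mainDerivRR r δ * S ^ 2 ∧ |mainDerivRD r δ * S| ≤ boundRD t L ∧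
      boundDD t L ≤ mainDerivDD r δ := by
  have hp := pi_pos
  have hβ := arccos_inv_lt hr.le
  have hcβ := cos_arccos_inv hr.le
  have hr0 : 0 < r := by linarith
  unfold mainDerivRR mainDerivRD mainDerivDD cscInt
  generalize arccos (1 / r) = β at *
  have hβ0 : 0 < β := h0.trans_le hδ
  set t := tan (β / 2) with htdef
  set u := tan (δ / 2) with hudef
  obtain ⟨hsβ, hcβ'⟩ := sin_cos_of_tan_half hβ0.le (by linarith) htdef
  obtain ⟨hsδ, hcδ⟩ := sin_cos_of_tan_half h0.le (by linarith) hudef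
  have ht0 : 0 < t := tan_pos_of_pos_of_lt_pi_div_two (by linarith) (by linarith)
  have hu0 : 0 < u := tan_pos_of_pos_of_lt_pi_div_two (by linarith) (by linarith)
  have hut : u ≤ t := by
    rcases hδ.eq_or_lt with h | h
    · rw [htdef, hudef, h]
    · exact (tan_lt_tan_of_lt_of_lt_pi_div_two (by linarith) (by linarith) (by linarith)).le
  have ht1 : t ≤ 2 / 9 := by
    have h1 : 77 / 85 ≤ 1 / r := by rw [le_div_iff₀ hr0]; linarith
    rw [← hcβ, hcβ', div_le_div_iff₀ (by norm_num) (by positivity)] at h1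
    by_contra hcon
    push Not at hcon
    nlinarith
  have hrt : r = (1 + t ^ 2) / (1 - t ^ 2) := by
    have : 1 - t ^ 2 ≠ 0 := by nlinarith
    have h3 := hcβ.symm.trans hcβ'
    field_simp at h3 ⊢
    linarith
  obtain ⟨L, hL⟩ : ∃ L, L = u / t := ⟨_, rfl⟩
  have huL : u = L * t := by rw [hL]; field_simp
  have hL0 : 0 < L := by rw [hL]; positivity
  have hL1 : L ≤ 1 := by rw [hL, div_le_one ht0]; exact hut
  clear_value t u
  clear hL htdef hudef
  subst huL
  have a1 : 0 < 1 - t ^ 2 := by nlinarith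
  have a2 : 0 < 1 - L * t := by linarith
  have a3 : 0 < 1 - t * (L * t) := by nlinarith
  have a4 : 0 < 1 - (L * t) ^ 2 := by nlinarith
  have a5 : 0 < t + L * t := by positivity
  have n1 : 1 - t * L ≠ 0 := by rw [mul_comm]; exact a2.ne'
  have n2 : 1 - t ^ 2 * L ≠ 0 := by
    rw [show 1 - t ^ 2 * L = 1 - t * (L * t) by ring]; exact a3.ne'
  have n3 : 1 + L ≠ 0 := by positivity
  have hSw : sin (β + δ) = 2 * (t + L * t) * (1 - t * (L * t)) /
      ((1 + t ^ 2) * (1 + (L * t) ^ 2)) := by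
    rw [sin_add, hsβ, hcβ', hsδ, hcδ]; field_simp; ring
  have hCw : cos (β + δ) = ((1 - t * (L * t)) ^ 2 - (t + L * t) ^ 2) /
      ((1 + t ^ 2) * (1 + (L * t) ^ 2)) := by
    rw [cos_add, hsβ, hcβ', hsδ, hcδ]; field_simp; ring
  have hSs : sin (β - δ) = 2 * (t - L * t) * (1 + t * (L * t)) /
      ((1 + t ^ 2) * (1 + (L * t) ^ 2)) := by
    rw [sin_sub, hsβ, hcβ', hsδ, hcδ]; field_simp; ring
  have hCs : cos (β - δ) = ((1 - t ^ 2) * (1 - (L * t) ^ 2) + 4 * t * (L * t)) /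
      ((1 + t ^ 2) * (1 + (L * t) ^ 2)) := by
    rw [cos_sub, hsβ, hcβ', hsδ, hcδ]; field_simp; ring
  set q := (1 + L * t) * (1 - t * (L * t)) / ((1 - L * t) * (t + L * t)) with hq
  have hq0 : 0 < q := by positivity
  have hlog : log (cos δ) - log (1 - sin δ) - log (sin (β + δ)) + log (1 + cos (β + δ)) =
      log q := by
    have e1 : 1 - sin δ = (1 - L * t) ^ 2 / (1 + (L * t) ^ 2) := by
      rw [hsδ]; field_simp; ring
    have e2 : 1 + cos (β + δ) = 2 * (1 - t * (L * t)) ^ 2 / ((1 + t ^ 2) * (1 + (L * t) ^ 2)) := by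
      rw [hCw]; field_simp; ring
    have p1 : 0 < cos δ := by rw [hcδ]; positivity
    have p2 : 0 < 1 - sin δ := by rw [e1]; positivity
    have p3 : 0 < sin (β + δ) := by rw [hSw]; positivity
    have p4 : 0 < 1 + cos (β + δ) := by rw [e2]; positivity
    rw [← log_div p1.ne' p2.ne', ← log_div (by positivity) p3.ne',
      ← log_mul (by positivity) p4.ne', e1, e2, hcδ, hSw, hq]
    congr 1
    field_simp
    ring
  have hB1 := log_le_add hq0
  have hB2 := sub_le_log hq0
  have hS0 : 0 < sin (β + δ) := by rw [hSw]; positivity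
  rw [hlog]
  generalize log q = B at *
  refine ⟨t, L, sin (β + δ), ht0, ht1, hL0, hL1, hS0, ?_, ?_, ?_, ?_⟩
  · rw [hSw, div_le_iff₀ (by positivity)]
    have h1 : 1 - t * (L * t) ≤ (1 + t ^ 2) * (1 + (L * t) ^ 2) := by
      have h3 : 0 < t * (L * t) := by positivity
      have h4 : 1 ≤ (1 + t ^ 2) * (1 + (L * t) ^ 2) :=
        one_le_mul_of_one_le_of_one_le (by linarith [sq_nonneg t]) (by linarith [sq_nonneg (L * t)])
      linarith
    have h2 : 0 ≤ 2 * t * (1 + L) := by positivity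
    have h5 := mul_le_mul_of_nonneg_left h1 h2
    linarith
  · have key := boundRR_mul_le ht0 ht1 hL0 hL1
    rw [← le_div_iff₀ (by positivity)] at key
    refine key.trans ?_
    -- the logarithm `B` enters with a nonpositive coefficient, so its upper bound is needed
    have hmul : sin (β + δ) ^ 2 * cos δ ^ 2 * B ≤
        sin (β + δ) ^ 2 * cos δ ^ 2 * (0.61 + q / 5) :=
      mul_le_mul_of_nonneg_left hB1 (by positivity)
    have e : (1 / (r ^ 3 * sin β * sin (β + δ)) - 2 * (1 - sin β) -
        (cos δ ^ 2 * B - cos (β - δ) + sin δ)) * sin (β + δ) ^ 2 =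
        sin (β + δ) / (r ^ 3 * sin β) - sin (β + δ) ^ 2 * (2 * (1 - sin β) - cos (β - δ) + sin δ)
          - sin (β + δ) ^ 2 * cos δ ^ 2 * B := by
      have : sin β ≠ 0 := by rw [hsβ]; positivity
      field_simp
      ring
    rw [e]
    refine le_trans (le_of_eq ?_) (sub_le_sub_left hmul _)
    rw [hSw, hCs, hsβ, hsδ, hcδ, hq, hrt]
    field_simp
    ring
  · have hSdD : 0 ≤ 2 * r * (sin δ * cos δ) * sin (β + δ) := by
      rw [hsδ, hcδ]; positivity
    have e : (r * (2 * sin δ * cos δ * B - 2 * cos δ + 2 * sin (β - δ)) +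
        1 / (r * sin (β + δ))) * sin (β + δ) =
        1 / r - 2 * r * sin (β + δ) * (cos δ - sin (β - δ)) +
          2 * r * (sin δ * cos δ) * sin (β + δ) * B := by
      field_simp
      ring
    rw [e, abs_le]
    constructor
    · have hnn := nonneg_of_boundRD ht0 ht1 hL0 hL1
      have h1 : 0 ≤ 1 / r - 2 * r * sin (β + δ) * (cos δ - sin (β - δ)) +
          2 * r * (sin δ * cos δ) * sin (β + δ) * (2.609 - 5 / q) := by
        have h2 : 0 < (1 - t ^ 2) * (1 + t ^ 2) * (1 + (L * t) ^ 2) ^ 3 := by positivity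
        refine (div_nonneg hnn h2.le).trans (le_of_eq ?_)
        rw [hSw, hSs, hsδ, hcδ, hq, hrt]
        field_simp
        ring
      have h3 := mul_le_mul_of_nonneg_left hB2 hSdD
      have h4 : 0 ≤ boundRD t L := by
        unfold boundRD
        have : 0 ≤ 1 - L := by linarith
        have : 0 ≤ 1 - 3.85 * t + 4.7 * t ^ 2 := by nlinarith
        have : 0 ≤ 1 - 6.4 * t + 12.8 * t ^ 2 := by nlinarith [sq_nonneg (t - 1 / 4)]
        positivity
      linarith
    · have key := le_boundRD_mul ht0 ht1 hL0 hL1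
      rw [← div_le_iff₀ (by positivity)] at key
      refine le_trans ?_ key
      have h3 := mul_le_mul_of_nonneg_left hB1 hSdD
      refine (add_le_add_right h3 _).trans (le_of_eq ?_)
      rw [hSw, hSs, hsδ, hcδ, hq, hrt]
      field_simp
      ring
  · have key := boundDD_mul_le ht0 ht1 hL0 hL1
    rw [← le_div_iff₀ (by positivity)] at key
    refine key.trans ?_
    have hpos : 0 ≤ cos δ ^ 2 - sin δ ^ 2 := by
      have : sin δ ≤ cos δ := by
        rw [hsδ, hcδ]
        refine div_le_div_of_nonneg_right ?_ (by positivity)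
        nlinarith
      have h2 : 0 ≤ sin δ := by rw [hsδ]; positivity
      nlinarith
    have h3 := mul_le_mul_of_nonneg_left hB2 hpos
    have h4 : L * t * (1 + (L * t) ^ 2) * (1 + 2 * (L * t) ^ 2) ≤ sin δ / (2 * cos δ ^ 2) := by
      rw [hsδ, hcδ]
      have : 2 * (L * t) / (1 + (L * t) ^ 2) / (2 * ((1 - (L * t) ^ 2) / (1 + (L * t) ^ 2)) ^ 2) =
        L * t * (1 + (L * t) ^ 2) / (1 - (L * t) ^ 2) ^ 2 := by field_simp
      rw [this, le_div_iff₀ (by positivity)]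
      have h5 : (1 + 2 * (L * t) ^ 2) * (1 - (L * t) ^ 2) ^ 2 ≤ 1 := by
        have h6 : 0 ≤ (L * t) ^ 2 := by positivity
        have h7 : (L * t) ^ 2 ≤ 1 := by linarith
        generalize (L * t) ^ 2 = z at *
        nlinarith [mul_nonneg h6 h6, mul_nonneg (mul_nonneg h6 h6) (sub_nonneg.mpr h7)]
      have h8 : 0 ≤ L * t * (1 + (L * t) ^ 2) := by positivity
      have h10 := mul_le_mul_of_nonneg_left h5 h8
      rw [mul_one, ← mul_assoc] at h10
      exact h10
    have h9 : r ^ 2 * ((cos δ ^ 2 - sin δ ^ 2) * (2.609 - 5 / q)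
        - sin δ * cos δ / sin (β + δ) + 2 * sin δ - cos (β - δ)) +
        L * t * (1 + (L * t) ^ 2) * (1 + 2 * (L * t) ^ 2) ≤
        r ^ 2 * ((cos δ ^ 2 - sin δ ^ 2) * B - sin δ * cos δ / sin (β + δ) + 2 * sin δ
          - cos (β - δ)) + sin δ / (2 * cos δ ^ 2) :=
      add_le_add (mul_le_mul_of_nonneg_left (by linarith) (sq_nonneg r)) h4
    refine le_trans (le_of_eq ?_) h9
    have e1 : r ^ 2 * ((cos δ ^ 2 - sin δ ^ 2) * (2.609 - 5 / q)) =
        ((1 - (L * t) ^ 2) ^ 2 - 4 * (L * t) ^ 2) * (2.609 * (1 - t * (L * t)) * (1 + L * t)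
        - 5 * (t + L * t) * (1 - L * t)) * (1 + L) * (1 + t ^ 2) * (1 + t ^ 2) /
        ((1 - t ^ 2) ^ 2 * (1 + (L * t) ^ 2) ^ 2 * (1 - t * (L * t)) * (1 + L * t) * (1 + L)) := by
      have e0 : 5 / q = 5 * (t + L * t) * (1 - L * t) / ((1 - t * (L * t)) * (1 + L * t)) := by
        rw [hq, div_div_eq_mul_div]; congr 1 <;> ring
      rw [e0, hsδ, hcδ, hrt]
      generalize L * t = u at *
      field_simp
      ring
    have e2 : r ^ 2 * (sin δ * cos δ / sin (β + δ)) =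
        L * (1 + t ^ 2) * (1 - (L * t) ^ 2) * (1 + t ^ 2) * (1 + (L * t) ^ 2) * (1 + L * t)
          * (1 + t ^ 2) /
        ((1 - t ^ 2) ^ 2 * (1 + (L * t) ^ 2) ^ 2 * (1 - t * (L * t)) * (1 + L * t) * (1 + L)) := by
      have e0 : sin δ * cos δ / sin (β + δ) = L * (1 - (L * t) ^ 2) * (1 + t ^ 2) /
          ((1 + (L * t) ^ 2) * (1 + L) * (1 - t * (L * t))) := by
        rw [hSw, hsδ, hcδ, div_mul_div_comm, div_div_div_eq, div_eq_div_iff (by positivity)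
          (by positivity)]
        ring
      rw [e0, hrt]
      generalize L * t = u at *
      field_simp
    have e3 : r ^ 2 * (2 * sin δ - cos (β - δ)) =
        (4 * (L * t) * (1 + t ^ 2) - ((1 - t ^ 2) * (1 - (L * t) ^ 2) + 4 * t * (L * t)))
        * (1 + (L * t) ^ 2) * (1 - t * (L * t)) * (1 + L * t) * (1 + L) * (1 + t ^ 2) /
        ((1 - t ^ 2) ^ 2 * (1 + (L * t) ^ 2) ^ 2 * (1 - t * (L * t)) * (1 + L * t) * (1 + L)) := by
      rw [hCs, hsδ, hrt]
      generalize L * t = u at *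
      field_simp
      ring
    have e4 : L * t * (1 + (L * t) ^ 2) * (1 + 2 * (L * t) ^ 2) =
        L * t * (1 + (L * t) ^ 2) * (1 + 2 * (L * t) ^ 2) * (1 - t ^ 2) ^ 2
          * (1 + (L * t) ^ 2) ^ 2 * (1 - t * (L * t)) * (1 + L * t) * (1 + L) /
        ((1 - t ^ 2) ^ 2 * (1 + (L * t) ^ 2) ^ 2 * (1 - t * (L * t)) * (1 + L * t) * (1 + L)) := by
      rw [eq_div_iff (by positivity)]
      ring
    rw [add_div, ← e4, show ∀ a b c d : ℝ,
      r ^ 2 * (a - b + c - d) = r ^ 2 * a - r ^ 2 * b + r ^ 2 * (c - d) from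
      fun a b c d => by ring, e1, e2, e3, ← sub_div, ← add_div]
    congr 2
    ring

/-- The Hessian of `mainPart` is uniformly positive definite for `1 < r ≤ 85 / 77`. -/
lemma mainDeriv_posDef {r δ : ℝ} (hr : 1 < r) (hr' : r ≤ 85 / 77) (h0 : 0 < δ)
    (hδ : δ ≤ arccos (1 / r)) (h l : ℝ) :
    0.05 * (h ^ 2 + l ^ 2) ≤ h ^ 2 * mainDerivRR r δ + 2 * h * l * mainDerivRD r δ
      + l ^ 2 * mainDerivDD r δ := by
  obtain ⟨t, L, S, ht, ht', hL, hL', hS, hS', hRR, hRD, hDD⟩ :=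
    exists_mainDeriv_bounds hr hr' h0 hδ
  have hdet := bound_det_pos ht ht' hL hL'
  have hDDp := boundDD_pos ht ht' hL hL'
  set A := mainDerivRR r δ * S ^ 2 - 0.05 * S ^ 2
  set D := mainDerivDD r δ - 0.05
  set C := mainDerivRD r δ * S
  have hA : boundRR t L - 0.05 * (2 * t * (1 + L)) ^ 2 ≤ A := by
    have : S ^ 2 ≤ (2 * t * (1 + L)) ^ 2 := pow_le_pow_left₀ hS.le hS' 2
    simp only [A]; linarith
  have hA0 : 0 < boundRR t L - 0.05 * (2 * t * (1 + L)) ^ 2 := by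
    by_contra hcon
    push Not at hcon
    nlinarith [sq_nonneg (boundRD t L)]
  have hD : boundDD t L - 0.05 ≤ D := by simp only [D]; linarith
  have hC : C ^ 2 ≤ boundRD t L ^ 2 := sq_le_sq' (by linarith [(abs_le.mp hRD).1])
    (abs_le.mp hRD).2
  have hAD : C ^ 2 ≤ A * D := by
    have := mul_le_mul hA hD hDDp.le (hA0.le.trans hA)
    linarith
  have hD0 : 0 < D := hDDp.trans_le hD
  -- completing the square in the rescaled increment `h / S`
  have hq : 0 ≤ (h / S) ^ 2 * A + 2 * (h / S) * l * C + l ^ 2 * D := by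
    have h1 : 0 ≤ D * ((h / S) ^ 2 * A + 2 * (h / S) * l * C + l ^ 2 * D) := by
      nlinarith [sq_nonneg (D * l + C * (h / S)), mul_le_mul_of_nonneg_left hAD (sq_nonneg (h / S))]
    exact nonneg_of_mul_nonneg_right h1 hD0
  have e : (h / S) ^ 2 * A + 2 * (h / S) * l * C + l ^ 2 * D =
      h ^ 2 * mainDerivRR r δ + 2 * h * l * mainDerivRD r δ + l ^ 2 * mainDerivDD r δ
        - 0.05 * (h ^ 2 + l ^ 2) := by
    simp only [A, C, D]
    field_simp
    ring
  linarith

/-! ### Convexity of `turnPart` -/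

/-- Twice the integrand of `turnPart`, extended by zero to the headings that lead directly to a
shore. -/
def turnDensity (r δ θ : ℝ) : ℝ :=
  if 1 ≤ r * cos θ then 0 else (1 - r * cos θ) ^ 2 / sin (θ - δ)

/-- Integrating over the fixed interval `(0, π / 2)` makes different `(r, δ)` comparable. -/
lemma integral_turnDensity {r δ : ℝ} (hr : 1 ≤ r) (h0 : 0 ≤ δ) (hδ : δ ≤ arccos (1 / r)) :
    IntegrableOn (turnDensity r δ) (Ioo 0 (π / 2)) ∧
      ∫ θ in Ioo 0 (π / 2), turnDensity r δ θ = 2 * turnPart r δ := by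
  have hp := pi_pos
  have hβ := arccos_inv_lt hr
  have hβ0 := arccos_nonneg (1 / r)
  have hcβ := cos_arccos_inv hr
  have hF := continuousOn_turnAnti hr h0 hδ
  have hd : ∀ θ ∈ Ioo (arccos (1 / r)) (π / 2),
      HasDerivAt (turnAnti r δ) ((1 - r * cos θ) ^ 2 / sin (θ - δ)) θ := fun θ hθ =>
    hasDerivAt_turnAnti (sin_pos_of_pos_of_lt_pi (by linarith [hθ.1]) (by linarith [hθ.2]))
  have hn : ∀ θ ∈ Ioo (arccos (1 / r)) (π / 2), 0 ≤ (1 - r * cos θ) ^ 2 / sin (θ - δ) :=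
    fun θ hθ => div_nonneg (sq_nonneg _)
      (sin_pos_of_pos_of_lt_pi (by linarith [hθ.1]) (by linarith [hθ.2])).le
  have hi := intervalIntegral.integrableOn_deriv_of_nonneg hF hd hn
  have hint := intervalIntegral.integral_eq_sub_of_hasDerivAt_of_le hβ.le hF hd
    ((intervalIntegrable_iff_integrableOn_Ioc_of_le hβ.le).mpr hi)
  rw [intervalIntegral.integral_of_le hβ.le, integral_Ioc_eq_integral_Ioo] at hint
  have hi' : IntegrableOn (fun θ => (1 - r * cos θ) ^ 2 / sin (θ - δ))
      (Ioo (arccos (1 / r)) (π / 2)) := hi.mono_set Ioo_subset_Ioc_self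
  have e1 : EqOn (turnDensity r δ) ((Ioo (arccos (1 / r)) (π / 2)).indicator
      fun θ => (1 - r * cos θ) ^ 2 / sin (θ - δ)) (Ioo 0 (π / 2)) := by
    intro θ hθ
    unfold turnDensity
    rcases le_or_gt θ (arccos (1 / r)) with h | h
    · rw [if_pos (one_le_mul_cos hr hθ.1.le h),
        indicator_of_notMem fun h' : θ ∈ Ioo _ _ => h'.1.not_ge h]
    · rw [if_neg (mul_cos_lt_one hr h hθ.2.le).not_ge,
        indicator_of_mem (show θ ∈ Ioo _ _ from ⟨h, hθ.2⟩)]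
  have hsub : Ioo 0 (π / 2) ∩ Ioo (arccos (1 / r)) (π / 2) = Ioo (arccos (1 / r)) (π / 2) :=
    inter_eq_right.mpr (Ioo_subset_Ioo_left hβ0)
  constructor
  · rw [integrableOn_congr_fun e1 measurableSet_Ioo, IntegrableOn,
      integrable_indicator_iff measurableSet_Ioo, IntegrableOn,
      Measure.restrict_restrict measurableSet_Ioo, inter_comm, hsub]
    exact hi'
  · rw [setIntegral_congr_fun measurableSet_Ioo e1, setIntegral_indicator measurableSet_Ioo, hsub,
      hint]
    unfold turnAnti turnPart
    rw [sin_pi_div_two_sub, cos_pi_div_two_sub, add_comm (π / 2) δ, cos_add_pi_div_two]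
    ring

lemma sin_le_add_cos_mul {a b : ℝ} (ha : a ∈ Icc 0 π) (hb : b ∈ Icc 0 π) :
    sin b ≤ sin a + cos a * (b - a) := by
  rcases lt_trichotomy a b with h | h | h
  · obtain ⟨c, hc, hc'⟩ := exists_hasDerivAt_eq_slope sin cos h continuous_sin.continuousOn
      fun x _ => hasDerivAt_sin x
    rw [eq_div_iff (by linarith)] at hc'
    have := cos_le_cos_of_nonneg_of_le_pi ha.1 (by linarith [hc.2, hb.2]) hc.1.le
    nlinarith
  · subst h; simp
  · obtain ⟨c, hc, hc'⟩ := exists_hasDerivAt_eq_slope sin cos h continuous_sin.continuousOn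
      fun x _ => hasDerivAt_sin x
    rw [eq_div_iff (by linarith)] at hc'
    have := cos_le_cos_of_nonneg_of_le_pi (by linarith [hc.1, hb.1]) ha.2 hc.2.le
    nlinarith

/-- The function `r ↦ arccos (1 / r)` is concave, because the secant is convex. -/
lemma arccos_inv_concave {r s a b : ℝ} (hr : 1 ≤ r) (hs : 1 ≤ s) (ha : 0 ≤ a) (hb : 0 ≤ b)
    (hab : a + b = 1) :
    a * arccos (1 / r) + b * arccos (1 / s) ≤ arccos (1 / (a * r + b * s)) := by
  have hp := pi_pos
  have h1 := arccos_inv_lt hr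
  have h2 := arccos_inv_lt hs
  have h3 := arccos_nonneg (1 / r)
  have h4 := arccos_nonneg (1 / s)
  have hr0 : 0 < r := by linarith
  have hs0 : 0 < s := by linarith
  have hq : 0 < a * r + b * s := by nlinarith
  have hc := strictConcaveOn_cos_Icc.concaveOn.2 (x := arccos (1 / r)) ⟨by linarith, h1.le⟩
    (y := arccos (1 / s)) ⟨by linarith, h2.le⟩ ha hb hab
  rw [cos_arccos_inv hr, cos_arccos_inv hs] at hc
  simp only [smul_eq_mul] at hc
  have h5 : 0 ≤ a * arccos (1 / r) + b * arccos (1 / s) := by positivity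
  have h6 : a * arccos (1 / r) + b * arccos (1 / s) ≤ π := by nlinarith
  rw [← arccos_cos h5 h6]
  apply arccos_le_arccos
  refine le_trans ?_ hc
  rw [div_le_iff₀ hq]
  have e : (a * (1 / r) + b * (1 / s)) * (a * r + b * s) = (a + b) ^ 2 +
      a * b * ((r - s) ^ 2 / (r * s)) := by field_simp; ring
  rw [e, hab]
  have : 0 ≤ a * b * ((r - s) ^ 2 / (r * s)) := by positivity
  linarith

/-- Tangent inequality for the convex function `x ^ 2 / y` with `x = 1 - r * cos θ` and the concave
function `y = sin (θ - δ)`. -/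
lemma tangent_le_turnDensity {r δ s ε θ : ℝ} (hr : 1 ≤ r) (h0 : 0 ≤ δ) (hδ : δ ≤ arccos (1 / r))
    (hs : 1 ≤ s) (h0' : 0 ≤ ε) (hε : ε ≤ arccos (1 / s)) (hθ : θ ∈ Ioo 0 (π / 2))
    (hx : r * cos θ < 1) :
    2 * ((1 - r * cos θ) / sin (θ - δ)) * (1 - s * cos θ) -
      ((1 - r * cos θ) / sin (θ - δ)) ^ 2 * (sin (θ - δ) + cos (θ - δ) * (δ - ε))
      ≤ turnDensity s ε θ := by
  have hp := pi_pos
  have hδθ : arccos (1 / r) < θ := by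
    by_contra hcon
    exact hx.not_ge (one_le_mul_cos hr hθ.1.le (not_lt.mp hcon))
  have hy : 0 < sin (θ - δ) := sin_pos_of_pos_of_lt_pi (by linarith) (by linarith [hθ.2])
  have hm : 0 < (1 - r * cos θ) / sin (θ - δ) := div_pos (by linarith) hy
  have hxy : (1 - r * cos θ) / sin (θ - δ) * sin (θ - δ) = 1 - r * cos θ := div_mul_cancel₀ _ hy.ne'
  set m := (1 - r * cos θ) / sin (θ - δ)
  unfold turnDensity
  split_ifs with hc
  · -- the tangent plane is positive at `(r, δ)` and nonpositive at the point of the segment to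
    -- `(s, ε)` with first coordinate `1 / cos θ`
    have hcθ : 0 < cos θ := cos_pos_of_mem_Ioo ⟨by linarith [hθ.1], hθ.2⟩
    have hrs : 0 < (s - r) * cos θ := by linarith
    obtain ⟨b, hb⟩ : ∃ b, b = (1 - r * cos θ) / ((s - r) * cos θ) := ⟨_, rfl⟩
    have hb0 : 0 < b := by rw [hb]; exact div_pos (by linarith) hrs
    have hb1 : b ≤ 1 := by rw [hb, div_le_one hrs]; linarith
    have hb' : b * ((s - r) * cos θ) = 1 - r * cos θ := by rw [hb]; exact div_mul_cancel₀ _ hrs.ne'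
    have hconc := arccos_inv_concave hr hs (sub_nonneg.mpr hb1) hb0.le (sub_add_cancel 1 b)
    have e : 1 / ((1 - b) * r + b * s) = cos θ := by
      rw [div_eq_iff (by nlinarith)]; linarith
    rw [e, arccos_cos hθ.1.le (by linarith [hθ.2])] at hconc
    have h1 : (1 - b) * δ + b * ε ≤ θ :=
      (add_le_add (mul_le_mul_of_nonneg_left hδ (sub_nonneg.mpr hb1))
        (mul_le_mul_of_nonneg_left hε hb0.le)).trans hconc
    have h2 : 0 ≤ (1 - b) * δ + b * ε :=
      add_nonneg (mul_nonneg (sub_nonneg.mpr hb1) h0) (mul_nonneg hb0.le h0')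
    have h3 := sin_le_add_cos_mul (a := θ - δ) ⟨by linarith, by linarith [hθ.2]⟩
      (b := θ - ((1 - b) * δ + b * ε)) ⟨by linarith, by linarith [hθ.2]⟩
    have h4 := sin_nonneg_of_nonneg_of_le_pi (x := θ - ((1 - b) * δ + b * ε)) (by linarith)
      (by linarith [hθ.2])
    have h5 : 0 ≤ m ^ 2 * (sin (θ - δ) + cos (θ - δ) * (b * (δ - ε))) := by
      apply mul_nonneg (sq_nonneg m)
      refine (h4.trans h3).trans (le_of_eq ?_)
      ring
    have h6 : b * (2 * m * (1 - s * cos θ) - m ^ 2 * (sin (θ - δ) + cos (θ - δ) * (δ - ε))) =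
        -(1 - b) * m * (m * sin (θ - δ)) + (2 * m * ((1 - r * cos θ)- b * ((s - r) * cos θ)))
        - 2 * m * (1 - b) * (1 - r * cos θ - m * sin (θ - δ))
        - m ^ 2 * (sin (θ - δ) + cos (θ - δ) * (b * (δ - ε))) := by ring
    rw [hb', hxy] at h6
    have h7 : 0 ≤ (1 - b) * m * (1 - r * cos θ) :=
      mul_nonneg (mul_nonneg (sub_nonneg.mpr hb1) hm.le) (by linarith)
    by_contra hcon
    push Not at hcon
    have := mul_pos hb0 hcon
    linarith
  · push Not at hc
    have hεθ : arccos (1 / s) < θ := by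
      by_contra hcon
      exact hc.not_ge (one_le_mul_cos hs hθ.1.le (not_lt.mp hcon))
    have hy' : 0 < sin (θ - ε) := sin_pos_of_pos_of_lt_pi (by linarith) (by linarith [hθ.2])
    have h3 := sin_le_add_cos_mul (a := θ - δ) ⟨by linarith, by linarith [hθ.2]⟩
      (b := θ - ε) ⟨by linarith, by linarith [hθ.2]⟩
    rw [le_div_iff₀ hy']
    have h4 : m ^ 2 * sin (θ - ε) ≤ m ^ 2 * (sin (θ - δ) + cos (θ - δ) * (δ - ε)) := by
      apply mul_le_mul_of_nonneg_left _ (sq_nonneg m)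
      refine h3.trans (le_of_eq ?_)
      ring
    nlinarith [mul_le_mul_of_nonneg_right h4 hy'.le, sq_nonneg (1 - s * cos θ - m * sin (θ - ε))]

/-- Convexity of `turnPart`. -/
lemma turnPart_convex {r δ s ε a b : ℝ} (hr : 1 ≤ r) (h0 : 0 ≤ δ) (hδ : δ ≤ arccos (1 / r))
    (hs : 1 ≤ s) (h0' : 0 ≤ ε) (hε : ε ≤ arccos (1 / s)) (ha : 0 ≤ a) (hb : 0 ≤ b)
    (hab : a + b = 1) :
    turnPart (a * r + b * s) (a * δ + b * ε) ≤ a * turnPart r δ + b * turnPart s ε := by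
  have h1 : 1 ≤ a * r + b * s := by nlinarith
  have h2 : 0 ≤ a * δ + b * ε := by positivity
  have h3 : a * δ + b * ε ≤ arccos (1 / (a * r + b * s)) :=
    (add_le_add (mul_le_mul_of_nonneg_left hδ ha) (mul_le_mul_of_nonneg_left hε hb)).trans
      (arccos_inv_concave hr hs ha hb hab)
  obtain ⟨i1, e1⟩ := integral_turnDensity hr h0 hδ
  obtain ⟨i2, e2⟩ := integral_turnDensity hs h0' hε
  obtain ⟨i3, e3⟩ := integral_turnDensity h1 h2 h3
  have key : ∫ θ in Ioo 0 (π / 2), turnDensity (a * r + b * s) (a * δ + b * ε) θ ≤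
      ∫ θ in Ioo 0 (π / 2), (a * turnDensity r δ θ + b * turnDensity s ε θ) := by
    refine setIntegral_mono_on i3 ((i1.const_mul a).add (i2.const_mul b)) measurableSet_Ioo
      fun θ hθ => ?_
    rcases le_or_gt 1 ((a * r + b * s) * cos θ) with hc | hc
    · have hn : ∀ {r δ : ℝ}, 1 ≤ r → 0 ≤ δ → δ ≤ arccos (1 / r) → 0 ≤ turnDensity r δ θ := by
        intro r δ hr h0 hδ
        unfold turnDensity
        split_ifs with h
        · rfl
        · have : arccos (1 / r) < θ := by
            by_contra hcon
            exact h (one_le_mul_cos hr hθ.1.le (not_lt.mp hcon))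
          exact div_nonneg (sq_nonneg _)
            (sin_nonneg_of_nonneg_of_le_pi (by linarith) (by linarith [hθ.2, pi_pos]))
      have h4 := mul_nonneg ha (hn hr h0 hδ)
      have h5 := mul_nonneg hb (hn hs h0' hε)
      unfold turnDensity at h4 h5 ⊢
      rw [if_pos hc]
      exact add_nonneg h4 h5
    · have t1 := mul_le_mul_of_nonneg_left
        (tangent_le_turnDensity h1 h2 h3 hr h0 hδ hθ hc) ha
      have t2 := mul_le_mul_of_nonneg_left
        (tangent_le_turnDensity h1 h2 h3 hs h0' hε hθ hc) hb
      refine le_trans (le_of_eq ?_) (add_le_add t1 t2)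
      have hδθ : arccos (1 / (a * r + b * s)) < θ := by
        by_contra hcon
        exact hc.not_ge (one_le_mul_cos h1 hθ.1.le (not_lt.mp hcon))
      have hy : 0 < sin (θ - (a * δ + b * ε)) :=
        sin_pos_of_pos_of_lt_pi (by linarith) (by linarith [hθ.2, pi_pos])
      unfold turnDensity
      rw [if_neg hc.not_ge]
      obtain rfl : b = 1 - a := by linarith
      field_simp
      ring
  rw [e3, integral_add (i1.const_mul a) (i2.const_mul b), integral_const_mul, integral_const_mul,
    e1, e2] at key
  linarith

/-- The graph of `turnPart` lies above its tangent planes. -/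
lemma tangent_le_turnPart {r δ s ε : ℝ} (hr : 1 < r) (h0 : 0 ≤ δ) (hδ : δ < arccos (1 / r))
    (hs : 1 ≤ s) (h0' : 0 ≤ ε) (hε : ε ≤ arccos (1 / s)) :
    turnPart r δ + ((s - r) * turnDerivR r δ + (ε - δ) * turnDerivD r δ) ≤ turnPart s ε := by
  have hp := pi_pos
  have hβ := arccos_inv_lt hr.le
  have hd := hasDerivAt_turnPart (R := fun t => r + t * (s - r)) (Δ := fun t => δ + t * (ε - δ))
    (h := s - r) (l := ε - δ) (t := 0)
    (by simpa using ((hasDerivAt_id (0 : ℝ)).mul_const (s - r)).const_add r)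
    (by simpa using ((hasDerivAt_id (0 : ℝ)).mul_const (ε - δ)).const_add δ)
    (by simpa using hr) (by simpa using cos_pos_of_mem_Ioo ⟨by linarith, by linarith⟩)
    (by
      simp only [zero_mul, add_zero]
      exact sin_pos_of_pos_of_lt_pi (by linarith) (by linarith))
  simp only [zero_mul, add_zero] at hd
  -- the difference quotients at `(r, δ)` are at most the slope of the chord
  have hlim := hd.tendsto_slope_zero_right
  have hle : ∀ᶠ t in nhdsWithin (0 : ℝ) (Ioi 0), t⁻¹ • (turnPart (r + (0 + t) * (s - r))
      (δ + (0 + t) * (ε - δ)) - turnPart (r + 0 * (s - r)) (δ + 0 * (ε - δ))) ≤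
      turnPart s ε - turnPart r δ := by
    filter_upwards [Ioo_mem_nhdsGT (show (0 : ℝ) < 1 by norm_num)] with t ht
    have := turnPart_convex hr.le h0 hδ.le hs h0' hε (a := 1 - t) (b := t) (by linarith [ht.2])
      ht.1.le (by ring)
    rw [show (1 - t) * r + t * s = r + (0 + t) * (s - r) by ring,
      show (1 - t) * δ + t * ε = δ + (0 + t) * (ε - δ) by ring] at this
    rw [smul_eq_mul, inv_mul_le_iff₀ ht.1]
    simp only [zero_mul, add_zero]
    linarith
  have := le_of_tendsto hlim hle
  linarith

/-! ### Strong convexity of `total` -/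

/-- Taylor's inequality for a function with second derivative at least `m`. -/
lemma add_add_le_of_le_deriv2 {f f' f'' : ℝ → ℝ} {m : ℝ}
    (hf : ∀ t ∈ Icc (0 : ℝ) 1, HasDerivAt f (f' t) t)
    (hf' : ∀ t ∈ Icc (0 : ℝ) 1, HasDerivAt f' (f'' t) t)
    (hm : ∀ t ∈ Ioo (0 : ℝ) 1, m ≤ f'' t) : f 0 + f' 0 + m / 2 ≤ f 1 := by
  have h1 : MonotoneOn (fun t => f' t - m * t) (Icc 0 1) := by
    have hd : ∀ t ∈ Icc (0 : ℝ) 1, HasDerivAt (fun t => f' t - m * t) (f'' t - m) t := fun t ht =>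
      ((hf' t ht).sub ((hasDerivAt_id t).const_mul m)).congr_deriv (by simp)
    refine monotoneOn_of_deriv_nonneg (convex_Icc 0 1)
      (fun t ht => (hd t ht).continuousAt.continuousWithinAt)
      (fun t ht => (hd t (interior_subset ht)).differentiableAt.differentiableWithinAt) ?_
    intro t ht
    rw [(hd t (interior_subset ht)).deriv, sub_nonneg]
    rw [interior_Icc] at ht
    exact hm t ht
  have h2 : MonotoneOn (fun t => f t - f' 0 * t - m / 2 * t ^ 2) (Icc 0 1) := by
    have hd : ∀ t ∈ Icc (0 : ℝ) 1, HasDerivAt (fun t => f t - f' 0 * t - m / 2 * t ^ 2)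
        (f' t - f' 0 - m * t) t := fun t ht =>
      (((hf t ht).sub ((hasDerivAt_id t).const_mul (f' 0))).sub
        (((hasDerivAt_id t).pow 2).const_mul (m / 2))).congr_deriv (by simp; ring)
    refine monotoneOn_of_deriv_nonneg (convex_Icc 0 1)
      (fun t ht => (hd t ht).continuousAt.continuousWithinAt)
      (fun t ht => (hd t (interior_subset ht)).differentiableAt.differentiableWithinAt) ?_
    intro t ht
    rw [(hd t (interior_subset ht)).deriv]
    have ht' := interior_subset ht
    have := h1 (left_mem_Icc.mpr zero_le_one) ht' ht'.1
    simp only [mul_zero, sub_zero] at this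
    linarith
  have := h2 (left_mem_Icc.mpr zero_le_one) (right_mem_Icc.mpr zero_le_one) zero_le_one
  simp only [mul_zero, sub_zero, one_pow, mul_one] at this
  linarith

/-- Strong convexity of `mainPart`. -/
lemma tangent_add_sq_le_mainPart {r δ s ε : ℝ} (hr : 1 < r) (hr' : r ≤ 85 / 77) (h0 : 0 < δ)
    (hδ : δ ≤ arccos (1 / r)) (hs : 1 < s) (hs' : s ≤ 85 / 77) (h0' : 0 ≤ ε)
    (hε : ε ≤ arccos (1 / s)) :
    mainPart r δ + ((s - r) * mainDerivR r δ + (ε - δ) * mainDerivD r δ) +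
      0.025 * ((s - r) ^ 2 + (ε - δ) ^ 2) ≤ mainPart s ε := by
  have hp := pi_pos
  have hR : ∀ t : ℝ, HasDerivAt (fun t => r + t * (s - r)) (s - r) t := fun t => by
    simpa using ((hasDerivAt_id t).mul_const (s - r)).const_add r
  have hΔ : ∀ t : ℝ, HasDerivAt (fun t => δ + t * (ε - δ)) (ε - δ) t := fun t => by
    simpa using ((hasDerivAt_id t).mul_const (ε - δ)).const_add δ
  have hR1 : ∀ t ∈ Icc (0 : ℝ) 1, 1 < r + t * (s - r) ∧ r + t * (s - r) ≤ 85 / 77 := fun t ht => by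
    constructor <;> nlinarith [ht.1, ht.2, mul_nonneg ht.1 (sub_nonneg.mpr hs.le),
      mul_nonneg (sub_nonneg.mpr ht.2) (sub_nonneg.mpr hr.le),
      mul_nonneg ht.1 (sub_nonneg.mpr hs'), mul_nonneg (sub_nonneg.mpr ht.2) (sub_nonneg.mpr hr')]
  have hD0 : ∀ t ∈ Icc (0 : ℝ) 1, 0 ≤ δ + t * (ε - δ) := fun t ht => by
    nlinarith [mul_nonneg ht.1 h0', mul_nonneg (sub_nonneg.mpr ht.2) h0.le]
  have hD1 : ∀ t ∈ Icc (0 : ℝ) 1, δ + t * (ε - δ) ≤ arccos (1 / (r + t * (s - r))) := by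
    intro t ht
    have := arccos_inv_concave hr.le hs.le (sub_nonneg.mpr ht.2) ht.1 (sub_add_cancel 1 t)
    rw [show (1 - t) * r + t * s = r + t * (s - r) by ring] at this
    nlinarith [mul_le_mul_of_nonneg_left hδ (sub_nonneg.mpr ht.2),
      mul_le_mul_of_nonneg_left hε ht.1]
  have hβ : ∀ t ∈ Icc (0 : ℝ) 1, arccos (1 / (r + t * (s - r))) < π / 2 := fun t ht =>
    arccos_inv_lt (hR1 t ht).1.le
  have hβ0 : ∀ t ∈ Icc (0 : ℝ) 1, 0 < arccos (1 / (r + t * (s - r))) := fun t ht => by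
    have := hR1 t ht
    rw [arccos_pos, div_lt_one (by linarith)]
    exact this.1
  have hc : ∀ t ∈ Icc (0 : ℝ) 1, 0 < cos (δ + t * (ε - δ)) := fun t ht =>
    cos_pos_of_mem_Ioo ⟨by linarith [hD0 t ht], by linarith [hD1 t ht, hβ t ht]⟩
  have hw : ∀ t ∈ Icc (0 : ℝ) 1, 0 < sin (arccos (1 / (r + t * (s - r))) + (δ + t * (ε - δ))) :=
    fun t ht => sin_pos_of_pos_of_lt_pi (by linarith [hD0 t ht, hβ0 t ht])
      (by linarith [hD1 t ht, hβ t ht])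
  have key := add_add_le_of_le_deriv2 (m := 0.05 * ((s - r) ^ 2 + (ε - δ) ^ 2))
    (f := fun t => mainPart (r + t * (s - r)) (δ + t * (ε - δ)))
    (fun t ht => hasDerivAt_mainPart (hR t) (hΔ t) (hR1 t ht).1 (hc t ht) (hw t ht))
    (fun t ht => ((hasDerivAt_mainDerivR (hR t) (hΔ t) (hR1 t ht).1 (hc t ht) (hw t ht)).const_mul
      (s - r)).add ((hasDerivAt_mainDerivD (hR t) (hΔ t) (hR1 t ht).1 (hc t ht) (hw t ht)).const_mul
      (ε - δ)))
    -- `δ + t * (ε - δ)` is positive for `t < 1`, even if `ε = 0`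
    (fun t ht => by
      have ht' := Ioo_subset_Icc_self ht
      have hpos : 0 < δ + t * (ε - δ) := by
        nlinarith [mul_nonneg ht.1.le h0', mul_pos (sub_pos.mpr ht.2) h0]
      have := mainDeriv_posDef (hR1 t ht').1 (hR1 t ht').2 hpos (hD1 t ht') (s - r) (ε - δ)
      linarith)
  simp only [zero_mul, add_zero, one_mul, add_sub_cancel] at key
  linarith

/-- Strong convexity of `total`. -/
lemma tangent_add_sq_le_total {r δ s ε : ℝ} (hr : 1 < r) (hr' : r ≤ 85 / 77) (h0 : 0 < δ)
    (hδ : δ < arccos (1 / r)) (hs : 1 < s) (hs' : s ≤ 85 / 77) (h0' : 0 ≤ ε)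
    (hε : ε ≤ arccos (1 / s)) :
    total r δ + ((s - r) * (mainDerivR r δ + turnDerivR r δ) +
      (ε - δ) * (mainDerivD r δ + turnDerivD r δ)) +
      0.025 * ((s - r) ^ 2 + (ε - δ) ^ 2) ≤ total s ε := by
  have h1 := tangent_add_sq_le_mainPart hr hr' h0 hδ.le hs hs' h0' hε
  have h2 := tangent_le_turnPart hr h0.le hδ hs.le h0' hε
  unfold total
  linarith

/-! ### Long first segments -/

/-- The `n`-th partial sum of the power series of `arctan`. -/
def arctanSum (n : ℕ) (x : ℝ) : ℝ :=
  ∑ k ∈ Finset.range n, (-1) ^ k * (x ^ (2 * k + 1) / (2 * k + 1))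

/-- The derivative is a geometric sum, which is compared with `1 / (1 + x ^ 2)` below. -/
lemma hasDerivAt_arctanSum (n : ℕ) (x : ℝ) :
    HasDerivAt (arctanSum n) ((1 - (-x ^ 2) ^ n) / (1 + x ^ 2)) x := by
  have h : ∀ k ∈ Finset.range n,
      HasDerivAt (fun x : ℝ => (-1) ^ k * (x ^ (2 * k + 1) / (2 * k + 1))) ((-x ^ 2) ^ k) x := by
    intro k _
    have := (((hasDerivAt_id x).pow (2 * k + 1)).div_const (2 * (k : ℝ) + 1)).const_mul ((-1) ^ k)
    refine this.congr_deriv ?_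
    have : (2 * (k : ℝ) + 1) ≠ 0 := by positivity
    rw [neg_pow (x ^ 2) k, ← pow_mul]
    simp
    field_simp
  have h2 := HasDerivAt.fun_sum h
  refine h2.congr_deriv ?_
  have h3 := mul_neg_geom_sum (-x ^ 2) n
  rw [eq_div_iff (by positivity), ← h3]
  ring

lemma arctanSum_le_arctan {n : ℕ} (hn : Even n) {x : ℝ} (hx : 0 ≤ x) :
    arctanSum n x ≤ arctan x := by
  have hd : ∀ y : ℝ, HasDerivAt (fun y => arctan y - arctanSum n y)
      ((-y ^ 2) ^ n / (1 + y ^ 2)) y := fun y =>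
    ((hasDerivAt_arctan y).sub (hasDerivAt_arctanSum n y)).congr_deriv (by ring)
  have hm : Monotone fun y => arctan y - arctanSum n y :=
    monotone_of_deriv_nonneg (fun y => (hd y).differentiableAt) fun y => by
      rw [(hd y).deriv]
      exact div_nonneg (hn.pow_nonneg _) (by positivity)
  have := hm hx
  simp [arctanSum] at this
  simpa [arctanSum] using this

lemma arctan_le_arctanSum {n : ℕ} (hn : Odd n) {x : ℝ} (hx : 0 ≤ x) :
    arctan x ≤ arctanSum n x := by
  have hd : ∀ y : ℝ, HasDerivAt (fun y => arctanSum n y - arctan y)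
      (-((-y ^ 2) ^ n) / (1 + y ^ 2)) y := fun y =>
    ((hasDerivAt_arctanSum n y).sub (hasDerivAt_arctan y)).congr_deriv (by ring)
  have hm : Monotone fun y => arctanSum n y - arctan y :=
    monotone_of_deriv_nonneg (fun y => (hd y).differentiableAt) fun y => by
      rw [(hd y).deriv]
      refine div_nonneg (neg_nonneg.mpr (hn.pow_nonpos ?_)) (by positivity)
      nlinarith [sq_nonneg y]
  have := hm hx
  simp [arctanSum] at this
  simpa [arctanSum] using this

lemma two_mul_sub_le_inv {a m : ℝ} (ha : 0 < a) : 2 * m - m ^ 2 * a ≤ 1 / a := by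
  rw [le_div_iff₀ ha]
  nlinarith [sq_nonneg (m * a - 1)]

/-- A lower bound for the expected escape length, from the inequality `1 / a ≥ 2 * m - m ^ 2 * a`
with `m = 1.075`. The choice of `m` is close to optimal for `r` slightly larger than `85 / 77`. -/
lemma le_expectedEscapeLength {μ : Measure (ℝ × ℝ)} (hμ : IsStartLaw μ) {r δ : ℝ}
    (hr : 1 ≤ r) (h0 : 0 ≤ δ) (hδ : δ ≤ arccos (1 / r)) :
    ENNReal.ofReal (1 / π * (log (1 + sin (arccos (1 / r))) - log (cos (arccos (1 / r)))
      + (2 * r + 2 * 1.075) * (π / 2 - arccos (1 / r))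
      - (r ^ 2 + 2 * 1.075 * r) * (1 - sin (arccos (1 / r)))
      - 1.075 ^ 2 * (cos δ / (2 * r) + sin δ * (r / 2 * (π / 2 - arccos (1 / r))
        - sin (arccos (1 / r)) / 2
        - r ^ 2 * (2 / 3 - sin (arccos (1 / r)) + sin (arccos (1 / r)) ^ 3 / 3)))))
      ≤ expectedEscapeLength μ r (π / 2 - δ) := by
  have hp := pi_pos
  have hβ := arccos_inv_lt hr
  have hβ0 := arccos_nonneg (1 / r)
  have hr0 : 0 < r := by linarith
  have habs : |δ| ≤ arccos (1 / r) := by rwa [abs_of_nonneg h0]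
  have hcβ := cos_arccos_inv hr
  rw [expectedEscapeLength_eq_lintegral_headingMean hμ (by linarith), lintegral_headings hr habs,
    lintegral_sec hβ0 hβ]
  obtain ⟨m, hm⟩ : ∃ m : ℝ, m = 1.075 := ⟨_, rfl⟩
  set F : ℝ → ℝ := fun θ => 2 * r * θ - r ^ 2 * sin θ + 2 * m * (θ - r * sin θ)
    - m ^ 2 * (cos δ * (-cos θ + r * cos θ ^ 2 / 2)
      + sin δ * (r * (θ + sin θ * cos θ) / 2 - r ^ 2 * (sin θ - sin θ ^ 3 / 3))) with hF
  set g : ℝ → ℝ := fun θ => 2 * r - r ^ 2 * cos θ + (1 - r * cos θ) *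
    (2 * m - m ^ 2 * (sin θ * cos δ + r * cos θ * (cos θ * sin δ))) with hg
  have hFd : ∀ θ : ℝ, HasDerivAt F (g θ) θ := by
    intro θ
    have hs := hasDerivAt_sin θ
    have hc := hasDerivAt_cos θ
    have hi := hasDerivAt_id θ
    have := (((hi.const_mul (2 * r)).sub (hs.const_mul (r ^ 2))).add
      ((hi.sub (hs.const_mul r)).const_mul (2 * m))).sub
      ((((hc.neg.add (((hc.pow 2).const_mul r).div_const 2)).const_mul (cos δ)).add
        (((((hi.add (hs.mul hc)).const_mul r).div_const 2).sub
          ((hs.sub ((hs.pow 3).div_const 3)).const_mul (r ^ 2))).const_mul (sin δ))).const_mul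
        (m ^ 2))
    refine this.congr_deriv ?_
    simp only [hg]
    have := sin_sq θ
    norm_num
    linear_combination (-(m ^ 2 * sin δ * (r ^ 2 * cos θ)) + m ^ 2 * sin δ * r / 2) * this
  have hbd : ∀ θ ∈ Ioo (arccos (1 / r)) (π / 2), 0 ≤ g θ ∧ g θ ≤ pairMean r δ θ := by
    intro θ hθ
    have hc : 0 < cos θ := cos_pos_of_mem_Ioo ⟨by linarith [hθ.1], hθ.2⟩
    have hrc := mul_cos_lt_one hr hθ.1 hθ.2.le
    have hrc0 : 0 < r * cos θ := by positivity
    have h1 : 0 < sin (θ - δ) := sin_pos_of_pos_of_lt_pi (by linarith [hθ.1]) (by linarith [hθ.2])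
    have h2 : 0 < sin (θ + δ) := sin_pos_of_pos_of_lt_pi (by linarith [hθ.1]) (by linarith [hθ.2])
    constructor
    · have h3 : 0 ≤ 2 * r - r ^ 2 * cos θ := by nlinarith
      have h4 : sin θ * cos δ + r * cos θ * (cos θ * sin δ) ≤ 1 := by
        have h5 : 0 ≤ sin δ := sin_nonneg_of_nonneg_of_le_pi h0 (by linarith)
        have h6 : r * cos θ * (cos θ * sin δ) ≤ 1 * (cos θ * sin δ) :=
          mul_le_mul_of_nonneg_right hrc.le (by positivity)
        have h7 := sin_le_one (θ + δ)
        rw [sin_add] at h7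
        linarith
      have h5 : 0 ≤ 2 * m - m ^ 2 * (sin θ * cos δ + r * cos θ * (cos θ * sin δ)) := by
        have := mul_le_mul_of_nonneg_left h4 (sq_nonneg m)
        have h6 : m ^ 2 ≤ 2 * m := by rw [hm]; norm_num
        linarith
      exact add_nonneg h3 (mul_nonneg (by linarith) h5)
    · have e1 := mul_le_mul_of_nonneg_left (two_mul_sub_le_inv (m := m) h1)
        (show 0 ≤ (1 - r * cos θ) ^ 2 / 2 by positivity)
      have e2 := mul_le_mul_of_nonneg_left (two_mul_sub_le_inv (m := m) h2)
        (show 0 ≤ (1 - (r * cos θ) ^ 2) / 2 by nlinarith)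
      have e3 : pairMean r δ θ = 2 * r - r ^ 2 * cos θ +
          (1 - r * cos θ) ^ 2 / 2 * (1 / sin (θ - δ)) +
          (1 - (r * cos θ) ^ 2) / 2 * (1 / sin (θ + δ)) := by
        unfold pairMean; field_simp
      rw [e3]
      refine le_trans (le_of_eq ?_) (add_le_add (add_le_add le_rfl e1) e2)
      simp only [hg]
      rw [sin_add, sin_sub]
      ring
  have hlog : 0 ≤ log (1 + sin (arccos (1 / r))) - log (cos (arccos (1 / r))) := by
    have hs : 0 ≤ sin (arccos (1 / r)) := sin_nonneg_of_nonneg_of_le_pi hβ0 (by linarith)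
    have h1 : 0 ≤ log (1 + sin (arccos (1 / r))) := log_nonneg (by linarith)
    have h2 : log (cos (arccos (1 / r))) ≤ 0 :=
      log_nonpos (by rw [hcβ]; positivity) (cos_le_one _)
    linarith
  have hint := lintegral_Ioo_ofReal_of_hasDerivAt hβ.le
    (fun θ _ => (hFd θ).continuousAt.continuousWithinAt) (fun θ _ => hFd θ)
    (fun θ hθ => (hbd θ hθ).1)
  have hmono : ∫⁻ θ in Ioo (arccos (1 / r)) (π / 2), ENNReal.ofReal (g θ) ≤
      ∫⁻ θ in Ioo (arccos (1 / r)) (π / 2), ENNReal.ofReal (pairMean r δ θ) :=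
    setLIntegral_mono' measurableSet_Ioo fun θ hθ => ENNReal.ofReal_le_ofReal (hbd θ hθ).2
  rw [hint] at hmono
  refine le_trans (le_trans (le_of_eq ?_)
    (mul_le_mul_right (ENNReal.ofReal_add_le (p :=
      log (1 + sin (arccos (1 / r))) - log (cos (arccos (1 / r))))) (ENNReal.ofReal (1 / π))))
    (mul_le_mul_right (add_le_add le_rfl hmono) _)
  rw [← ENNReal.ofReal_mul (by positivity)]
  congr 2
  simp only [hF, sin_pi_div_two, cos_pi_div_two, hcβ, ← hm]
  field_simp
  ring

/-- The bound of `le_expectedEscapeLength` in terms of `u = tan (π / 4 - arccos (1 / r) / 2)`. It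
decreases in `u`, so the end point `u = 7 / 11`, that is `r = 85 / 77`, is the critical one. The
number `0.0086` bounds the part that involves `sin δ`. -/
lemma lt_of_le_seven_div_eleven {u : ℝ} (h0 : 0 < u) (hu : u ≤ 7 / 11) :
    2.787 < -log u + 2 * arctan u * (1 + u ^ 2) / u - (1 + u ^ 2) / 2
      + 2 * 1.075 * (2 * arctan u - u) - 1.075 ^ 2 * (u / (1 + u ^ 2) + 0.0086) := by
  set f : ℝ → ℝ := fun u => -log u + 2 * arctan u * (1 + u ^ 2) / u - (1 + u ^ 2) / 2
      + 2 * 1.075 * (2 * arctan u - u) - 1.075 ^ 2 * (u / (1 + u ^ 2) + 0.0086) with hf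
  have hd : ∀ v ∈ Icc u (7 / 11), HasDerivAt f ((1 - v ^ 2) * (1 / v - 2 * arctan v / v ^ 2 +
      (2 * 1.075 * (1 / (1 + v ^ 2)) - 1.075 ^ 2 * (1 / (1 + v ^ 2)) ^ 2))) v := by
    intro v hv
    have hv0 : 0 < v := h0.trans_le hv.1
    have hA := hasDerivAt_arctan v
    have hq := ((hasDerivAt_id v).pow 2).const_add 1
    have := ((((hasDerivAt_log hv0.ne').neg.add (((hA.const_mul 2).mul hq).div (hasDerivAt_id v)
      hv0.ne')).sub (hq.div_const 2)).add
      (((hA.const_mul 2).sub (hasDerivAt_id v)).const_mul (2 * 1.075))).sub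
      ((((hasDerivAt_id v).div hq (by simp; positivity)).add_const 0.0086).const_mul (1.075 ^ 2))
    refine this.congr_deriv ?_
    simp
    field_simp
    ring
  have hanti : AntitoneOn f (Icc u (7 / 11)) := by
    refine antitoneOn_of_deriv_nonpos (convex_Icc _ _)
      (fun v hv => (hd v hv).continuousAt.continuousWithinAt)
      (fun v hv => (hd v (interior_subset hv)).differentiableAt.differentiableWithinAt) ?_
    intro v hv
    have hv' := interior_subset hv
    have hv0 : 0 < v := h0.trans_le hv'.1
    rw [(hd v hv').deriv]
    refine mul_nonpos_of_nonneg_of_nonpos (by nlinarith [hv'.2]) ?_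
    -- the last bracket in the derivative is at most `1`, and `2 * arctan v ≥ v + v ^ 2`
    have h1 := arctanSum_le_arctan (n := 2) (by norm_num) hv0.le
    norm_num [arctanSum, Finset.sum_range_succ] at h1
    have h2 : 2 * 1.075 * (1 / (1 + v ^ 2)) - 1.075 ^ 2 * (1 / (1 + v ^ 2)) ^ 2 ≤ 1 := by
      nlinarith [sq_nonneg (1.075 * (1 / (1 + v ^ 2)) - 1)]
    have h3 : 1 / v + 1 ≤ 2 * arctan v / v ^ 2 := by
      rw [le_div_iff₀ (by positivity)]
      have : (1 / v + 1) * v ^ 2 = v + v ^ 2 := by field_simp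
      rw [this]
      have h5 : 0 ≤ v * (1 - v - 2 / 3 * v ^ 2) := mul_nonneg hv0.le (by nlinarith [hv'.2])
      nlinarith
    linarith
  have h1 := hanti (left_mem_Icc.mpr hu) (right_mem_Icc.mpr hu) hu
  refine lt_of_lt_of_le ?_ h1
  simp only [hf]
  have h2 := arctanSum_le_arctan (n := 16) (x := 7 / 11) (by decide) (by norm_num)
  have h3 := sum_range_le_log_div (x := 2 / 9) (by norm_num) (by norm_num) 4
  rw [show ((1 : ℝ) + 2 / 9) / (1 - 2 / 9) = (7 / 11)⁻¹ by norm_num, log_inv] at h3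
  norm_num [arctanSum, Finset.sum_range_succ] at h2 h3 ⊢
  linarith

/-- The expected escape length is not minimal if the first segment is long: the constant `2.787`
exceeds `total` near its minimizer. -/
lemma lt_expectedEscapeLength_of_large {μ : Measure (ℝ × ℝ)} (hμ : IsStartLaw μ) {r δ : ℝ}
    (hr : 85 / 77 ≤ r) (h0 : 0 ≤ δ) (hδ : δ ≤ arccos (1 / r)) :
    ENNReal.ofReal (2.787 / π) < expectedEscapeLength μ r (π / 2 - δ) := by
  have hp := pi_pos
  have hr1 : 1 ≤ r := by linarith
  refine lt_of_lt_of_le ?_ (le_expectedEscapeLength hμ hr1 h0 hδ)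
  have hβ := arccos_inv_lt hr1
  have hβ0 := arccos_nonneg (1 / r)
  have hcβ := cos_arccos_inv hr1
  have hr0 : 0 < r := by linarith
  have hcδ : 1 - cos δ ≥ sin δ ^ 2 / 2 := by
    nlinarith [sin_sq_add_cos_sq δ, cos_le_one δ, neg_one_le_cos δ]
  generalize arccos (1 / r) = β at *
  obtain ⟨u, hu⟩ : ∃ u, u = tan ((π / 2 - β) / 2) := ⟨_, rfl⟩
  obtain ⟨hs, hc⟩ := sin_cos_of_tan_half (x := π / 2 - β) (by linarith) (by linarith) hu
  rw [sin_pi_div_two_sub] at hs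
  rw [cos_pi_div_two_sub] at hc
  have hA : arctan u = (π / 2 - β) / 2 := by
    rw [hu]; exact arctan_tan (by linarith) (by linarith)
  have hu0 : 0 < u := by
    rw [hu]; exact tan_pos_of_pos_of_lt_pi_div_two (by linarith) (by linarith)
  have hu1 : u ≤ 1 := by
    rw [← tan_pi_div_four, hu]
    rcases eq_or_ne ((π / 2 - β) / 2) (π / 4) with h | h
    · rw [h]
    · exact (tan_lt_tan_of_lt_of_lt_pi_div_two (by linarith) (by linarith)
        (lt_of_le_of_ne (by linarith) h)).le
  have hu2 : u ≤ 7 / 11 := by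
    have h1 : 1 / r ≤ 77 / 85 := by rw [div_le_iff₀ hr0]; linarith
    rw [← hcβ, hs, div_le_div_iff₀ (by positivity) (by norm_num)] at h1
    by_contra hcon
    push Not at hcon
    nlinarith
  have hru : r = (1 + u ^ 2) / (2 * u) := by
    have h3 := hcβ.symm.trans hs
    field_simp at h3 ⊢
    linarith
  have hγ : π / 2 - β = 2 * arctan u := by linarith
  have hQ : arctan u * (1 + u ^ 2) / (2 * u) - (1 - u ^ 2) / (1 + u ^ 2) / 2
      - u ^ 2 * (2 + (1 - u ^ 2) / (1 + u ^ 2)) / 3 ≤ u ^ 2 * (1 / 3 - 0.285 * u ^ 2) := by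
    have h2 := arctan_le_arctanSum (n := 5) (x := u) (by decide) hu0.le
    norm_num [arctanSum, Finset.sum_range_succ] at h2
    have e : u ^ 2 * (1 / 3 - 0.285 * u ^ 2) - (arctan u * (1 + u ^ 2) / (2 * u)
        - (1 - u ^ 2) / (1 + u ^ 2) / 2 - u ^ 2 * (2 + (1 - u ^ 2) / (1 + u ^ 2)) / 3) =
        (u ^ 2 * (1 / 3 - 0.285 * u ^ 2) + (1 - u ^ 2) / (1 + u ^ 2) / 2
          + u ^ 2 * (2 + (1 - u ^ 2) / (1 + u ^ 2)) / 3)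
          - arctan u * ((1 + u ^ 2) / (2 * u)) := by ring
    rw [← sub_nonneg, e]
    have h3 := mul_le_mul_of_nonneg_right h2 (show 0 ≤ (1 + u ^ 2) / (2 * u) by positivity)
    refine le_trans ?_ (sub_le_sub_left h3 _)
    clear * - hu0 hu2
    obtain ⟨x, hx, rfl⟩ := exists_eq_div_one_add hu0 hu2
    field_simp
    ring_nf
    positivity
  have hq : u ^ 3 * (1 + u ^ 2) * (1 / 3 - 0.285 * u ^ 2) ^ 2 / 2 ≤ 0.0086 := by
    rw [← sub_nonneg]
    clear * - hu0 hu2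
    obtain ⟨x, hx, rfl⟩ := exists_eq_div_one_add hu0 hu2
    field_simp
    ring_nf
    positivity
  have key := lt_of_le_seven_div_eleven hu0 hu2
  have hlog : log (1 + sin β) - log (cos β) = -log u := by
    have h1 : 1 + sin β = 2 / (1 + u ^ 2) := by rw [hc]; field_simp; ring
    rw [← log_div (by rw [h1]; positivity) (by rw [hs]; positivity), ← log_inv, h1, hs]
    congr 1
    field_simp
  have hQ' : r / 2 * (π / 2 - β) - sin β / 2 - r ^ 2 * (2 / 3 - sin β + sin β ^ 3 / 3) ≤
      u ^ 2 * (1 / 3 - 0.285 * u ^ 2) := by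
    refine le_trans (le_of_eq ?_) hQ
    rw [hγ, hc, hru]
    field_simp
    ring
  have hsδ : 0 ≤ sin δ := sin_nonneg_of_nonneg_of_le_pi h0 (by linarith)
  have hm := mul_le_mul_of_nonneg_left hQ' hsδ
  have hP : 1 / (2 * r) = u / (1 + u ^ 2) := by rw [hru]; field_simp
  -- maximize over the direction `(cos δ, sin δ)`
  have hmax : cos δ / (2 * r) + sin δ * (u ^ 2 * (1 / 3 - 0.285 * u ^ 2)) ≤
      u / (1 + u ^ 2) + 0.0086 := by
    set q := u ^ 2 * (1 / 3 - 0.285 * u ^ 2) with hqdef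
    have h1 : r * q ^ 2 ≤ 0.0086 := by
      refine le_trans (le_of_eq ?_) hq
      rw [hru, hqdef]
      field_simp
    have h2 : cos δ / (2 * r) ≤ (1 - sin δ ^ 2 / 2) / (2 * r) :=
      div_le_div_of_nonneg_right (by linarith) (by positivity)
    have h3 : (1 - sin δ ^ 2 / 2) / (2 * r) + sin δ * q =
        1 / (2 * r) + r * q ^ 2 - (sin δ / 2 - r * q) ^ 2 / r := by
      field_simp; ring
    have h4 : 0 ≤ (sin δ / 2 - r * q) ^ 2 / r := by positivity
    linarith
  have e1 : (2 * r + 2 * 1.075) * (π / 2 - β) - (r ^ 2 + 2 * 1.075 * r) * (1 - sin β) =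
      2 * arctan u * (1 + u ^ 2) / u - (1 + u ^ 2) / 2 + 2 * 1.075 * (2 * arctan u - u) := by
    rw [hγ, hc, hru]
    field_simp
    ring
  rw [div_eq_inv_mul, ← one_div]
  have hbig : 2.787 < log (1 + sin β) - log (cos β) + (2 * r + 2 * 1.075) * (π / 2 - β)
      - (r ^ 2 + 2 * 1.075 * r) * (1 - sin β)
      - 1.075 ^ 2 * (cos δ / (2 * r) + sin δ * (r / 2 * (π / 2 - β) - sin β / 2
        - r ^ 2 * (2 / 3 - sin β + sin β ^ 3 / 3))) := by
    linarith
  have hpos : 0 < 1 / π := by positivity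
  rw [ENNReal.ofReal_lt_ofReal_iff (mul_pos hpos (by linarith))]
  exact mul_lt_mul_of_pos_left hbig hpos

/-! ### The value and the gradient near the minimizer -/

section HalfAngle

variable {t u : ℝ}

lemma sin_cos_two_mul_arctan {x : ℝ} (h0 : 0 < x) :
    sin (2 * arctan x) = 2 * x / (1 + x ^ 2) ∧
      cos (2 * arctan x) = (1 - x ^ 2) / (1 + x ^ 2) := by
  have h2 := arctan_pos.mpr h0
  have h3 := arctan_lt_pi_div_two x
  apply sin_cos_of_tan_half (by linarith) (by linarith)
  rw [mul_div_cancel_left₀ _ two_ne_zero, tan_arctan]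

lemma arccos_inv_eq_two_mul_arctan (h0 : 0 < t) :
    arccos (1 / ((1 + t ^ 2) / (1 - t ^ 2))) = 2 * arctan t := by
  rw [one_div_div, ← (sin_cos_two_mul_arctan h0).2, arccos_cos]
  · linarith [arctan_pos.mpr h0]
  · linarith [arctan_lt_pi_div_two t]

/-- The addition formulas at `β = 2 * arctan t` and `δ = 2 * arctan u`. -/
lemma sin_cos_half_angle (h0 : 0 < u) (hut : u < t) :
    (sin (2 * arctan t + 2 * arctan u) = 2 * (t + u) * (1 - t * u) / ((1 + t ^ 2) * (1 + u ^ 2)) ∧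
    cos (2 * arctan t + 2 * arctan u) =
      ((1 - t * u) ^ 2 - (t + u) ^ 2) / ((1 + t ^ 2) * (1 + u ^ 2))) ∧
    sin (2 * arctan t - 2 * arctan u) = 2 * (t - u) * (1 + t * u) / ((1 + t ^ 2) * (1 + u ^ 2)) ∧
    cos (2 * arctan t - 2 * arctan u) =
      ((1 + t * u) ^ 2 - (t - u) ^ 2) / ((1 + t ^ 2) * (1 + u ^ 2)) := by
  obtain ⟨h2, h3⟩ := sin_cos_two_mul_arctan (h0.trans hut)
  obtain ⟨h4, h5⟩ := sin_cos_two_mul_arctan h0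
  rw [sin_add, cos_add, sin_sub, cos_sub, h2, h3, h4, h5]
  refine ⟨⟨?_, ?_⟩, ?_, ?_⟩ <;> field_simp <;> ring

/-- The four combinations of logarithms in `total` and in its gradient. -/
lemma log_half_angle (h0 : 0 < u) (hut : u < t) (h1 : t < 1) :
    cscInt ((1 + t ^ 2) / (1 - t ^ 2)) (2 * arctan u) =
      log ((1 + u) * (1 - t * u) / ((1 - u) * (t + u))) ∧
    log (1 + sin (2 * arctan u)) - log (1 + cos (2 * arctan t - 2 * arctan u)) =
      log ((1 + u) ^ 2 * (1 + t ^ 2) / (2 * (1 + t * u) ^ 2)) ∧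
    log (cos (2 * arctan u)) - log (sin (2 * arctan t - 2 * arctan u)) =
      log ((1 - u) * (1 + t * u) / ((1 + u) * (t - u))) +
        log ((1 + u) ^ 2 * (1 + t ^ 2) / (2 * (1 + t * u) ^ 2)) ∧
    log (1 + sin (2 * arctan t)) - log (cos (2 * arctan t)) = log ((1 + t) / (1 - t)) := by
  have ht0 := h0.trans hut
  obtain ⟨⟨hsw, hcw⟩, hss, hcs⟩ := sin_cos_half_angle h0 hut
  obtain ⟨hsβ, hcβ⟩ := sin_cos_two_mul_arctan ht0
  obtain ⟨hsδ, hcδ⟩ := sin_cos_two_mul_arctan h0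
  have a1 : 0 < 1 - t ^ 2 := by nlinarith
  have a2 : 0 < 1 - u ^ 2 := by nlinarith
  have a3 : 0 < 1 - t * u := by nlinarith
  have a4 : 0 < 1 - u := by linarith
  have a5 : 0 < 1 - t := by linarith
  have a6 : 0 < t - u := by linarith
  have a7 : 0 < 1 + t * u := by positivity
  have e1 : 1 - sin (2 * arctan u) = (1 - u) ^ 2 / (1 + u ^ 2) := by rw [hsδ]; field_simp; ring
  have e2 : 1 + sin (2 * arctan u) = (1 + u) ^ 2 / (1 + u ^ 2) := by rw [hsδ]; field_simp; ring
  have e3 : 1 + cos (2 * arctan t + 2 * arctan u) =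
      2 * (1 - t * u) ^ 2 / ((1 + t ^ 2) * (1 + u ^ 2)) := by rw [hcw]; field_simp; ring
  have e4 : 1 + cos (2 * arctan t - 2 * arctan u) =
      2 * (1 + t * u) ^ 2 / ((1 + t ^ 2) * (1 + u ^ 2)) := by rw [hcs]; field_simp; ring
  have e5 : 1 + sin (2 * arctan t) = (1 + t) ^ 2 / (1 + t ^ 2) := by rw [hsβ]; field_simp; ring
  refine ⟨?_, ?_, ?_, ?_⟩
  · unfold cscInt
    rw [arccos_inv_eq_two_mul_arctan ht0, e1, e3, hcδ, hsw,
      ← log_div (by positivity) (by positivity), ← log_div (by positivity) (by positivity),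
      ← log_mul (by positivity) (by positivity)]
    congr 1
    field_simp
    ring
  · rw [e2, e4, ← log_div (by positivity) (by positivity)]
    congr 1
    field_simp
  · rw [hcδ, hss, ← log_div (by positivity) (by positivity),
      ← log_mul (by positivity) (by positivity)]
    congr 1
    field_simp
    ring
  · rw [e5, hcβ, ← log_div (by positivity) (by positivity)]
    congr 1
    field_simp
    ring

end HalfAngle

/-- The series of `log ((1 + y) / (1 - y))` with a bound for the remainder. -/
lemma log_bounds {X y : ℝ} (n : ℕ) (h0 : 0 ≤ y) (h1 : y < 1) (hX : X * (1 - y) = 1 + y) :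
    2 * ∑ i ∈ Finset.range n, y ^ (2 * i + 1) / (2 * i + 1) ≤ log X ∧
      log X ≤ 2 * (∑ i ∈ Finset.range n, y ^ (2 * i + 1) / (2 * i + 1) +
        y ^ (2 * n + 1) / (1 - y ^ 2)) := by
  have h2 := sum_range_le_log_div h0 h1 n
  have h3 := log_div_le_sum_range_add h0 h1 n
  have : X = (1 + y) / (1 - y) := by rw [eq_div_iff (by linarith), hX]
  rw [← this] at h2 h3
  constructor <;> linarith

lemma log_two_bounds : 0.69314718055994530 < log 2 ∧ log 2 < 0.69314718055994532 := by
  have h := log_bounds (X := 2) (y := 1 / 3) 18 (by norm_num) (by norm_num) (by norm_num)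
  norm_num [Finset.sum_range_succ] at h
  constructor <;> linarith [h.1, h.2]

lemma log_three_bounds : 1.09861228866810968 < log 3 ∧ log 3 < 1.09861228866810971 := by
  have h := log_bounds (X := 3 / 2) (y := 1 / 5) 13 (by norm_num) (by norm_num) (by norm_num)
  rw [log_div (by norm_num) (by norm_num)] at h
  have h2 := log_two_bounds
  norm_num [Finset.sum_range_succ] at h
  constructor <;> linarith [h.1, h.2]

lemma log_five_bounds : 1.60943791243410035 < log 5 ∧ log 5 < 1.60943791243410042 := by
  have h := log_bounds (X := 5 / 4) (y := 1 / 9) 9 (by norm_num) (by norm_num) (by norm_num)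
  rw [show (5 : ℝ) / 4 = 5 / 2 ^ 2 by norm_num, log_div (by norm_num) (by norm_num), log_pow] at h
  have h2 := log_two_bounds
  norm_num [Finset.sum_range_succ] at h
  constructor <;> linarith [h.1, h.2]

/- Numerical values of the four logarithms of `log_half_angle` at a point very close to the
minimizer. A factor `5`, `18` or `3 / 5` is split off to speed up the convergence of the series. -/

lemma log_bounds_cscInt {t u : ℝ} (ht : t = 0.1455174869284891) (hu : u = 0.0989726492487941) :
    1.5926687974324411 < log ((1 + u) * (1 - t * u) / ((1 - u) * (t + u))) ∧
      log ((1 + u) * (1 - t * u) / ((1 - u) * (t + u))) < 1.5926687974324413 := by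
  obtain ⟨X, hX⟩ : ∃ X, X = (1 + u) * (1 - t * u) / ((1 - u) * (t + u)) := ⟨_, rfl⟩
  have h5 := log_five_bounds
  rw [← hX]
  rw [ht, hu] at hX
  norm_num at hX
  have h := log_bounds (X := 5 / X) (y := (5 - X) / (5 + X)) 4 (by rw [hX]; norm_num)
    (by rw [hX]; norm_num) (by rw [hX]; norm_num)
  rw [log_div (by norm_num) (by rw [hX]; norm_num)] at h
  generalize log X = l at *
  rw [hX] at h
  norm_num [Finset.sum_range_succ] at h
  constructor <;> linarith [h.1, h.2]

lemma log_bounds_turn {t u : ℝ} (ht : t = 0.1455174869284891) (hu : u = 0.0989726492487941) :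
    2.8830432497309413 < log ((1 - u) * (1 + t * u) / ((1 + u) * (t - u))) ∧
      log ((1 - u) * (1 + t * u) / ((1 + u) * (t - u))) < 2.8830432497309416 := by
  obtain ⟨X, hX⟩ : ∃ X, X = (1 - u) * (1 + t * u) / ((1 + u) * (t - u)) := ⟨_, rfl⟩
  have h2 := log_two_bounds
  have h3 := log_three_bounds
  rw [← hX]
  rw [ht, hu] at hX
  norm_num at hX
  have h := log_bounds (X := 18 / X) (y := (18 - X) / (18 + X)) 3 (by rw [hX]; norm_num)
    (by rw [hX]; norm_num) (by rw [hX]; norm_num)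
  rw [log_div (by norm_num) (by rw [hX]; norm_num), show (18 : ℝ) = 2 * 3 ^ 2 by norm_num,
    log_mul (by norm_num) (by norm_num), log_pow] at h
  generalize log X = l at *
  rw [hX] at h
  norm_num [Finset.sum_range_succ] at h
  constructor <;> linarith [h.1, h.2]

lemma log_bounds_one_add_sin {t u : ℝ} (ht : t = 0.1455174869284891) (hu : u = 0.0989726492487941) :
    -0.5120403950380918 < log ((1 + u) ^ 2 * (1 + t ^ 2) / (2 * (1 + t * u) ^ 2)) ∧
      log ((1 + u) ^ 2 * (1 + t ^ 2) / (2 * (1 + t * u) ^ 2)) < -0.5120403950380916 := by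
  obtain ⟨X, hX⟩ : ∃ X, X = (1 + u) ^ 2 * (1 + t ^ 2) / (2 * (1 + t * u) ^ 2) := ⟨_, rfl⟩
  have h5 := log_five_bounds
  have h3 := log_three_bounds
  rw [← hX]
  rw [ht, hu] at hX
  norm_num at hX
  have h := log_bounds (X := 3 / 5 / X) (y := (3 / 5 - X) / (3 / 5 + X)) 3 (by rw [hX]; norm_num)
    (by rw [hX]; norm_num) (by rw [hX]; norm_num)
  rw [log_div (by norm_num) (by rw [hX]; norm_num), log_div (by norm_num) (by norm_num)] at h
  generalize log X = l at *
  rw [hX] at h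
  norm_num [Finset.sum_range_succ] at h
  constructor <;> linarith [h.1, h.2]

lemma log_bounds_direct {t : ℝ} (ht : t = 0.1455174869284891) :
    0.2931157297066356 < log ((1 + t) / (1 - t)) ∧
      log ((1 + t) / (1 - t)) < 0.2931157297066358 := by
  have h := log_bounds (X := (1 + t) / (1 - t)) (y := t) 10 (by rw [ht]; norm_num)
    (by rw [ht]; norm_num) (div_mul_cancel₀ _ (by rw [ht]; norm_num))
  generalize log ((1 + t) / (1 - t)) = l at *
  rw [ht] at h
  norm_num [Finset.sum_range_succ] at h
  constructor <;> linarith [h.1, h.2]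

lemma arctan_tan_half_delta_bounds {u : ℝ} (hu : u = 0.0989726492487941) :
    0.09865137040465864 < arctan u ∧ arctan u < 0.09865137040465866 := by
  have h0 : 0 ≤ u := by rw [hu]; norm_num
  have h1 := arctanSum_le_arctan (n := 10) (by decide) h0
  have h2 := arctan_le_arctanSum (n := 11) (by decide) h0
  generalize arctan u = a at *
  rw [hu] at h1 h2
  norm_num [arctanSum, Finset.sum_range_succ] at h1 h2
  constructor <;> linarith

lemma arctan_tan_half_beta_bounds {t : ℝ} (ht : t = 0.1455174869284891) :
    0.144503215231701918 < arctan t ∧ arctan t < 0.144503215231701921 := by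
  have h0 : 0 ≤ t := by rw [ht]; norm_num
  have h1 := arctanSum_le_arctan (n := 10) (by decide) h0
  have h2 := arctan_le_arctanSum (n := 11) (by decide) h0
  generalize arctan t = a at *
  rw [ht] at h1 h2
  norm_num [arctanSum, Finset.sum_range_succ] at h1 h2
  constructor <;> linarith

set_option maxHeartbeats 1000000 in
/-- The value and the gradient of `total` at a point very close to its minimizer. -/
lemma total_bounds {t u r δ : ℝ} (ht : t = 0.1455174869284891) (hu : u = 0.0989726492487941)
    (hr : r = (1 + t ^ 2) / (1 - t ^ 2)) (hδ : δ = 2 * arctan u) :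
    |mainDerivR r δ + turnDerivR r δ| ≤ 1e-13 ∧ |mainDerivD r δ + turnDerivD r δ| ≤ 1e-13 ∧
      2.786488714704 ≤ total r δ ∧ total r δ ≤ 2.786488714705 := by
  have hu0 : 0 < u := by rw [hu]; norm_num
  have hut : u < t := by rw [hu, ht]; norm_num
  have ht1 : t < 1 := by rw [ht]; norm_num
  have ht0 := hu0.trans hut
  obtain ⟨⟨hsw, hcw⟩, hss, hcs⟩ := sin_cos_half_angle hu0 hut
  obtain ⟨hsβ, hcβ⟩ := sin_cos_two_mul_arctan ht0
  obtain ⟨hsδ, hcδ⟩ := sin_cos_two_mul_arctan hu0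
  obtain ⟨l1, l2, l3, l4⟩ := log_half_angle hu0 hut ht1
  have hβ := arccos_inv_eq_two_mul_arctan ht0
  have b1 := log_bounds_cscInt ht hu
  have b2 := log_bounds_turn ht hu
  have b3 := log_bounds_one_add_sin ht hu
  have b4 := log_bounds_direct ht
  have b5 := arctan_tan_half_beta_bounds ht
  have b6 := pi_gt_d20
  have b7 := pi_lt_d20
  have e : total r δ = (log (1 + sin (arccos (1 / r))) - log (cos (arccos (1 / r))))
      + 2 * r * (π / 2 - arccos (1 / r)) - r ^ 2 * (1 - sin (arccos (1 / r)))
      + 1 / 2 * ((1 - (r * cos δ) ^ 2) * cscInt r δ + r ^ 2 * (cos (arccos (1 / r) - δ) - sin δ))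
      + 1 / 2 * ((1 - r * cos δ) ^ 2 * (log (cos δ) - log (sin (arccos (1 / r) - δ)))
        - (1 + (r * cos δ) ^ 2) * (log (1 + sin δ) - log (1 + cos (arccos (1 / r) - δ)))
        + 2 * r * sin δ * (π / 2 - arccos (1 / r))
        - r ^ 2 * (sin δ + cos (arccos (1 / r) + δ))) := by
    unfold total mainPart turnPart cscInt
    ring
  rw [e]
  unfold mainDerivR mainDerivD turnDerivR turnDerivD
  rw [← hr] at l1 hβ
  rw [hβ, hδ, l1, l2, l3, l4, hsw, hcw, hss, hcs, hsβ, hsδ, hcδ, hr]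
  generalize log ((1 + u) * (1 - t * u) / ((1 - u) * (t + u))) = x1 at *
  generalize log ((1 - u) * (1 + t * u) / ((1 + u) * (t - u))) = x2 at *
  generalize log ((1 + u) ^ 2 * (1 + t ^ 2) / (2 * (1 + t * u) ^ 2)) = x3 at *
  generalize log ((1 + t) / (1 - t)) = x4 at *
  generalize arctan t = x5 at *
  generalize π = x6 at *
  clear l1 l2 l3 l4 hβ hsw hcw hss hcs hsβ hcβ hsδ hcδ e hr hδ ht0 ht1 hut hu0
  subst ht hu
  norm_num at b1 b2 b3 b4 b5 b6 b7 ⊢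
  -- everything is linear in the logarithms, the arctangent and `π`, with rational coefficients
  refine ⟨abs_le.mpr ⟨?_, ?_⟩, abs_le.mpr ⟨?_, ?_⟩, ?_, ?_⟩ <;> linarith [b1.1, b1.2, b2.1, b2.2,
    b3.1, b3.2, b4.1, b4.2, b5.1, b5.2]

/-! ### The minimizer -/

lemma lt_arccos_inv_of_le {s ε : ℝ} (hs : 1.04 ≤ s) (hε : ε < 0.2) : ε < arccos (1 / s) := by
  have hp := pi_gt_three
  refine hε.trans_le ?_
  rw [← arccos_cos (x := 0.2) (by norm_num) (by linarith)]
  apply arccos_le_arccos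
  have h1 := one_sub_sq_div_two_le_cos (x := 0.2)
  refine le_trans ?_ h1
  rw [div_le_iff₀ (by linarith)]
  norm_num
  linarith

lemma continuousOn_total :
    ContinuousOn (fun p : ℝ × ℝ => total p.1 p.2)
      {p | 1 < p.1 ∧ 0 < p.2 ∧ p.2 < arccos (1 / p.1)} := by
  have hp := pi_pos
  intro p hp0
  obtain ⟨h1, h2, h3⟩ := hp0
  have hβ := arccos_inv_lt h1.le
  have hβs := sin_arccos_inv_pos h1
  have c0 : p.1 ≠ 0 := by linarith
  have c1 : 1 + sin (arccos (1 / p.1)) ≠ 0 := by linarith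
  have c2 : cos (arccos (1 / p.1)) ≠ 0 := by
    rw [cos_arccos_inv h1.le]; exact one_div_ne_zero c0
  have c3 : cos p.2 ≠ 0 := (cos_pos_of_mem_Ioo ⟨by linarith, by linarith⟩).ne'
  have c4' : 0 < sin (π / 2 - p.2) := sin_pos_of_pos_of_lt_pi (by linarith) (by linarith)
  have c4 : 1 - sin p.2 ≠ 0 := by
    have := one_sub_cos_pos_of_sin_pos c4'
    rw [cos_pi_div_two_sub] at this
    exact this.ne'
  have c5' : 0 < sin (arccos (1 / p.1) + p.2) :=
    sin_pos_of_pos_of_lt_pi (by linarith) (by linarith)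
  have c5 := c5'.ne'
  have c6 := (one_add_cos_pos_of_sin_pos c5').ne'
  have c7' : 0 < sin (arccos (1 / p.1) - p.2) :=
    sin_pos_of_pos_of_lt_pi (by linarith) (by linarith)
  have c7 := c7'.ne'
  have c8 := (one_add_cos_pos_of_sin_pos c7').ne'
  have c9 : 1 + sin p.2 ≠ 0 := by
    have := one_add_cos_pos_of_sin_pos c4'
    rw [cos_pi_div_two_sub] at this
    exact this.ne'
  apply ContinuousAt.continuousWithinAt
  unfold total mainPart turnPart
  fun_prop (disch := assumption)

lemma neg_le_quadratic (x : ℝ) : -1e-25 ≤ 0.025 * x ^ 2 - 1e-13 * x := by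
  have h := sq_nonneg (x - 2e-12)
  norm_num at h ⊢
  linarith

lemma lt_quadratic {x : ℝ} (hx : 6e-12 < x) : 1e-25 < 0.025 * x ^ 2 - 1e-13 * x := by
  norm_num at hx ⊢
  have h := mul_pos (sub_pos.mpr hx) (sub_pos.mpr hx)
  linarith

/-- Existence, uniqueness and location of the minimizer of `total` for `1 < r ≤ 85 / 77`. -/
lemma exists_minimizer_total :
    ∃ r₀ δ₀ : ℝ, |r₀ - 1.04326686861443| ≤ 1e-11 ∧ |δ₀ - 0.19730274080931| ≤ 1.3e-11 ∧
      (2.786488714703 ≤ total r₀ δ₀ ∧ total r₀ δ₀ ≤ 2.786488714705) ∧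
      ∀ s ε : ℝ, 1 < s → s ≤ 85 / 77 → 0 ≤ ε → ε ≤ arccos (1 / s) → (s, ε) ≠ (r₀, δ₀) →
        total r₀ δ₀ < total s ε := by
  -- `(r, δ)` is very close to the critical point; its half-angle tangents are rational
  obtain ⟨t, ht⟩ : ∃ t : ℝ, t = 0.1455174869284891 := ⟨_, rfl⟩
  obtain ⟨u, hu⟩ : ∃ u : ℝ, u = 0.0989726492487941 := ⟨_, rfl⟩
  obtain ⟨r, hr⟩ : ∃ r : ℝ, r = (1 + t ^ 2) / (1 - t ^ 2) := ⟨_, rfl⟩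
  obtain ⟨δ, hδ⟩ : ∃ δ : ℝ, δ = 2 * arctan u := ⟨_, rfl⟩
  obtain ⟨hR, hD, hT1, hT2⟩ := total_bounds ht hu hr hδ
  have hrb : 1.0432668686144308 < r ∧ r < 1.0432668686144309 := by
    rw [hr, ht]; norm_num
  have hδb : 0.19730274080931728 < δ ∧ δ < 0.19730274080931732 := by
    have := arctan_tan_half_delta_bounds hu
    constructor <;> linarith [this.1, this.2]
  clear hr hδ ht hu
  set B : Set (ℝ × ℝ) := Icc (r - 6e-12) (r + 6e-12) ×ˢ Icc (δ - 6e-12) (δ + 6e-12) with hB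
  have hBK : ∀ p ∈ B, 1 < p.1 ∧ p.1 ≤ 85 / 77 ∧ 0 < p.2 ∧ p.2 < arccos (1 / p.1) := by
    rintro p ⟨⟨h1, h2⟩, h3, h4⟩
    norm_num at h1 h2 h3 h4 hrb hδb
    exact ⟨by linarith, by linarith, by linarith,
      lt_arccos_inv_of_le (by norm_num; linarith) (by norm_num; linarith)⟩
  have hpB : (r, δ) ∈ B := by
    refine ⟨⟨?_, ?_⟩, ?_, ?_⟩ <;> norm_num
  have hex : ∃ r₀ δ₀ : ℝ, (r₀, δ₀) ∈ B ∧ ∀ s ε : ℝ, (s, ε) ∈ B → total r₀ δ₀ ≤ total s ε := by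
    obtain ⟨z, hz, hmin⟩ := (isCompact_Icc.prod isCompact_Icc : IsCompact B).exists_isMinOn
      ⟨_, hpB⟩ (continuousOn_total.mono fun p hp => ⟨(hBK p hp).1, (hBK p hp).2.2⟩)
    rw [isMinOn_iff] at hmin
    exact ⟨z.1, z.2, hz, fun s ε h => hmin (s, ε) h⟩
  obtain ⟨r₀, δ₀, hz, hmin⟩ := hex
  obtain ⟨g1, g2, g3, g4⟩ := hBK _ hpB
  have hsupp : ∀ s ε : ℝ, 1 < s → s ≤ 85 / 77 → 0 ≤ ε → ε ≤ arccos (1 / s) →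
      total r δ + (0.025 * |s - r| ^ 2 - 1e-13 * |s - r|) +
        (0.025 * |ε - δ| ^ 2 - 1e-13 * |ε - δ|) ≤ total s ε := by
    intro s ε h1 h2 h3 h4
    have h5 := tangent_add_sq_le_total g1 g2 g3 g4 h1 h2 h3 h4
    have h6 : -(1e-13 * |s - r|) ≤ (s - r) * (mainDerivR r δ + turnDerivR r δ) := by
      have h7 := neg_abs_le ((s - r) * (mainDerivR r δ + turnDerivR r δ))
      rw [abs_mul] at h7
      have := mul_le_mul_of_nonneg_left hR (abs_nonneg (s - r))
      linarith
    have h8 : -(1e-13 * |ε - δ|) ≤ (ε - δ) * (mainDerivD r δ + turnDerivD r δ) := by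
      have h7 := neg_abs_le ((ε - δ) * (mainDerivD r δ + turnDerivD r δ))
      rw [abs_mul] at h7
      have := mul_le_mul_of_nonneg_left hD (abs_nonneg (ε - δ))
      linarith
    rw [sq_abs, sq_abs]
    linarith
  -- each of the two quadratics is at least `-1e-25`, so `total` exceeds its value at `(r, δ)` as soon
  -- as one of them is larger than `1e-25`
  have hlow : ∀ x : ℝ, -1e-25 ≤ 0.025 * x ^ 2 - 1e-13 * x := neg_le_quadratic
  have hbig : ∀ x : ℝ, 6e-12 < x → 1e-25 < 0.025 * x ^ 2 - 1e-13 * x := fun x => lt_quadratic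
  have hle := hmin _ _ hpB
  obtain ⟨k1, k2, k3, k4⟩ := hBK _ hz
  refine ⟨r₀, δ₀, ?_, ?_, ⟨?_, hle.trans hT2⟩, ?_⟩
  · have h1 := hz.1.1
    have h2 := hz.1.2
    norm_num at h1 h2 hrb
    rw [abs_le]
    norm_num
    constructor <;> linarith
  · have h1 := hz.2.1
    have h2 := hz.2.2
    norm_num at h1 h2 hδb
    rw [abs_le]
    norm_num
    constructor <;> linarith
  · have h1 := hsupp r₀ δ₀ k1 k2 k3.le k4.le
    have h2 := hlow |r₀ - r|
    have h3 := hlow |δ₀ - δ|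
    norm_num at h1 h2 h3 hT1 ⊢
    linarith
  · intro s ε h1 h2 h3 h4 hne
    by_cases hsB : (s, ε) ∈ B
    · -- strong convexity at the midpoint `m` of `(s, ε)` and `(r₀, δ₀)`: the gradient terms cancel,
      -- and `total` is not smaller at `m` than at `(r₀, δ₀)`
      have hm : ((s + r₀) / 2, (ε + δ₀) / 2) ∈ B := by
        obtain ⟨⟨a1, a2⟩, a3, a4⟩ := hsB
        obtain ⟨⟨b1, b2⟩, b3, b4⟩ := hz
        dsimp only at a1 a2 a3 a4 b1 b2 b3 b4
        refine ⟨⟨?_, ?_⟩, ?_, ?_⟩ <;> dsimp only <;> linarith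
      obtain ⟨m1, m2, m3, m4⟩ := hBK _ hm
      have e1 := tangent_add_sq_le_total m1 m2 m3 m4 h1 h2 h3 h4
      have e2 := tangent_add_sq_le_total m1 m2 m3 m4 k1 k2 k3.le k4.le
      have e3 : total r₀ δ₀ ≤ total ((s + r₀) / 2) ((ε + δ₀) / 2) := hmin _ _ hm
      have e4 : 0 < (s - r₀) ^ 2 + (ε - δ₀) ^ 2 := by
        by_contra hcon
        push Not at hcon
        have q1 := sq_nonneg (s - r₀)
        have q2 := sq_nonneg (ε - δ₀)
        have a1 : s - r₀ = 0 := pow_eq_zero_iff two_ne_zero |>.mp (le_antisymm (by linarith) q1)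
        have a2 : ε - δ₀ = 0 := pow_eq_zero_iff two_ne_zero |>.mp (le_antisymm (by linarith) q2)
        exact hne (by rw [Prod.mk.injEq]; constructor <;> linarith)
      linarith
    · refine hle.trans_lt ?_
      have h5 := hsupp s ε h1 h2 h3 h4
      have h6 := hlow |s - r|
      have h7 := hlow |ε - δ|
      have h8 : 6e-12 < |s - r| ∨ 6e-12 < |ε - δ| := by
        by_contra hcon
        push Not at hcon
        obtain ⟨a1, a2⟩ := hcon
        rw [abs_le] at a1 a2
        exact hsB ⟨⟨by linarith [a1.1], by linarith [a1.2]⟩, by linarith [a2.1], by linarith [a2.2]⟩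
      rcases h8 with h8 | h8
      · have := hbig _ h8
        linarith
      · have := hbig _ h8
        linarith

/-- The closed form of the expected escape length. -/
lemma expectedEscapeLength_eq_closedForm {μ : Measure (ℝ × ℝ)} (hμ : IsStartLaw μ) {r α : ℝ}
    (hr : 1 < r) (h0 : 0 < π / 2 - α) (h1 : π / 2 - α < arccos (1 / r)) :
    expectedEscapeLength μ r α ≠ ∞ ∧
      π * (expectedEscapeLength μ r α).toReal = closedForm r α := by
  have hp := pi_pos
  obtain ⟨h2, h3⟩ := expectedEscapeLength_eq_total hμ hr.le h0.le h1.le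
  rw [sub_sub_cancel] at h2
  rw [h2]
  refine ⟨ENNReal.ofReal_ne_top, ?_⟩
  rw [ENNReal.toReal_ofReal (by positivity), mul_div_cancel₀ _ hp.ne',
    total_eq_closedForm hr h0 h1, sub_sub_cancel]

/-- Existence, uniqueness and location of the optimal parameters. -/
lemma exists_unique_minimizer :
    ∃ r₀ α₀ L : ℝ,
      (1 < r₀ ∧ 0 < π / 2 - α₀ ∧ π / 2 - α₀ < arccos (1 / r₀)) ∧
      (1.0432668686 ≤ r₀ ∧ r₀ < 1.0432668687) ∧
      (1.3734935859 ≤ α₀ ∧ α₀ < 1.3734935860) ∧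
      (0.8869669056 ≤ L ∧ L < 0.8869669057) ∧
      ∀ μ : Measure (ℝ × ℝ), IsStartLaw μ →
        expectedEscapeLength μ r₀ α₀ = ENNReal.ofReal L ∧
        ∀ r α : ℝ, 0 ≤ r → 0 ≤ α → α ≤ π → (r, α) ≠ (r₀, α₀) →
          expectedEscapeLength μ r₀ α₀ < expectedEscapeLength μ r α := by
  have hp := pi_pos
  obtain ⟨r₀, δ₀, hr₀, hδ₀, ⟨hT1, hT2⟩, hmin⟩ := exists_minimizer_total
  rw [abs_le] at hr₀ hδ₀
  norm_num at hr₀ hδ₀ hT1 hT2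
  have hπ1 := pi_gt_d20
  have hπ2 := pi_lt_d20
  norm_num at hπ1 hπ2
  have hβ₀ : δ₀ < arccos (1 / r₀) :=
    lt_arccos_inv_of_le (by norm_num; linarith) (by norm_num; linarith)
  refine ⟨r₀, π / 2 - δ₀, total r₀ δ₀ / π, ⟨by linarith, by linarith, by linarith⟩,
    ⟨by norm_num; linarith, by norm_num; linarith⟩, ⟨by norm_num; linarith, by norm_num; linarith⟩,
    ⟨?_, ?_⟩, ?_⟩
  · rw [le_div_iff₀ hp]; norm_num; linarith
  · rw [div_lt_iff₀ hp]; norm_num; linarith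
  intro μ hμ
  have hE₀ := (expectedEscapeLength_eq_total hμ (r := r₀) (δ := δ₀) (by linarith) (by linarith)
    hβ₀.le).1
  refine ⟨hE₀, ?_⟩
  -- the comparison in the region `0 ≤ δ ≤ arccos (1 / r)`
  have key : ∀ r δ : ℝ, 1 ≤ r → 0 ≤ δ → δ ≤ arccos (1 / r) → (r, δ) ≠ (r₀, δ₀) →
      expectedEscapeLength μ r₀ (π / 2 - δ₀) < expectedEscapeLength μ r (π / 2 - δ) := by
    intro r δ hr h0 h1 hne
    rw [hE₀]
    rcases le_or_gt r (85 / 77) with hr' | hr'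
    · obtain ⟨h2, h3⟩ := expectedEscapeLength_eq_total hμ hr h0 h1
      rw [h2, ENNReal.ofReal_lt_ofReal_iff (by positivity)]
      apply div_lt_div_of_pos_right _ hp
      rcases hr.eq_or_lt with h4 | h4
      · subst h4
        rw [one_div_one, arccos_one] at h1
        obtain rfl : δ = 0 := le_antisymm h1 h0
        have h5 : total 1 0 = π - 1 + log 2 := by
          unfold total mainPart turnPart
          rw [one_div_one, arccos_one]
          simp
          rw [one_add_one_eq_two]
          ring
        rw [h5]
        have := log_two_gt_d9
        norm_num at this ⊢
        linarith
      · exact hmin r δ h4 hr' h0 h1 hne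
    · refine lt_of_le_of_lt ?_ (lt_expectedEscapeLength_of_large hμ hr'.le h0 h1)
      apply ENNReal.ofReal_le_ofReal
      apply div_le_div_of_nonneg_right _ hp.le
      norm_num
      linarith
  intro r α hr hα0 hα1 hne
  obtain ⟨δ, rfl⟩ : ∃ δ, α = π / 2 - δ := ⟨π / 2 - α, by ring⟩
  have hδ : |δ| ≤ π / 2 := abs_le.mpr ⟨by linarith, by linarith⟩
  rcases lt_or_ge (r * cos δ) 1 with h1 | h1
  · rw [expectedEscapeLength_eq_top hμ hr hδ h1, hE₀]
    exact ENNReal.ofReal_lt_top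
  · have hr1 : 1 ≤ r := h1.trans (mul_le_of_le_one_right hr (cos_le_one δ))
    have h2 : |δ| ≤ arccos (1 / r) := by
      rw [← arccos_cos (abs_nonneg δ) (by linarith), cos_abs]
      apply arccos_le_arccos
      rw [div_le_iff₀ (by linarith)]
      linarith
    rcases le_or_gt 0 δ with h3 | h3
    · rw [abs_of_nonneg h3] at h2
      refine key r δ hr1 h3 h2 fun h => hne ?_
      rw [Prod.mk.injEq] at h ⊢
      exact ⟨h.1, by rw [h.2]⟩
    · rw [abs_of_neg h3] at h2
      have h4 := expectedEscapeLength_lt_of_neg hμ hr1 (neg_pos.mpr h3) h2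
      rw [neg_neg] at h4
      refine lt_of_le_of_lt ?_ h4
      rcases eq_or_ne (r, -δ) (r₀, δ₀) with h | h
      · rw [Prod.mk.injEq] at h
        rw [h.1, h.2]
      · exact (key r (-δ) hr1 (by linarith) h2 h).le

end LostAtSea

end

theorem mainTheorem2 :
    (∀ μ : Measure (ℝ × ℝ), LostAtSea.IsStartLaw μ →
      ∀ r α : ℝ, 1 < r → 0 < π / 2 - α → π / 2 - α < arccos (1 / r) →
        LostAtSea.expectedEscapeLength μ r α ≠ ∞ ∧
        π * (LostAtSea.expectedEscapeLength μ r α).toReal = LostAtSea.closedForm r α) ∧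
    ∃ r₀ α₀ L : ℝ,
      (1 < r₀ ∧ 0 < π / 2 - α₀ ∧ π / 2 - α₀ < arccos (1 / r₀)) ∧
      (1.0432668686 ≤ r₀ ∧ r₀ < 1.0432668687) ∧
      (1.3734935859 ≤ α₀ ∧ α₀ < 1.3734935860) ∧
      (0.8869669056 ≤ L ∧ L < 0.8869669057) ∧
      ∀ μ : Measure (ℝ × ℝ), LostAtSea.IsStartLaw μ →
        LostAtSea.expectedEscapeLength μ r₀ α₀ = ENNReal.ofReal L ∧
        ∀ r α : ℝ, 0 ≤ r → 0 ≤ α → α ≤ π → (r, α) ≠ (r₀, α₀) →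
          LostAtSea.expectedEscapeLength μ r₀ α₀ < LostAtSea.expectedEscapeLength μ r α := by
  exact ⟨fun μ hμ r α => LostAtSea.expectedEscapeLength_eq_closedForm hμ,
    LostAtSea.exists_unique_minimizer⟩
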